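/- Let $(M^{2n+1},\Phi,\xi,\eta,g)$ be an almost contact metric manifold with Riemannian connection $\nabla$, that is, $\eta=g(\cdot,\xi)$, $\Phi\xi=0$, $\eta(\xi)=1$, $\eta\circ\Phi=0$, $\Phi^2=-\mathrm{id}+\eta\otimes\xi$, $g(\Phi X,\Phi Y)=g(X,Y)-\eta(X)\eta(Y)$. Suppose that it is of Kenmotsu type: $\nabla_X(\Phi)Y-\nabla_{\Phi X}(\Phi)\Phi Y=-\eta(Y)\Phi X$ for all $X,Y$. Let $R(X,Y)Z=\nabla_X\nabla_YZ-\nabla_Y\nabla_XZ-\nabla_{[X,Y]}Z$, let $r(X,Y)=\operatorname{tr}(Z\mapsto R(Z,X)Y)$ be the Ricci tensor and $s$ the scalar curvature, and let $a_0,a_1,a_2$ be scalars (real functions on $M$, for instance constants) with $a_0,a_1$ nowhere zero. Put $R(X,Y,Z,W)=g(R(Z,W)Y,X)$ and let $$\begin{aligned}B(X,Y,Z,W)={}&a_0R(X,Y,Z,W)+a_1\{g(X,Z)r(Y,W)-g(X,W)r(Y,Z)+r(X,Z)g(Y,W)-r(X,W)g(Y,Z)\}\\&+2a_2s\{g(X,Z)g(Y,W)-g(X,W)g(Y,Z)\}\end{aligned}$$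 be the generalized curvature tensor. An A-frame over an open set consists of $\xi$, $\varepsilon_a=\frac1{\sqrt2}(e_a-\sqrt{-1}\,\Phi e_a)$ and $\varepsilon_{\hat a}=\frac1{\sqrt2}(e_a+\sqrt{-1}\,\Phi e_a)$ for $1\le a\le n$, where $\xi,e_1,\dots,e_n,\Phi e_1,\dots,\Phi e_n$ is a smooth orthonormal frame. Write $\omega,\omega^a,\omega_a$ for the dual forms of $\xi,\varepsilon_a,\varepsilon_{\hat a}$, $\omega^a_b$ for the coefficient of $\varepsilon_a$ in $\nabla\varepsilon_b$, and $\Phi^i_{j,k}$ for the components of $\nabla\Phi$. Repeated indices $h,c,d$ are summed in the following definitions: $B^{ab}_{c}=-\frac{\sqrt{-1}}2\Phi^a_{\hat b,c}$; $B_{ab}^{c}=\frac{\sqrt{-1}}2\Phi^{\hat a}_{b,\hat c}$; $B^{ab}_{cd}$ is the coefficient of $\omega^d$ in $dB^{ab}_{c}+B^{hb}_{c}\omega^a_h+B^{ah}_{c}\omega^b_h-B^{ab}_{h}\omega^h_c$; and $A^{ad}_{bc}$, $A^a_{bcd}=-A^a_{bdc}$ are the structure functions in $$d\omega^a_b+\omega^a_h\wedge\omega^h_b=A^{ad}_{bc}\,\omega^c\wedge\omega_d+A^a_{bcd}\,\omega^c\wedge\omega^d+A^{acd}_b\,\omega_c\wedge\omega_d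 .$$ Then $B$ vanishes identically if and only if $M$ is $\eta$-Einstein, $r=\lambda g+\mu\,\eta\otimes\eta$, with the scalars $$\lambda=\frac{a_0+2na_1-2a_2s}{a_1},\qquad \mu=-(2n+\lambda),$$ and in addition, for every A-frame and all indices $a,b,c,d$, $$A^a_{bcd}=0,\qquad A^{ad}_{bc}=\sum_h B^{ah}_{c}B_{bh}^{d}+\frac{a_1}{a_0}\mu\,\delta^a_c\delta^d_b,\qquad B^{ab}_{[cd]}=\frac{a_1}{a_0}\mu\,\delta^a_{[c}\delta^b_{d]},$$ where $[cd]$ denotes antisymmetrization with the factor $\frac12$. -/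

import Mathlib

open Bundle
open scoped Manifold ContDiff

noncomputable section

namespace Kenmotsu

/-! ### The Riemannian connection and its curvature -/

section Riemannian

variable {E : Type*} [NormedAddCommGroup E] [NormedSpace ℝ E] [FiniteDimensional ℝ E]
  {M : Type*} [TopologicalSpace M] [ChartedSpace E M] [IsManifold 𝓘(ℝ, E) ∞ M]
  [RiemannianBundle (fun p : M ↦ TangentSpace 𝓘(ℝ, E) p)]
  [IsContMDiffRiemannianBundle 𝓘(ℝ, E) ∞ E (fun p : M ↦ TangentSpace 𝓘(ℝ, E) p)]

/-- `D` is the Riemannian (Levi-Civita) connection: metric, i.e.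
`v g(Y, Z) = g(∇_v Y, Z) + g(Y, ∇_v Z)`, and torsion-free. Recall that `D Y p (X p)` is `(∇_X Y)(p)`. -/
structure IsRiemannianConnection
    (D : CovariantDerivative 𝓘(ℝ, E) E (fun p : M ↦ TangentSpace 𝓘(ℝ, E) p)) : Prop where
  metric : ∀ {p : M} {Y Z : Π p : M, TangentSpace 𝓘(ℝ, E) p},
    MDifferentiableAt 𝓘(ℝ, E) (𝓘(ℝ, E).prod 𝓘(ℝ, E))
      (fun q ↦ TotalSpace.mk' E (E := fun p : M ↦ TangentSpace 𝓘(ℝ, E) p) q (Y q)) p →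
    MDifferentiableAt 𝓘(ℝ, E) (𝓘(ℝ, E).prod 𝓘(ℝ, E))
      (fun q ↦ TotalSpace.mk' E (E := fun p : M ↦ TangentSpace 𝓘(ℝ, E) p) q (Z q)) p →
    ∀ v : TangentSpace 𝓘(ℝ, E) p,
      mvfderiv 𝓘(ℝ, E) (fun q ↦ (inner ℝ (Y q) (Z q) : ℝ)) p v
        = inner ℝ (D Y p v) (Z p) + inner ℝ (Y p) (D Z p v)
  torsion_free : D.torsion = 0

variable (D : CovariantDerivative 𝓘(ℝ, E) E (fun p : M ↦ TangentSpace 𝓘(ℝ, E) p))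

/-- The Riemann curvature `R(X, Y)Z = ∇_X ∇_Y Z - ∇_Y ∇_X Z - ∇_[X,Y] Z` of vector fields. -/
def curvatureField (X Y Z : Π p : M, TangentSpace 𝓘(ℝ, E) p) (p : M) : TangentSpace 𝓘(ℝ, E) p :=
  D (fun q ↦ D Z q (Y q)) p (X p) - D (fun q ↦ D Z q (X q)) p (Y p)
    - D Z p (VectorField.mlieBracket 𝓘(ℝ, E) X Y p)

/-- The curvature tensor `R(x, y)z` on tangent vectors at `p`, computed with
extensions of `x`, `y`, `z` to vector fields that are smooth near `p`. -/
def curvature (p : M) (x y z : TangentSpace 𝓘(ℝ, E) p) : TangentSpace 𝓘(ℝ, E) p :=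
  curvatureField D (FiberBundle.extend E x) (FiberBundle.extend E y) (FiberBundle.extend E z) p

instance (p : M) : FiniteDimensional ℝ (TangentSpace 𝓘(ℝ, E) p) :=
  inferInstanceAs (FiniteDimensional ℝ E)

/-- The Ricci tensor `r(x, y) = tr (z ↦ R(z, x)y)`; the trace is taken in an orthonormal basis. -/
def ricci (p : M) (x y : TangentSpace 𝓘(ℝ, E) p) : ℝ :=
  ∑ i, inner ℝ (curvature D p (stdOrthonormalBasis ℝ (TangentSpace 𝓘(ℝ, E) p) i) x y)
    (stdOrthonormalBasis ℝ (TangentSpace 𝓘(ℝ, E) p) i)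

/-- The scalar curvature `s`, the trace of the Ricci tensor. -/
def scalarCurvature (p : M) : ℝ :=
  ∑ i, ricci D p (stdOrthonormalBasis ℝ (TangentSpace 𝓘(ℝ, E) p) i)
    (stdOrthonormalBasis ℝ (TangentSpace 𝓘(ℝ, E) p) i)

/-- The `(4,0)` curvature tensor `R(x, y, z, w) = g(R(z, w)y, x)`. -/
def curvature₄ (p : M) (x y z w : TangentSpace 𝓘(ℝ, E) p) : ℝ :=
  inner ℝ (curvature D p z w y) x

/-- The generalized curvature tensor `B` at the point `p`, for the values `a₀`, `a₁`, `a₂` of the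
coefficients at `p`. -/
def generalizedCurvature (a₀ a₁ a₂ : ℝ) (p : M) (x y z w : TangentSpace 𝓘(ℝ, E) p) : ℝ :=
  a₀ * curvature₄ D p x y z w
    + a₁ * (inner ℝ x z * ricci D p y w - inner ℝ x w * ricci D p y z
        + ricci D p x z * inner ℝ y w - ricci D p x w * inner ℝ y z)
    + 2 * a₂ * scalarCurvature D p * (inner ℝ x z * inner ℝ y w - inner ℝ x w * inner ℝ y z)

/-- The covariant derivative `(∇_x Φ)y` of a field of endomorphisms `Φ`, at tangent vectors. -/
def covDerivEndo (Φ : Π p : M, TangentSpace 𝓘(ℝ, E) p →L[ℝ] TangentSpace 𝓘(ℝ, E) p)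
    (p : M) (x y : TangentSpace 𝓘(ℝ, E) p) : TangentSpace 𝓘(ℝ, E) p :=
  D (fun q ↦ Φ q (FiberBundle.extend E y q)) p x - Φ p (D (FiberBundle.extend E y) p x)

end Riemannian

/-! ### Almost contact metric manifolds -/

section AlmostContact

variable {E : Type*} [NormedAddCommGroup E] [NormedSpace ℝ E] [FiniteDimensional ℝ E]
  {M : Type*} [TopologicalSpace M] [ChartedSpace E M] [IsManifold 𝓘(ℝ, E) ∞ M]
  [RiemannianBundle (fun p : M ↦ TangentSpace 𝓘(ℝ, E) p)]
  [IsContMDiffRiemannianBundle 𝓘(ℝ, E) ∞ E (fun p : M ↦ TangentSpace 𝓘(ℝ, E) p)]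

variable (E M) in
/-- An almost contact metric structure `(Φ, ξ, η, g)` on a Riemannian manifold `(M, g)`; the
form `η = g(·, ξ)` is determined by `ξ` and written out here. -/
structure AlmostContactMetric where
  /-- the structure endomorphism -/
  Φ : Π p : M, TangentSpace 𝓘(ℝ, E) p →L[ℝ] TangentSpace 𝓘(ℝ, E) p
  /-- the characteristic vector field -/
  ξ : Π p : M, TangentSpace 𝓘(ℝ, E) p
  smooth_Φ : ContMDiff 𝓘(ℝ, E) (𝓘(ℝ, E).prod 𝓘(ℝ, E →L[ℝ] E)) ∞
    (fun p ↦ TotalSpace.mk' (E →L[ℝ] E)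
      (E := fun p : M ↦ TangentSpace 𝓘(ℝ, E) p →L[ℝ] TangentSpace 𝓘(ℝ, E) p) p (Φ p))
  smooth_ξ : ContMDiff 𝓘(ℝ, E) (𝓘(ℝ, E).prod 𝓘(ℝ, E)) ∞
    (fun p ↦ TotalSpace.mk' E (E := fun p : M ↦ TangentSpace 𝓘(ℝ, E) p) p (ξ p))
  Φ_ξ : ∀ p, Φ p (ξ p) = 0
  η_ξ : ∀ p, inner ℝ (ξ p) (ξ p) = (1 : ℝ)
  η_Φ : ∀ p (x : TangentSpace 𝓘(ℝ, E) p), inner ℝ (Φ p x) (ξ p) = (0 : ℝ)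
  Φ_Φ : ∀ p (x : TangentSpace 𝓘(ℝ, E) p), Φ p (Φ p x) = -x + (inner ℝ x (ξ p) : ℝ) • ξ p
  g_Φ_Φ : ∀ p (x y : TangentSpace 𝓘(ℝ, E) p),
    inner ℝ (Φ p x) (Φ p y) = (inner ℝ x y : ℝ) - inner ℝ x (ξ p) * inner ℝ y (ξ p)

namespace AlmostContactMetric

variable (S : AlmostContactMetric E M)
  (D : CovariantDerivative 𝓘(ℝ, E) E (fun p : M ↦ TangentSpace 𝓘(ℝ, E) p))

/-- The contact form `η(x) = g(x, ξ)`. -/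
def η (p : M) (x : TangentSpace 𝓘(ℝ, E) p) : ℝ := inner ℝ x (S.ξ p)

/-- The class of Kenmotsu type: `∇_X(Φ)Y - ∇_{ΦX}(Φ)ΦY = -η(Y)ΦX`. -/
def IsKenmotsuType : Prop :=
  ∀ (p : M) (x y : TangentSpace 𝓘(ℝ, E) p),
    covDerivEndo D S.Φ p x y - covDerivEndo D S.Φ p (S.Φ p x) (S.Φ p y) = -(S.η p y • S.Φ p x)

/-- `M` is `η`-Einstein with scalars `lam` and `mu`: `r = lam g + mu η ⊗ η`. -/
def IsEtaEinsteinWith (lam mu : M → ℝ) : Prop :=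
  ∀ (p : M) (x y : TangentSpace 𝓘(ℝ, E) p),
    ricci D p x y = lam p * inner ℝ x y + mu p * (S.η p x * S.η p y)

end AlmostContactMetric

/-! ### Complexification -/

/-- The elements `re + √-1 im` of the complexification of a real vector space `V`
(a tangent space, or the space of vector fields). -/
@[ext] structure Cplx (V : Type*) where
  re : V
  im : V

/-- The complex linear extension of a real linear map `f : V → ℂ`. -/
def cext {V : Type*} (f : V → ℂ) (z : Cplx V) : ℂ := f z.re + Complex.I * f z.im

/-- The value at `p` of a complex vector field. -/
def Cplx.at (Z : Cplx (Π p : M, TangentSpace 𝓘(ℝ, E) p)) (p : M) :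
    Cplx (TangentSpace 𝓘(ℝ, E) p) := ⟨Z.re p, Z.im p⟩

namespace AlmostContactMetric

/-! ### The associated G-structure

A section over an open set `U` of the associated G-structure space is an A-frame
`(ξ, ε_1, …, ε_n, ε_1̂, …, ε_n̂)`, where `ε_a = (e_a - √-1 Φ e_a)/√2`, `ε_â = (e_a + √-1 Φ e_a)/√2`
and `ξ, e_1, …, e_n, Φ e_1, …, Φ e_n` is orthonormal; equivalently `g_{âb} = δ^a_b`, `g_{ab} = 0`
and `g_{a0} = 0`. It is recorded by the real fields `e_a`. -/

variable (S : AlmostContactMetric E M)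
  (D : CovariantDerivative 𝓘(ℝ, E) E (fun p : M ↦ TangentSpace 𝓘(ℝ, E) p))

/-- `e` generates a smooth A-frame over the open set `U`
(for `M` of dimension `2 n + 1`). -/
structure IsAFrame {n : ℕ} (U : Set M) (e : Fin n → Π p : M, TangentSpace 𝓘(ℝ, E) p) : Prop where
  isOpen : IsOpen U
  smooth : ∀ a, ContMDiffOn 𝓘(ℝ, E) (𝓘(ℝ, E).prod 𝓘(ℝ, E)) ∞
    (fun p ↦ TotalSpace.mk' E (E := fun p : M ↦ TangentSpace 𝓘(ℝ, E) p) p (e a p)) U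
  inner_ξ : ∀ p ∈ U, ∀ a, inner ℝ (e a p) (S.ξ p) = (0 : ℝ)
  inner_e : ∀ p ∈ U, ∀ a b, inner ℝ (e a p) (e b p) = if a = b then (1 : ℝ) else 0
  inner_Φ : ∀ p ∈ U, ∀ a b, inner ℝ (e a p) (S.Φ p (e b p)) = (0 : ℝ)

variable {n : ℕ} (e : Fin n → Π p : M, TangentSpace 𝓘(ℝ, E) p)

/-- `ε_a = (e_a - √-1 Φ e_a)/√2`. -/
def eps (a : Fin n) : Cplx (Π p : M, TangentSpace 𝓘(ℝ, E) p) :=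
  ⟨fun p ↦ (1 / √2 : ℝ) • e a p, fun p ↦ -((1 / √2 : ℝ) • S.Φ p (e a p))⟩

/-- `ε_â = (e_a + √-1 Φ e_a)/√2`. -/
def epsBar (a : Fin n) : Cplx (Π p : M, TangentSpace 𝓘(ℝ, E) p) :=
  ⟨fun p ↦ (1 / √2 : ℝ) • e a p, fun p ↦ (1 / √2 : ℝ) • S.Φ p (e a p)⟩

/-- The connection forms `ω^a_b(v)`, the coefficient of `ε_a` in `∇_v ε_b`. Since
`g(ε_a, ε_â) = 1` and `ε_â` is orthogonal to the other members of the A-frame,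
it is `g(∇_v ε_b, ε_â)`, all maps being extended complex linearly. -/
def connForm (a b : Fin n) (p : M) (v : TangentSpace 𝓘(ℝ, E) p) : ℂ :=
  cext (fun Y ↦ cext (fun Z ↦ ((inner ℝ (D Y p v) (Z p) : ℝ) : ℂ)) (S.epsBar e a)) (S.eps e b)

/-- The 2-forms `dω^a_b + ω^a_h ∧ ω^h_b` on real vector fields. -/
def curvForm (a b : Fin n) (p : M) (X Y : Π p : M, TangentSpace 𝓘(ℝ, E) p) : ℂ :=
  mvfderiv 𝓘(ℝ, E) (fun q ↦ S.connForm D e a b q (Y q)) p (X p)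
    - mvfderiv 𝓘(ℝ, E) (fun q ↦ S.connForm D e a b q (X q)) p (Y p)
    - S.connForm D e a b p (VectorField.mlieBracket 𝓘(ℝ, E) X Y p)
    + ∑ h, (S.connForm D e a h p (X p) * S.connForm D e h b p (Y p)
        - S.connForm D e a h p (Y p) * S.connForm D e h b p (X p))

/-- The complex bilinear extension of `curvForm` to complex vector fields. -/
def curvFormC (a b : Fin n) (p : M) (X Y : Cplx (Π p : M, TangentSpace 𝓘(ℝ, E) p)) : ℂ :=
  cext (fun x ↦ cext (fun y ↦ S.curvForm D e a b p x y) Y) X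

/-- The structure functions `A^{ad}_{bc}`, defined by the second group of structure equations
`dω^a_b + ω^a_h ∧ ω^h_b = A^{ad}_{bc} ω^c ∧ ω_d + A^a_{bcd} ω^c ∧ ω^d + A^{acd}_b ω_c ∧ ω_d`,
where `ω^c` and `ω_d = ω^d̂` are dual to `ε_c` and `ε_d̂`. -/
def A₂₂ (a d b c : Fin n) (p : M) : ℂ :=
  S.curvFormC D e a b p (S.eps e c) (S.epsBar e d)

/-- The structure functions `A^a_{bcd} = -A^a_{bdc}` of the same equations. -/
def A₁₃ (a b c d : Fin n) (p : M) : ℂ :=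
  (1 / 2) * S.curvFormC D e a b p (S.eps e c) (S.eps e d)

/-- The first structure (Kirichenko) tensor `B^{ab}_c = -(√-1/2) Φ^a_{b̂,c}`, where `Φ^a_{b̂,c}` is
the coefficient of `ε_a` in `∇_{ε_c}(Φ) ε_b̂`. -/
def Bup (a b c : Fin n) (p : M) : ℂ :=
  -(Complex.I / 2) * cext (fun x ↦ cext (fun y ↦ cext (fun z ↦
    ((inner ℝ (covDerivEndo D S.Φ p x y) z : ℝ) : ℂ))
      ((S.epsBar e a).at p)) ((S.epsBar e b).at p)) ((S.eps e c).at p)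

/-- The conjugate tensor `B_{ab}^c = (√-1/2) Φ^â_{b,ĉ}`, where `Φ^â_{b,ĉ}` is the coefficient of
`ε_â` in `∇_{ε_ĉ}(Φ) ε_b`. -/
def Bdown (a b c : Fin n) (p : M) : ℂ :=
  (Complex.I / 2) * cext (fun x ↦ cext (fun y ↦ cext (fun z ↦
    ((inner ℝ (covDerivEndo D S.Φ p x y) z : ℝ) : ℂ))
      ((S.eps e a).at p)) ((S.eps e b).at p)) ((S.epsBar e c).at p)

/-- The structure functions `B^{ab}_{cd}`, the coefficients of `ω^d` in the 1-forms
`dB^{ab}_c + B^{hb}_c ω^a_h + B^{ah}_c ω^b_h - B^{ab}_h ω^h_c`. -/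
def B₂₂ (a b c d : Fin n) (p : M) : ℂ :=
  cext (fun v : TangentSpace 𝓘(ℝ, E) p ↦
    mvfderiv 𝓘(ℝ, E) (fun q ↦ S.Bup D e a b c q) p v
      + ∑ h, (S.Bup D e h b c p * S.connForm D e a h p v
        + S.Bup D e a h c p * S.connForm D e b h p v
        - S.Bup D e a b h p * S.connForm D e h c p v))
    ((S.eps e d).at p)

end AlmostContactMetric

end AlmostContact

/-- Kronecker's delta. -/
def delta {n : ℕ} (a b : Fin n) : ℂ := if a = b then 1 else 0

end Kenmotsu

end

/-! On a manifold of Kenmotsu type the curvature is rigid in the direction ξ. The defining identity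
at Y = ξ gives ∇_v ξ = v - η(v)ξ (`cov_ξ`), hence R(x, y)ξ = η(x)y - η(y)x (`curvature_ξ`) and r(ξ,
·) = r(·, ξ) = -2nη (`ricci_ξ_left`, `ricci_ξ_right`). In B(x, ξ, y, ξ) everything but r(x, y) is
therefore known, and as a₁ ≠ 0 the equation B(x, ξ, y, ξ) = 0 can be solved for r(x, y). The
solution is the η-Einstein condition with the stated λ and μ
(`ricci_eq_of_generalizedCurvature_eq_zero`).

Once r has this form, B is a₀ times the deviation `curvDev` of R from an explicit tensor `modelCurv`
in g, η and κ = a₁μ/a₀ (`generalizedCurvature_eq`). So B = 0 amounts to the vanishing of this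
deviation.

The deviation has the skew and pair symmetries of a curvature tensor and vanishes as soon as one
argument is ξ. It is thus determined by its complex components in a single A-frame, and up to
symmetries and complex conjugation these are of four types (`IsAFrameAt.eq_zero_of_components`). The
components on four vectors ε vanish on every manifold of Kenmotsu type (`IsAFrameNear.ccurv_eps`).
The other three types measure how far A^a_{bcd}, B^{ab}_{[cd]} and A^{ad}_{bc} are from the
prescribed values (`A₁₃_eq_curvDev`, `B₂₂_sub_eq_curvDev`, `A₂₂_eq_curvDev`).

These formulas come from writing R through the coefficients g(∇_X Z, W) in an A-frame. The Kronecker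
deltas arise from the ξ-component of ∇ε, since g(∇_v ε, ξ) = -g(ε, v). The coefficients with X, Z, W
of one type vanish (`conn₃_eq_zero`), and those with X of the opposite type to both Z and W are the
Kirichenko tensors (`Bup_eq`, `Bdown_eq`).

The preliminaries derive the symmetries of R from the axioms of the Riemannian connection, together
with the local existence of A-frames and the smoothness of ∇. -/

noncomputable section

namespace Kenmotsu

open Filter Topology

set_option linter.unusedSectionVars false

/-! ### Vector fields and functions smooth near a point. -/

section SmoothGerms

variable {E : Type*} [NormedAddCommGroup E] [NormedSpace ℝ E] [FiniteDimensional ℝ E]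
  {M : Type*} [TopologicalSpace M] [ChartedSpace E M] [IsManifold 𝓘(ℝ, E) ∞ M]

variable (E M) in
/-- Vector fields on `M`, without any regularity. -/
abbrev VField := Π p : M, TangentSpace 𝓘(ℝ, E) p

/-- The vector field `X` is smooth on a neighbourhood of `p`. -/
def SmoothNear (X : VField E M) (p : M) : Prop :=
  ∀ᶠ q in 𝓝 p, ContMDiffAt 𝓘(ℝ, E) (𝓘(ℝ, E).prod 𝓘(ℝ, E)) ∞
    (fun q ↦ TotalSpace.mk' E (E := fun p : M ↦ TangentSpace 𝓘(ℝ, E) p) q (X q)) q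

variable (E) in
/-- The function `f` is smooth on a neighbourhood of `p`. -/
def SmoothFnNear (f : M → ℝ) (p : M) : Prop :=
  ∀ᶠ q in 𝓝 p, ContMDiffAt 𝓘(ℝ, E) 𝓘(ℝ) ∞ f q

variable {X Y Z : VField E M} {f g : M → ℝ} {p : M}

lemma SmoothNear.contMDiffAt (h : SmoothNear X p) :
    ContMDiffAt 𝓘(ℝ, E) (𝓘(ℝ, E).prod 𝓘(ℝ, E)) ∞
      (fun q ↦ TotalSpace.mk' E (E := fun p : M ↦ TangentSpace 𝓘(ℝ, E) p) q (X q)) p :=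
  h.self_of_nhds

lemma SmoothNear.mdiff (h : SmoothNear X p) :
    MDifferentiableAt 𝓘(ℝ, E) (𝓘(ℝ, E).prod 𝓘(ℝ, E))
      (fun q ↦ TotalSpace.mk' E (E := fun p : M ↦ TangentSpace 𝓘(ℝ, E) p) q (X q)) p :=
  h.contMDiffAt.mdifferentiableAt (by simp)

lemma SmoothNear.eventually (h : SmoothNear X p) : ∀ᶠ q in 𝓝 p, SmoothNear X q :=
  eventually_eventually_nhds.2 h

lemma SmoothFnNear.eventually (h : SmoothFnNear E f p) : ∀ᶠ q in 𝓝 p, SmoothFnNear E f q :=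
  eventually_eventually_nhds.2 h

lemma SmoothFnNear.contMDiffAt (h : SmoothFnNear E f p) : ContMDiffAt 𝓘(ℝ, E) 𝓘(ℝ) ∞ f p :=
  h.self_of_nhds

lemma SmoothFnNear.mdiff (h : SmoothFnNear E f p) : MDifferentiableAt 𝓘(ℝ, E) 𝓘(ℝ) f p :=
  h.contMDiffAt.mdifferentiableAt (by simp)

lemma SmoothNear.congr (h : SmoothNear X p) (hXY : ∀ᶠ q in 𝓝 p, X q = Y q) :
    SmoothNear Y p := by
  filter_upwards [h, eventually_eventually_nhds.2 hXY] with q hq hq'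
  refine hq.congr_of_eventuallyEq ?_
  filter_upwards [hq'] with r hr
  rw [hr]

lemma SmoothFnNear.congr (h : SmoothFnNear E f p) (hfg : ∀ᶠ q in 𝓝 p, f q = g q) :
    SmoothFnNear E g p := by
  filter_upwards [h, eventually_eventually_nhds.2 hfg] with q hq hq'
  refine hq.congr_of_eventuallyEq ?_
  filter_upwards [hq'] with r hr
  rw [hr]

lemma SmoothNear.add (hX : SmoothNear X p) (hY : SmoothNear Y p) : SmoothNear (X + Y) p := by
  filter_upwards [hX, hY] with q hq hq'
  exact hq.add_section hq'

lemma SmoothNear.sub (hX : SmoothNear X p) (hY : SmoothNear Y p) : SmoothNear (X - Y) p := by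
  filter_upwards [hX, hY] with q hq hq'
  exact hq.sub_section hq'

lemma SmoothNear.neg (hX : SmoothNear X p) : SmoothNear (-X) p := by
  filter_upwards [hX] with q hq
  exact hq.neg_section

lemma SmoothNear.smul (hf : SmoothFnNear E f p) (hX : SmoothNear X p) :
    SmoothNear (f • X) p := by
  filter_upwards [hf, hX] with q hq hq'
  exact hq.smul_section hq'

lemma SmoothNear.sum {ι : Type*} {s : Finset ι} {X : ι → VField E M}
    (hX : ∀ i ∈ s, SmoothNear (X i) p) : SmoothNear (fun q ↦ ∑ i ∈ s, X i q) p := by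
  have h : ∀ᶠ q in 𝓝 p, ∀ i ∈ s, ContMDiffAt 𝓘(ℝ, E) (𝓘(ℝ, E).prod 𝓘(ℝ, E)) ∞
      (fun q ↦ TotalSpace.mk' E (E := fun p : M ↦ TangentSpace 𝓘(ℝ, E) p) q (X i q)) q :=
    (Finset.eventually_all s).2 hX
  filter_upwards [h] with q hq
  exact ContMDiffAt.sum_section hq

lemma SmoothFnNear.const (c : ℝ) : SmoothFnNear E (fun _ : M ↦ c) p :=
  Eventually.of_forall fun _ ↦ contMDiffAt_const

lemma SmoothFnNear.add (hf : SmoothFnNear E f p) (hg : SmoothFnNear E g p) :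
    SmoothFnNear E (f + g) p := by
  filter_upwards [hf, hg] with q hq hq'
  exact ContMDiffAt.add hq hq'

lemma SmoothFnNear.sub (hf : SmoothFnNear E f p) (hg : SmoothFnNear E g p) :
    SmoothFnNear E (f - g) p := by
  filter_upwards [hf, hg] with q hq hq'
  exact ContMDiffAt.sub hq hq'

lemma SmoothFnNear.mul (hf : SmoothFnNear E f p) (hg : SmoothFnNear E g p) :
    SmoothFnNear E (f * g) p := by
  filter_upwards [hf, hg] with q hq hq'
  exact ContMDiffAt.mul hq hq'

lemma SmoothFnNear.comp {φ : ℝ → ℝ} (hf : SmoothFnNear E f p)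
    (h : ∀ᶠ q in 𝓝 p, ContDiffAt ℝ ∞ φ (f q)) : SmoothFnNear E (fun q ↦ φ (f q)) p := by
  filter_upwards [hf, h] with q hq hq'
  exact hq'.contMDiffAt.comp q hq

lemma SmoothNear.const_smul (c : ℝ) (hX : SmoothNear X p) : SmoothNear (c • X) p :=
  SmoothNear.smul (SmoothFnNear.const c) hX

lemma smoothNear_extend (x : TangentSpace 𝓘(ℝ, E) p) :
    SmoothNear (FiberBundle.extend E x : VField E M) p := by
  obtain ⟨s, hs, h⟩ := FiberBundle.exists_contMDiffOn_extend (k := ∞) 𝓘(ℝ, E) E x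
  filter_upwards [eventually_mem_nhds_iff.2 hs] with q hq
  exact h.contMDiffAt hq

/-- Differentiation loses no regularity at order ∞, so derivatives can be iterated freely among
functions smooth near p. -/
lemma SmoothFnNear.deriv (hf : SmoothFnNear E f p) (hX : SmoothNear X p) :
    SmoothFnNear E (fun q ↦ mvfderiv 𝓘(ℝ, E) f q (X q)) p := by
  filter_upwards [hf, hX] with q hq hq'
  have h1 := hq.mfderiv_const (m := ∞) (by simp)
  have h2 := ContMDiffAt.clm_apply_of_inCoordinates (E₂ := TangentSpace 𝓘(ℝ, ℝ))
    (b₁ := id) (b₂ := f) h1 hq' hq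
  rw [contMDiffAt_totalSpace] at h2
  convert h2.2 using 1
  ext r
  simp [mvfderiv]
  rfl

-- The two instances provide the exponents required for the smoothness of Lie brackets and for the
-- Jacobi identity.
scoped instance : IsManifold 𝓘(ℝ, E) (((⊤ : ℕ∞) : WithTop ℕ∞) + 1) M :=
  IsManifold.of_le (n := ∞) (by simp)

scoped instance : IsManifold 𝓘(ℝ, E) (minSmoothness ℝ 3) M :=
  IsManifold.of_le (n := ∞) (by simpa using WithTop.coe_le_coe.2 (le_top : (3 : ℕ∞) ≤ ⊤))

lemma SmoothNear.bracket (hX : SmoothNear X p) (hY : SmoothNear Y p) :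
    SmoothNear (VectorField.mlieBracket 𝓘(ℝ, E) X Y) p := by
  filter_upwards [hX, hY] with q hq hq'
  exact ContMDiffAt.mlieBracket_vectorField (m := ⊤) (n := ⊤) hq hq' (by simp)

end SmoothGerms

/-! ### Smoothness of inner products and of the structure tensors. -/

section InnerGerms

variable {E : Type*} [NormedAddCommGroup E] [NormedSpace ℝ E] [FiniteDimensional ℝ E]
  {M : Type*} [TopologicalSpace M] [ChartedSpace E M] [IsManifold 𝓘(ℝ, E) ∞ M]
  [RiemannianBundle (fun p : M ↦ TangentSpace 𝓘(ℝ, E) p)]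
  [IsContMDiffRiemannianBundle 𝓘(ℝ, E) ∞ E (fun p : M ↦ TangentSpace 𝓘(ℝ, E) p)]

variable {X Y Z : VField E M} {f g : M → ℝ} {p : M}

lemma SmoothNear.inner (hX : SmoothNear X p) (hY : SmoothNear Y p) :
    SmoothFnNear E (fun q ↦ (inner ℝ (X q) (Y q) : ℝ)) p := by
  filter_upwards [hX, hY] with q hq hq'
  exact ContMDiffAt.inner_bundle (F := E) (E := fun p : M ↦ TangentSpace 𝓘(ℝ, E) p)
    (b := fun q : M ↦ q) (v := X) (w := Y) hq hq'

lemma AlmostContactMetric.smoothNear_ξ (S : AlmostContactMetric E M) : SmoothNear S.ξ p :=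
  Eventually.of_forall fun q ↦ S.smooth_ξ q

lemma AlmostContactMetric.smoothNear_Φ (S : AlmostContactMetric E M) (hX : SmoothNear X p) :
    SmoothNear (fun q ↦ S.Φ q (X q)) p := by
  filter_upwards [hX] with q hq
  exact ContMDiffAt.clm_bundle_apply (S.smooth_Φ q) hq

end InnerGerms

/-! ### The Lie bracket as a commutator of derivations. -/

section BracketDerivative

variable {E : Type*} [NormedAddCommGroup E] [NormedSpace ℝ E] [FiniteDimensional ℝ E]
  {M : Type*} [TopologicalSpace M] [ChartedSpace E M] [IsManifold 𝓘(ℝ, E) ∞ M]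
  {X Y Z : VField E M} {f g : M → ℝ} {p : M}

open VectorField

/-- `[X, Y] f = X (Y f) - Y (X f)`, deduced from the Jacobi identity for `X`, `Y`, `f W`. -/
lemma mvfderiv_mlieBracket (hX : SmoothNear X p) (hY : SmoothNear Y p)
    (hf : SmoothFnNear E f p) :
    mvfderiv 𝓘(ℝ, E) f p (mlieBracket 𝓘(ℝ, E) X Y p)
      = mvfderiv 𝓘(ℝ, E) (fun q ↦ mvfderiv 𝓘(ℝ, E) f q (Y q)) p (X p)
        - mvfderiv 𝓘(ℝ, E) (fun q ↦ mvfderiv 𝓘(ℝ, E) f q (X q)) p (Y p) := by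
  -- The argument needs a field W with W p ≠ 0; on a zero tangent space both sides vanish.
  rcases subsingleton_or_nontrivial E with hE | hE
  · have : Subsingleton (TangentSpace 𝓘(ℝ, E) p) := hE
    rw [Subsingleton.elim (mlieBracket 𝓘(ℝ, E) X Y p) 0, Subsingleton.elim (X p) 0,
      Subsingleton.elim (Y p) 0]
    simp
  obtain ⟨w, hw⟩ : ∃ w : TangentSpace 𝓘(ℝ, E) p, w ≠ 0 := exists_ne (α := E) 0
  set W : VField E M := FiberBundle.extend E w with hWdef
  have hW : SmoothNear W p := smoothNear_extend w
  have hWp : W p = w := FiberBundle.extend_apply_self E w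
  have hsm : ∀ {A : VField E M} {r : M}, SmoothNear A r → ContMDiffAt 𝓘(ℝ, E)
      (𝓘(ℝ, E).prod 𝓘(ℝ, E)) (minSmoothness ℝ 2)
      (fun q ↦ TotalSpace.mk' E (E := fun p : M ↦ TangentSpace 𝓘(ℝ, E) p) q (A q)) r :=
    fun h ↦ h.contMDiffAt.of_le (by simpa using WithTop.coe_le_coe.2 (le_top : (2 : ℕ∞) ≤ ⊤))
  have key : ∀ {A B : VField E M}, SmoothNear A p → SmoothNear B p →
      mlieBracket 𝓘(ℝ, E) A (mlieBracket 𝓘(ℝ, E) B (f • W)) p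
        = (f p • mlieBracket 𝓘(ℝ, E) A (mlieBracket 𝓘(ℝ, E) B W) p
          + mvfderiv 𝓘(ℝ, E) f p (A p) • mlieBracket 𝓘(ℝ, E) B W p)
          + (mvfderiv 𝓘(ℝ, E) f p (B p) • mlieBracket 𝓘(ℝ, E) A W p
          + mvfderiv 𝓘(ℝ, E) (fun q ↦ mvfderiv 𝓘(ℝ, E) f q (B q)) p (A p) • W p) := by
    intro A B hA hB
    have h1 : mlieBracket 𝓘(ℝ, E) B (f • W) =ᶠ[𝓝 p]
        ((fun q ↦ mvfderiv 𝓘(ℝ, E) f q (B q)) • W + f • mlieBracket 𝓘(ℝ, E) B W) := by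
      filter_upwards [hf.eventually, hW.eventually] with q hq hq'
      exact mlieBracket_smul_right hq.mdiff hq'.mdiff
    refine (EventuallyEq.mlieBracket_vectorField_eq (EventuallyEq.refl _ A) h1).trans ?_
    rw [mlieBracket_add_right (SmoothNear.smul (hf.deriv hB) hW).mdiff
        (SmoothNear.smul hf (hB.bracket hW)).mdiff,
      mlieBracket_smul_right (hf.deriv hB).mdiff hW.mdiff,
      mlieBracket_smul_right hf.mdiff (hB.bracket hW).mdiff]
    abel
  -- Subtracting f times the Jacobi identity for W from the one for fW leaves the wanted scalar
  -- identity multiplied by W p, because the products of first derivatives cancel.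
  have J1 := leibniz_identity_mlieBracket_apply (hsm hX) (hsm hY) (hsm (SmoothNear.smul hf hW))
  have J2 := leibniz_identity_mlieBracket_apply (hsm hX) (hsm hY) (hsm hW)
  rw [key hX hY, key hY hX, mlieBracket_smul_right hf.mdiff hW.mdiff, J2] at J1
  rw [hWp] at J1
  have h0 : (mvfderiv 𝓘(ℝ, E) f p (mlieBracket 𝓘(ℝ, E) X Y p)
      - (mvfderiv 𝓘(ℝ, E) (fun q ↦ mvfderiv 𝓘(ℝ, E) f q (Y q)) p (X p)
        - mvfderiv 𝓘(ℝ, E) (fun q ↦ mvfderiv 𝓘(ℝ, E) f q (X q)) p (Y p))) • w = 0 := by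
    linear_combination (norm := module) (-1 : ℝ) • J1
  rcases smul_eq_zero.1 h0 with h | h
  · exact sub_eq_zero.1 h
  · exact absurd h hw

end BracketDerivative

/-! ### Pointwise and local A-frames; their existence. -/

section AFrames

variable {E : Type*} [NormedAddCommGroup E] [NormedSpace ℝ E] [FiniteDimensional ℝ E]
  {M : Type*} [TopologicalSpace M] [ChartedSpace E M] [IsManifold 𝓘(ℝ, E) ∞ M]
  [RiemannianBundle (fun p : M ↦ TangentSpace 𝓘(ℝ, E) p)]
  [IsContMDiffRiemannianBundle 𝓘(ℝ, E) ∞ E (fun p : M ↦ TangentSpace 𝓘(ℝ, E) p)]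

namespace AlmostContactMetric

variable (S : AlmostContactMetric E M)

/-- Compatibility g(Φx, Φ·) evaluated at Φy, where Φ² = -id + η ⊗ ξ and η ∘ Φ = 0. -/
lemma inner_Φ_left (p : M) (x y : TangentSpace 𝓘(ℝ, E) p) :
    (inner ℝ (S.Φ p x) y : ℝ) = -inner ℝ x (S.Φ p y) := by
  have h := S.g_Φ_Φ p x (S.Φ p y)
  rw [S.Φ_Φ, inner_add_right, inner_neg_right, inner_smul_right, S.η_Φ, S.η_Φ] at h
  linarith

lemma inner_Φ_self (p : M) (x : TangentSpace 𝓘(ℝ, E) p) :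
    (inner ℝ x (S.Φ p x) : ℝ) = 0 := by
  have h := S.inner_Φ_left p x x
  rw [real_inner_comm] at h
  linarith

lemma inner_ξ_Φ (p : M) (x : TangentSpace 𝓘(ℝ, E) p) :
    (inner ℝ (S.ξ p) (S.Φ p x) : ℝ) = 0 := by
  rw [real_inner_comm]; exact S.η_Φ p x

/-- The vectors `u_a` at `p` satisfy the relations of an A-frame. -/
structure IsAFrameAt {n : ℕ} (p : M) (u : Fin n → TangentSpace 𝓘(ℝ, E) p) : Prop where
  inner_ξ : ∀ a, inner ℝ (u a) (S.ξ p) = (0 : ℝ)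
  inner_e : ∀ a b, inner ℝ (u a) (u b) = if a = b then (1 : ℝ) else 0
  inner_Φ : ∀ a b, inner ℝ (u a) (S.Φ p (u b)) = (0 : ℝ)

/-- The family `ξ, u_a, Φ u_a`. -/
def adapted {n : ℕ} (p : M) (u : Fin n → TangentSpace 𝓘(ℝ, E) p) :
    Option (Fin n ⊕ Fin n) → TangentSpace 𝓘(ℝ, E) p
  | none => S.ξ p
  | some (Sum.inl a) => u a
  | some (Sum.inr a) => S.Φ p (u a)

variable {S} {n : ℕ} {p : M} {u : Fin n → TangentSpace 𝓘(ℝ, E) p}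

lemma IsAFrameAt.inner_ΦΦ (h : S.IsAFrameAt p u) (a b : Fin n) :
    inner ℝ (S.Φ p (u a)) (S.Φ p (u b)) = if a = b then (1 : ℝ) else 0 := by
  rw [S.g_Φ_Φ, h.inner_ξ, h.inner_e]; simp

lemma IsAFrameAt.ξ_inner (h : S.IsAFrameAt p u) (a : Fin n) :
    inner ℝ (S.ξ p) (u a) = (0 : ℝ) := by
  rw [real_inner_comm, h.inner_ξ]

lemma IsAFrameAt.Φ_inner (h : S.IsAFrameAt p u) (a b : Fin n) :
    inner ℝ (S.Φ p (u a)) (u b) = (0 : ℝ) := by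
  rw [real_inner_comm, h.inner_Φ]

lemma IsAFrameAt.orthonormal (h : S.IsAFrameAt p u) : Orthonormal ℝ (S.adapted p u) := by
  rw [orthonormal_iff_ite]
  rintro (_ | a | a) (_ | b | b)
  · simpa [adapted] using S.η_ξ p
  · simpa [adapted, real_inner_comm] using h.inner_ξ b
  · simpa [adapted] using S.inner_ξ_Φ p (u b)
  · simpa [adapted] using h.inner_ξ a
  · simpa [adapted] using h.inner_e a b
  · simpa [adapted] using h.inner_Φ a b
  · simpa [adapted] using S.η_Φ p (u a)
  · rw [real_inner_comm]; simpa [adapted] using h.inner_Φ b a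
  · simpa [adapted] using h.inner_ΦΦ a b

/-- The orthonormal basis `ξ, u_a, Φ u_a` of the tangent space. -/
def IsAFrameAt.basis (h : S.IsAFrameAt p u) (hE : Module.finrank ℝ E = 2 * n + 1) :
    OrthonormalBasis (Option (Fin n ⊕ Fin n)) ℝ (TangentSpace 𝓘(ℝ, E) p) :=
  OrthonormalBasis.mk h.orthonormal (by
    have h1 := h.orthonormal.linearIndependent.span_eq_top_of_card_eq_finrank' (by
      simp only [Fintype.card_option, Fintype.card_sum, Fintype.card_fin]
      exact (by omega : n + n + 1 = 2 * n + 1).trans hE.symm)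
    rw [h1])

lemma IsAFrameAt.coe_basis (h : S.IsAFrameAt p u) (hE : Module.finrank ℝ E = 2 * n + 1) :
    ⇑(h.basis hE) = S.adapted p u :=
  OrthonormalBasis.coe_mk _ _

lemma IsAFrameAt.expand (h : S.IsAFrameAt p u) (hE : Module.finrank ℝ E = 2 * n + 1)
    (x : TangentSpace 𝓘(ℝ, E) p) :
    x = ((inner ℝ (S.ξ p) x : ℝ) • S.ξ p + ∑ a, (inner ℝ (u a) x : ℝ) • u a)
      + ∑ a, (inner ℝ (S.Φ p (u a)) x : ℝ) • S.Φ p (u a) := by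
  conv_lhs => rw [← (h.basis hE).sum_repr' x]
  simp only [h.coe_basis hE, Fintype.sum_option, Fintype.sum_sum_type, adapted]
  rw [add_assoc]

variable (S) in
/-- `e` is an A-frame on some neighbourhood of `p`. -/
structure IsAFrameNear (p : M) (e : Fin n → VField E M) : Prop where
  smooth : ∀ a, SmoothNear (e a) p
  frame : ∀ᶠ q in 𝓝 p, S.IsAFrameAt q (fun a ↦ e a q)

lemma IsAFrame.isAFrameAt {U : Set M} {e : Fin n → VField E M} (h : S.IsAFrame U e)
    (hp : p ∈ U) : S.IsAFrameAt p (fun a ↦ e a p) :=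
  ⟨h.inner_ξ p hp, h.inner_e p hp, h.inner_Φ p hp⟩

lemma IsAFrame.near {U : Set M} {e : Fin n → VField E M} (h : S.IsAFrame U e)
    (hp : p ∈ U) : S.IsAFrameNear p e where
  smooth a := by
    filter_upwards [h.isOpen.mem_nhds hp] with q hq
    exact (h.smooth a).contMDiffAt (h.isOpen.mem_nhds hq)
  frame := by
    filter_upwards [h.isOpen.mem_nhds hp] with q hq using h.isAFrameAt hq

lemma IsAFrameNear.exists_isAFrame {e : Fin n → VField E M} (h : S.IsAFrameNear p e) :
    ∃ U : Set M, p ∈ U ∧ S.IsAFrame U e := by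
  have h1 := (eventually_all.2 h.smooth).and h.frame
  obtain ⟨U, hU, hUo, hpU⟩ := eventually_nhds_iff.1 h1
  refine ⟨U, hpU, hUo, fun a q hq ↦ ((hU q hq).1 a).contMDiffWithinAt, ?_, ?_, ?_⟩
  · exact fun q hq ↦ (hU q hq).2.inner_ξ
  · exact fun q hq ↦ (hU q hq).2.inner_e
  · exact fun q hq ↦ (hU q hq).2.inner_Φ

lemma IsAFrameNear.eventually {e : Fin n → VField E M} (h : S.IsAFrameNear p e) :
    ∀ᶠ q in 𝓝 p, S.IsAFrameNear q e := by
  filter_upwards [eventually_all.2 fun a ↦ (h.smooth a).eventually, h.frame.eventually_nhds]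
    with q h1 h2 using ⟨h1, h2⟩

lemma IsAFrameNear.at {e : Fin n → VField E M} (h : S.IsAFrameNear p e) :
    S.IsAFrameAt p (fun a ↦ e a p) := h.frame.self_of_nhds

variable (S) in
-- Here n is the length of a partial frame: ξ, u_a, Φu_a span at most 2n + 1 dimensions, so a larger
-- tangent space contains a nonzero orthogonal vector.
lemma exists_orthogonal (u : Fin n → TangentSpace 𝓘(ℝ, E) p)
    (hE : 2 * n + 1 < Module.finrank ℝ E) :
    ∃ v : TangentSpace 𝓘(ℝ, E) p, v ≠ 0 ∧ inner ℝ (S.ξ p) v = (0 : ℝ) ∧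
      (∀ a, inner ℝ (u a) v = (0 : ℝ)) ∧ ∀ a, inner ℝ (S.Φ p (u a)) v = (0 : ℝ) := by
  set K := Submodule.span ℝ (Set.range (S.adapted p u)) with hK
  have hlt : Module.finrank ℝ K < Module.finrank ℝ (TangentSpace 𝓘(ℝ, E) p) := by
    refine (finrank_range_le_card (S.adapted p u)).trans_lt ?_
    simp only [Fintype.card_option, Fintype.card_sum, Fintype.card_fin]
    exact (by omega : n + n + 1 = 2 * n + 1).trans_lt hE
  have hne : Kᗮ ≠ ⊥ := by
    rw [Ne, Submodule.orthogonal_eq_bot_iff]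
    intro hT
    rw [hT, finrank_top] at hlt
    exact lt_irrefl _ hlt
  obtain ⟨v, hv, hv0⟩ := Submodule.exists_mem_ne_zero_of_ne_bot hne
  have hi : ∀ i, inner ℝ (S.adapted p u i) v = (0 : ℝ) := fun i ↦
    (Submodule.mem_orthogonal K v).1 hv _ (Submodule.subset_span ⟨i, rfl⟩)
  exact ⟨v, hv0, hi none, fun a ↦ hi (some (Sum.inl a)), fun a ↦ hi (some (Sum.inr a))⟩

/-- A unit vector v orthogonal to ξ, u_a and Φu_a extends the frame without any condition on Φv: v ⟂
Φv always holds, and u_a ⟂ Φv follows from Φu_a ⟂ v by skewness. -/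
lemma IsAFrameAt.snoc (h : S.IsAFrameAt p u) {v : TangentSpace 𝓘(ℝ, E) p}
    (h0 : inner ℝ v (S.ξ p) = (0 : ℝ)) (h1 : ∀ a, inner ℝ (u a) v = (0 : ℝ))
    (h2 : ∀ a, inner ℝ (S.Φ p (u a)) v = (0 : ℝ)) (hv : inner ℝ v v = (1 : ℝ)) :
    S.IsAFrameAt p (Fin.snoc u v : Fin (n + 1) → TangentSpace 𝓘(ℝ, E) p) where
  inner_ξ a := by
    induction a using Fin.lastCases with
    | last => simpa using h0
    | cast a => simpa using h.inner_ξ a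
  inner_e a b := by
    induction a using Fin.lastCases with
    | last =>
      induction b using Fin.lastCases with
      | last => simpa using hv
      | cast b =>
        have : Fin.last n ≠ b.castSucc := (Fin.castSucc_lt_last b).ne'
        simpa [this, real_inner_comm] using h1 b
    | cast a =>
      induction b using Fin.lastCases with
      | last =>
        have : a.castSucc ≠ Fin.last n := (Fin.castSucc_lt_last a).ne
        simpa [this] using h1 a
      | cast b => simpa using h.inner_e a b
  inner_Φ a b := by
    induction a using Fin.lastCases with
    | last =>
      induction b using Fin.lastCases with
      | last => simpa using S.inner_Φ_self p v
      | cast b => rw [real_inner_comm]; simpa using h2 b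
    | cast a =>
      induction b using Fin.lastCases with
      | last =>
        have h3 := S.inner_Φ_left p (u a) v
        rw [h2, eq_comm, neg_eq_zero] at h3
        simpa using h3
      | cast b => simpa using h.inner_Φ a b

lemma IsAFrameNear.exists_snoc {e : Fin n → VField E M} (h : S.IsAFrameNear p e)
    (hE : 2 * n + 1 < Module.finrank ℝ E) :
    ∃ v : VField E M, S.IsAFrameNear p (Fin.snoc e v : Fin (n + 1) → VField E M) := by
  obtain ⟨v, hv0, hvξ, hve, hvΦ⟩ := S.exists_orthogonal (fun a ↦ e a p) hE
  set V : VField E M := FiberBundle.extend E v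
  have hV : SmoothNear V p := smoothNear_extend v
  have hVp : V p = v := FiberBundle.extend_apply_self E v
  -- One Gram-Schmidt step carried out at all points near p. At p nothing is subtracted, so W p = v
  -- ≠ 0, and W stays nonzero nearby and can be normalised smoothly.
  set W : VField E M := (V - (fun q ↦ (inner ℝ (S.ξ q) (V q) : ℝ)) • S.ξ)
    - (fun q ↦ ∑ a, ((fun q ↦ (inner ℝ (e a q) (V q) : ℝ)) • e a) q)
    - (fun q ↦ ∑ a, ((fun q ↦ (inner ℝ (S.Φ q (e a q)) (V q) : ℝ)) •
        fun q ↦ S.Φ q (e a q)) q) with hW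
  have hWs : SmoothNear W p :=
    ((hV.sub (SmoothNear.smul (S.smoothNear_ξ.inner hV) S.smoothNear_ξ)).sub
      (SmoothNear.sum fun a _ ↦ SmoothNear.smul ((h.smooth a).inner hV) (h.smooth a))).sub
      (SmoothNear.sum fun a _ ↦ SmoothNear.smul
        ((S.smoothNear_Φ (h.smooth a)).inner hV) (S.smoothNear_Φ (h.smooth a)))
  have hWq : ∀ q, W q = (V q - (inner ℝ (S.ξ q) (V q) : ℝ) • S.ξ q)
      - (∑ a, (inner ℝ (e a q) (V q) : ℝ) • e a q)
      - ∑ a, (inner ℝ (S.Φ q (e a q)) (V q) : ℝ) • S.Φ q (e a q) := fun q ↦ rfl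
  have hWp : W p = v := by
    rw [hWq, hVp]; simp [hvξ, hve, hvΦ]
  set f : M → ℝ := fun q ↦ inner ℝ (W q) (W q) with hf
  have hfs : SmoothFnNear E f p := hWs.inner hWs
  have hfp : 0 < f p := by
    simp only [hf, hWp]; exact real_inner_self_pos.2 hv0
  have hfe : ∀ᶠ q in 𝓝 p, 0 < f q :=
    hfs.contMDiffAt.continuousAt.eventually (lt_mem_nhds hfp)
  have hgs : SmoothFnNear E (fun q ↦ (√(f q))⁻¹) p :=
    SmoothFnNear.comp (φ := fun t ↦ (√t)⁻¹) hfs (by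
      filter_upwards [hfe] with q hq
      exact (Real.contDiffAt_sqrt hq.ne').inv (Real.sqrt_pos.2 hq).ne')
  refine ⟨(fun q ↦ (√(f q))⁻¹) • W, ?_, ?_⟩
  · intro a
    induction a using Fin.lastCases with
    | last => simpa using SmoothNear.smul hgs hWs
    | cast a => simpa using h.smooth a
  · filter_upwards [h.frame, hfe] with q hq hfq
    have hsn : (fun a : Fin (n + 1) ↦
        (Fin.snoc e ((fun q ↦ (√(f q))⁻¹) • W) : Fin (n + 1) → VField E M) a q)
        = Fin.snoc (fun a ↦ e a q) ((√(f q))⁻¹ • W q) := by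
      funext a
      induction a using Fin.lastCases with
      | last => simp
      | cast a => simp
    rw [hsn]
    have e1 : inner ℝ (S.ξ q) (W q) = (0 : ℝ) := by
      rw [hWq]
      simp [-inner_self_eq_norm_sq_to_K, inner_sub_right, inner_smul_right, inner_sum, S.η_ξ,
        S.inner_ξ_Φ, hq.ξ_inner]
    have e2 : ∀ b, inner ℝ (e b q) (W q) = (0 : ℝ) := by
      intro b
      rw [hWq]
      simp [inner_sub_right, inner_smul_right, inner_sum, hq.inner_ξ, hq.inner_e, hq.inner_Φ]
    have e3 : ∀ b, inner ℝ (S.Φ q (e b q)) (W q) = (0 : ℝ) := by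
      intro b
      rw [hWq]
      simp [inner_sub_right, inner_smul_right, inner_sum, S.η_Φ, hq.inner_ΦΦ,
        hq.Φ_inner]
    refine hq.snoc ?_ ?_ ?_ ?_
    · rw [inner_smul_left, real_inner_comm, e1, mul_zero]
    · intro a; rw [inner_smul_right, e2, mul_zero]
    · intro a; rw [inner_smul_right, e3, mul_zero]
    · rw [inner_smul_left, inner_smul_right]
      change (√(f q))⁻¹ * ((√(f q))⁻¹ * f q) = 1
      have := Real.mul_self_sqrt hfq.le
      have h0 := (Real.sqrt_pos.2 hfq).ne'
      field_simp
      nlinarith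

variable (S) in
-- Partial frames are lengthened one vector at a time; there is room as long as 2k + 1 < 2n + 1.
lemma exists_isAFrameNear (p : M) (hE : Module.finrank ℝ E = 2 * n + 1) :
    ∃ e : Fin n → VField E M, S.IsAFrameNear p e := by
  have h : ∀ k ≤ n, ∃ e : Fin k → VField E M, S.IsAFrameNear p e := by
    intro k
    induction k with
    | zero =>
      intro _
      exact ⟨Fin.elim0, fun a ↦ a.elim0, Eventually.of_forall fun q ↦
        ⟨fun a ↦ a.elim0, fun a ↦ a.elim0, fun a ↦ a.elim0⟩⟩
    | succ k ih =>
      intro hk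
      obtain ⟨e, he⟩ := ih (by omega)
      obtain ⟨v, hv⟩ := he.exists_snoc (by omega)
      exact ⟨_, hv⟩
  exact h n le_rfl

end AlmostContactMetric

end AFrames

/-! ### Tensoriality: operations depending only on the value of a field at p. -/

section Tensorial

variable {E : Type*} [NormedAddCommGroup E] [NormedSpace ℝ E] [FiniteDimensional ℝ E]
  {M : Type*} [TopologicalSpace M] [ChartedSpace E M] [IsManifold 𝓘(ℝ, E) ∞ M]

/-- An operation on vector fields which is additive and homogeneous over smooth functions, for
fields which are smooth near `p`. -/
structure IsTensorialNear {A : Type*} [AddCommGroup A] [Module ℝ A] (F : VField E M → A)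
    (p : M) : Prop where
  add : ∀ {X Y : VField E M}, SmoothNear X p → SmoothNear Y p → F (X + Y) = F X + F Y
  smul : ∀ {f : M → ℝ} {X : VField E M}, SmoothFnNear E f p → SmoothNear X p →
    F (f • X) = f p • F X

variable {A : Type*} [AddCommGroup A] [Module ℝ A] {F : VField E M → A} {p : M}
  {X Y : VField E M}

lemma IsTensorialNear.congr (hF : IsTensorialNear F p) (hX : SmoothNear X p)
    (hXY : ∀ᶠ q in 𝓝 p, X q = Y q) : F X = F Y := by
  classical
  have hY : SmoothNear Y p := hX.congr hXY
  -- The indicator function of {X = Y} serves as cut-off. It is constant near p, which is all the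
  -- smoothness required, and ψX = ψY holds everywhere.
  set ψ : M → ℝ := fun q ↦ if X q = Y q then 1 else 0
  have hψ : SmoothFnNear E ψ p :=
    (SmoothFnNear.const 1).congr (hXY.mono fun q hq ↦ by simp [ψ, hq])
  have hψp : ψ p = 1 := by simp [ψ, hXY.self_of_nhds]
  have h : ψ • X = ψ • Y := by
    funext q
    by_cases hq : X q = Y q
    · change ψ q • X q = ψ q • Y q
      rw [hq]
    · change ψ q • X q = ψ q • Y q
      simp [ψ, hq]
  have h1 := hF.smul hψ hX
  rw [h, hF.smul hψ hY, hψp, one_smul, one_smul] at h1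
  exact h1.symm

lemma IsTensorialNear.sum (hF : IsTensorialNear F p) {ι : Type*} (s : Finset ι)
    {X : ι → VField E M} (hX : ∀ i, SmoothNear (X i) p) :
    F (fun q ↦ ∑ i ∈ s, X i q) = ∑ i ∈ s, F (X i) := by
  classical
  induction s using Finset.induction_on with
  -- The zero field is 0 • 0, so homogeneity gives F 0 = 0.
  | empty =>
    have h := hF.smul (f := fun _ ↦ 0) (X := fun _ ↦ 0) (SmoothFnNear.const 0)
      (SmoothNear.sum (s := (∅ : Finset ι)) (X := X) (by simp))
    have h0 : ((fun _ ↦ 0 : M → ℝ) • (fun _ ↦ 0 : VField E M)) = fun _ ↦ 0 := by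
      funext q; exact smul_zero _
    rw [h0, zero_smul] at h
    simpa using h
  | insert i s hi ih =>
    have h : (fun q ↦ ∑ j ∈ insert i s, X j q) = X i + fun q ↦ ∑ j ∈ s, X j q := by
      funext q; rw [Finset.sum_insert hi]; rfl
    rw [h, hF.add (hX i) (SmoothNear.sum fun j _ ↦ hX j), ih, Finset.sum_insert hi]

lemma IsTensorialNear.pointwise (hF : IsTensorialNear F p) (hX : SmoothNear X p)
    (hY : SmoothNear Y p) (hXY : X p = Y p) : F X = F Y := by
  let t := trivializationAt E (fun p : M ↦ TangentSpace 𝓘(ℝ, E) p) p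
  have hp : p ∈ t.baseSet := FiberBundle.mem_baseSet_trivializationAt E _ p
  let b := Module.Basis.ofVectorSpace ℝ E
  let s := t.localFrame b
  let c := t.localFrameCoeff 𝓘(ℝ, E) b
  have hev : ∀ᶠ q in 𝓝 p, q ∈ t.baseSet := t.open_baseSet.mem_nhds hp
  have hs : ∀ i, SmoothNear (s i) p := fun i ↦ by
    filter_upwards [hev] with q hq
    exact contMDiffAt_localFrame_of_mem ∞ _ b i hq
  have hc : ∀ {Z : VField E M}, SmoothNear Z p → ∀ i, SmoothFnNear E (fun q ↦ c i q (Z q)) p := by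
    intro Z hZ i
    filter_upwards [hev, hZ] with q hq hZq
    exact contMDiffAt_localFrameCoeff (I := 𝓘(ℝ, E)) (e := t) b hq hZq i
  -- In a local frame s_i, additivity and homogeneity show that F Z involves only the coefficients
  -- of Z at p.
  have key : ∀ {Z : VField E M}, SmoothNear Z p → F Z = ∑ i, c i p (Z p) • F (s i) := by
    intro Z hZ
    have hZe : ∀ᶠ q in 𝓝 p, Z q = ∑ i, c i q (Z q) • s i q :=
      t.eventually_eq_localFrame_sum_coeff_smul (I := 𝓘(ℝ, E)) b hp
    rw [hF.congr hZ hZe]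
    refine (hF.sum Finset.univ (X := fun i ↦ (fun q ↦ c i q (Z q)) • s i)
      fun i ↦ SmoothNear.smul (hc hZ i) (hs i)).trans ?_
    exact Finset.sum_congr rfl fun i _ ↦ hF.smul (hc hZ i) (hs i)
  rw [key hX, key hY, hXY]

end Tensorial

/-! ### Calculus rules for a covariant derivative. -/

section Connection

variable {E : Type*} [NormedAddCommGroup E] [NormedSpace ℝ E] [FiniteDimensional ℝ E]
  {M : Type*} [TopologicalSpace M] [ChartedSpace E M] [IsManifold 𝓘(ℝ, E) ∞ M]
  {D : CovariantDerivative 𝓘(ℝ, E) E (fun p : M ↦ TangentSpace 𝓘(ℝ, E) p)}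
  {X Y Z W : VField E M} {f : M → ℝ} {p : M}

lemma cov_add (hX : SmoothNear X p) (hY : SmoothNear Y p) (v : TangentSpace 𝓘(ℝ, E) p) :
    D (X + Y) p v = D X p v + D Y p v := by
  rw [D.isCovariantDerivativeOnUniv.add hX.mdiff hY.mdiff]; rfl

lemma cov_smul (hf : SmoothFnNear E f p) (hX : SmoothNear X p) (v : TangentSpace 𝓘(ℝ, E) p) :
    D (f • X) p v = f p • D X p v + mvfderiv 𝓘(ℝ, E) f p v • X p := by
  rw [D.isCovariantDerivativeOnUniv.leibniz hX.mdiff hf.mdiff]; rfl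

lemma cov_neg (hX : SmoothNear X p) (v : TangentSpace 𝓘(ℝ, E) p) :
    D (-X) p v = -D X p v := by
  have h := D.isCovariantDerivativeOnUniv.smul_const (-1) hX.mdiff
  rw [neg_one_smul, neg_one_smul] at h
  rw [h]; rfl

lemma cov_sub (hX : SmoothNear X p) (hY : SmoothNear Y p) (v : TangentSpace 𝓘(ℝ, E) p) :
    D (X - Y) p v = D X p v - D Y p v := by
  rw [sub_eq_add_neg, cov_add hX hY.neg, cov_neg hY, sub_eq_add_neg]

lemma cov_congr (hX : SmoothNear X p) (hXY : ∀ᶠ q in 𝓝 p, X q = Y q) : D X p = D Y p :=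
  D.isCovariantDerivativeOnUniv.congr_of_eventuallyEq hX.mdiff (hX.congr hXY).mdiff
    univ_mem hXY

lemma mvfderiv_congr {G : Type*} [NormedAddCommGroup G] [NormedSpace ℝ G] {f g : M → G}
    (h : ∀ᶠ q in 𝓝 p, f q = g q) :
    mvfderiv 𝓘(ℝ, E) f p = mvfderiv 𝓘(ℝ, E) g p := by
  have h1 : f =ᶠ[𝓝 p] g := h
  ext v
  simp only [mvfderiv, ContinuousLinearMap.comp_apply]
  rw [h1.mfderiv_eq]
  rfl

end Connection

/-! ### The Koszul formula and the smoothness of the Riemannian connection. -/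

section RiemannianConnection

variable {E : Type*} [NormedAddCommGroup E] [NormedSpace ℝ E] [FiniteDimensional ℝ E]
  {M : Type*} [TopologicalSpace M] [ChartedSpace E M] [IsManifold 𝓘(ℝ, E) ∞ M]
  [RiemannianBundle (fun p : M ↦ TangentSpace 𝓘(ℝ, E) p)]
  [IsContMDiffRiemannianBundle 𝓘(ℝ, E) ∞ E (fun p : M ↦ TangentSpace 𝓘(ℝ, E) p)]
  {D : CovariantDerivative 𝓘(ℝ, E) E (fun p : M ↦ TangentSpace 𝓘(ℝ, E) p)}
  {X Y Z W : VField E M} {f : M → ℝ} {p : M}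

open VectorField

namespace IsRiemannianConnection

lemma bracket (hD : IsRiemannianConnection D) (hX : SmoothNear X p) (hY : SmoothNear Y p) :
    D Y p (X p) - D X p (Y p) = mlieBracket 𝓘(ℝ, E) X Y p :=
  (CovariantDerivative.torsion_eq_zero_iff D).1 hD.torsion_free hX.mdiff hY.mdiff

lemma deriv_inner (hD : IsRiemannianConnection D) (hX : SmoothNear X p) (hY : SmoothNear Y p)
    (v : TangentSpace 𝓘(ℝ, E) p) :
    mvfderiv 𝓘(ℝ, E) (fun q ↦ (inner ℝ (X q) (Y q) : ℝ)) p v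
        = inner ℝ (D X p v) (Y p) + inner ℝ (X p) (D Y p v) :=
  hD.metric hX.mdiff hY.mdiff v

/-- The Koszul formula. -/
lemma koszul (hD : IsRiemannianConnection D) (hX : SmoothNear X p) (hY : SmoothNear Y p)
    (hZ : SmoothNear Z p) :
    2 * (inner ℝ (D Y p (X p)) (Z p) : ℝ)
      = mvfderiv 𝓘(ℝ, E) (fun q ↦ (inner ℝ (Y q) (Z q) : ℝ)) p (X p)
        + mvfderiv 𝓘(ℝ, E) (fun q ↦ (inner ℝ (X q) (Z q) : ℝ)) p (Y p)
        - mvfderiv 𝓘(ℝ, E) (fun q ↦ (inner ℝ (X q) (Y q) : ℝ)) p (Z p)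
        + inner ℝ (mlieBracket 𝓘(ℝ, E) X Y p) (Z p)
        - inner ℝ (mlieBracket 𝓘(ℝ, E) X Z p) (Y p)
        - inner ℝ (mlieBracket 𝓘(ℝ, E) Y Z p) (X p) := by
  rw [hD.deriv_inner hY hZ, hD.deriv_inner hX hZ, hD.deriv_inner hX hY, ← hD.bracket hX hY,
    ← hD.bracket hX hZ, ← hD.bracket hY hZ]
  simp only [inner_sub_left]
  rw [real_inner_comm (D Z p (X p)) (Y p), real_inner_comm (D Z p (Y p)) (X p),
    real_inner_comm (D Y p (Z p)) (X p)]
  ring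

/-- The Riemannian connection of a smooth metric is smooth. -/
lemma smoothNear_cov (hD : IsRiemannianConnection D) {n : ℕ} {S : AlmostContactMetric E M}
    (hE : Module.finrank ℝ E = 2 * n + 1) (hX : SmoothNear X p) (hY : SmoothNear Y p) :
    SmoothNear (fun q ↦ D Y q (X q)) p := by
  -- By the Koszul formula the product of ∇_X Y with any smooth field is smooth; taking this field
  -- from a local A-frame gives smooth coefficients of ∇_X Y.
  have key : ∀ {Z : VField E M}, SmoothNear Z p →
      SmoothFnNear E (fun q ↦ (inner ℝ (Z q) (D Y q (X q)) : ℝ)) p := by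
    intro Z hZ
    have h := SmoothFnNear.mul (SmoothFnNear.const (1 / 2)) (SmoothFnNear.sub (SmoothFnNear.sub
      (SmoothFnNear.add (SmoothFnNear.sub (SmoothFnNear.add ((hY.inner hZ).deriv hX)
        ((hX.inner hZ).deriv hY)) ((hX.inner hY).deriv hZ)) ((hX.bracket hY).inner hZ))
      ((hX.bracket hZ).inner hY)) ((hY.bracket hZ).inner hX))
    refine h.congr ?_
    filter_upwards [hX.eventually, hY.eventually, hZ.eventually] with q h1 h2 h3
    have := hD.koszul h1 h2 h3
    rw [real_inner_comm]
    simp only [Pi.mul_apply, Pi.sub_apply, Pi.add_apply]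
    linarith
  obtain ⟨e, he⟩ := S.exists_isAFrameNear p hE
  have hs := ((SmoothNear.smul (key S.smoothNear_ξ) S.smoothNear_ξ).add
    (SmoothNear.sum (s := Finset.univ) fun a _ ↦
      SmoothNear.smul (key (he.smooth a)) (he.smooth a))).add
    (SmoothNear.sum (s := Finset.univ) fun a _ ↦
      SmoothNear.smul (key (S.smoothNear_Φ (he.smooth a))) (S.smoothNear_Φ (he.smooth a)))
  refine hs.congr ?_
  filter_upwards [he.frame] with q hq
  exact (hq.expand hE (D Y q (X q))).symm

end IsRiemannianConnection

end RiemannianConnection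

/-! ### The curvature tensor and its symmetries. -/

section Curvature

variable {E : Type*} [NormedAddCommGroup E] [NormedSpace ℝ E] [FiniteDimensional ℝ E]
  {M : Type*} [TopologicalSpace M] [ChartedSpace E M] [IsManifold 𝓘(ℝ, E) ∞ M]
  [RiemannianBundle (fun p : M ↦ TangentSpace 𝓘(ℝ, E) p)]
  [IsContMDiffRiemannianBundle 𝓘(ℝ, E) ∞ E (fun p : M ↦ TangentSpace 𝓘(ℝ, E) p)]
  {D : CovariantDerivative 𝓘(ℝ, E) E (fun p : M ↦ TangentSpace 𝓘(ℝ, E) p)}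
  {X Y Z W : VField E M} {f : M → ℝ} {p : M}

open VectorField

variable (D) in
/-- A Riemannian connection whose covariant derivatives of smooth fields are smooth. -/
structure IsSmoothRiemannianConnection : Prop extends IsRiemannianConnection D where
  smooth : ∀ {p : M} {X Y : VField E M}, SmoothNear X p → SmoothNear Y p →
    SmoothNear (fun q ↦ D Y q (X q)) p

lemma IsRiemannianConnection.isSmooth (hD : IsRiemannianConnection D) {n : ℕ}
    (S : AlmostContactMetric E M) (hE : Module.finrank ℝ E = 2 * n + 1) :
    IsSmoothRiemannianConnection D :=
  ⟨hD, hD.smoothNear_cov (S := S) hE⟩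

namespace IsSmoothRiemannianConnection

lemma curvatureField_swap (X Y Z : VField E M) (p : M) :
    curvatureField D X Y Z p = -curvatureField D Y X Z p := by
  unfold curvatureField
  rw [mlieBracket_swap_apply, map_neg]
  abel

/-- For fX the extra term (Yf)∇_X Z from the second derivative cancels the one coming from [fX, Y] =
f[X, Y] - (Yf)X. -/
lemma tensorial_fst (hD : IsSmoothRiemannianConnection D) (Y : VField E M)
    (hZ : SmoothNear Z p) : IsTensorialNear (fun X ↦ curvatureField D X Y Z p) p where
  add {X X'} hX hX' := by
    have h1 : D (fun q ↦ D Z q ((X + X') q)) p (Y p)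
        = D (fun q ↦ D Z q (X q)) p (Y p) + D (fun q ↦ D Z q (X' q)) p (Y p) := by
      rw [← cov_add (hD.smooth hX hZ) (hD.smooth hX' hZ)]
      congr 2
      funext q
      exact map_add _ _ _
    simp only [curvatureField]
    rw [h1, mlieBracket_add_left hX.mdiff hX'.mdiff, Pi.add_apply, map_add, map_add]
    abel
  smul {f X} hf hX := by
    have h1 : D (fun q ↦ D Z q ((f • X) q)) p (Y p)
        = f p • D (fun q ↦ D Z q (X q)) p (Y p)
          + mvfderiv 𝓘(ℝ, E) f p (Y p) • D Z p (X p) := by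
      rw [← cov_smul hf (hD.smooth hX hZ)]
      congr 2
      funext q
      exact map_smul _ _ _
    simp only [curvatureField]
    rw [h1, mlieBracket_smul_left hf.mdiff hX.mdiff, map_add, map_smul, map_smul]
    change D (fun q ↦ D Z q (Y q)) p (f p • X p) - _ - _ = _
    rw [map_smul]
    module

lemma tensorial_snd (hD : IsSmoothRiemannianConnection D) (X : VField E M)
    (hZ : SmoothNear Z p) : IsTensorialNear (fun Y ↦ curvatureField D X Y Z p) p where
  add {Y Y'} hY hY' := by
    simp only [fun Y ↦ curvatureField_swap (D := D) X Y Z p]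
    rw [(hD.tensorial_fst X hZ).add hY hY']
    abel
  smul {f Y} hf hY := by
    simp only [fun Y ↦ curvatureField_swap (D := D) X Y Z p]
    rw [(hD.tensorial_fst X hZ).smul hf hY, smul_neg]

/-- The mixed first-order terms in f are symmetric in X and Y and cancel. The second derivatives of
f leave (XYf - YXf - [X, Y]f)Z, which is zero by `mvfderiv_mlieBracket`. -/
lemma tensorial_trd (hD : IsSmoothRiemannianConnection D) (hX : SmoothNear X p)
    (hY : SmoothNear Y p) : IsTensorialNear (fun Z ↦ curvatureField D X Y Z p) p where
  add {Z Z'} hZ hZ' := by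
    have h1 : ∀ {A : VField E M}, SmoothNear A p → ∀ v, D (fun q ↦ D (Z + Z') q (A q)) p v
        = D (fun q ↦ D Z q (A q)) p v + D (fun q ↦ D Z' q (A q)) p v := by
      intro A hA v
      rw [← cov_add (hD.smooth hA hZ) (hD.smooth hA hZ')]
      congr 1
      refine cov_congr (hD.smooth hA (hZ.add hZ')) ?_
      filter_upwards [hZ.eventually, hZ'.eventually] with q h h'
      exact cov_add h h' _
    simp only [curvatureField]
    rw [h1 hX, h1 hY, cov_add hZ hZ']
    abel
  smul {f Z} hf hZ := by
    have h1 : ∀ {A : VField E M}, SmoothNear A p → ∀ v, D (fun q ↦ D (f • Z) q (A q)) p v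
        = (f p • D (fun q ↦ D Z q (A q)) p v + mvfderiv 𝓘(ℝ, E) f p v • D Z p (A p))
          + (mvfderiv 𝓘(ℝ, E) f p (A p) • D Z p v
            + mvfderiv 𝓘(ℝ, E) (fun q ↦ mvfderiv 𝓘(ℝ, E) f q (A q)) p v • Z p) := by
      intro A hA v
      rw [← cov_smul hf (hD.smooth hA hZ), ← cov_smul (hf.deriv hA) hZ,
        ← cov_add (SmoothNear.smul hf (hD.smooth hA hZ)) (SmoothNear.smul (hf.deriv hA) hZ)]
      congr 1
      refine cov_congr (hD.smooth hA (SmoothNear.smul hf hZ)) ?_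
      filter_upwards [hf.eventually, hZ.eventually] with q h h'
      exact cov_smul h h' _
    simp only [curvatureField]
    rw [h1 hX, h1 hY, cov_smul hf hZ, mvfderiv_mlieBracket hX hY hf]
    module

/-- The curvature of smooth fields is the value of the curvature tensor. -/
lemma curvatureField_eq (hD : IsSmoothRiemannianConnection D) (hX : SmoothNear X p)
    (hY : SmoothNear Y p) (hZ : SmoothNear Z p) :
    curvatureField D X Y Z p = curvature D p (X p) (Y p) (Z p) := by
  have hX' := smoothNear_extend (X p)
  have hY' := smoothNear_extend (Y p)
  have hZ' := smoothNear_extend (Z p)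
  unfold curvature
  rw [(hD.tensorial_fst Y hZ).pointwise hX hX' (FiberBundle.extend_apply_self E _).symm,
    (hD.tensorial_snd _ hZ).pointwise hY hY' (FiberBundle.extend_apply_self E _).symm,
    (hD.tensorial_trd hX' hY').pointwise hZ hZ' (FiberBundle.extend_apply_self E _).symm]

variable (x x' y y' z z' w w' : TangentSpace 𝓘(ℝ, E) p) (c : ℝ)

lemma curvature_swap : curvature D p x y z = -curvature D p y x z :=
  curvatureField_swap _ _ _ _

lemma curvature_add_left (hD : IsSmoothRiemannianConnection D) :
    curvature D p (x + x') y z = curvature D p x y z + curvature D p x' y z := by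
  have h := hD.curvatureField_eq ((smoothNear_extend x).add (smoothNear_extend x'))
    (smoothNear_extend y) (smoothNear_extend z)
  rw [(hD.tensorial_fst (FiberBundle.extend E y) (smoothNear_extend z)).add
    (smoothNear_extend x) (smoothNear_extend x')] at h
  simp at h
  exact h.symm

lemma curvature_smul_left (hD : IsSmoothRiemannianConnection D) :
    curvature D p (c • x) y z = c • curvature D p x y z := by
  have h := hD.curvatureField_eq (SmoothNear.smul (SmoothFnNear.const c) (smoothNear_extend x))
    (smoothNear_extend y) (smoothNear_extend z)
  rw [(hD.tensorial_fst (FiberBundle.extend E y) (smoothNear_extend z)).smul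
    (SmoothFnNear.const c) (smoothNear_extend x)] at h
  simp at h
  exact h.symm

/-- The first Bianchi identity. -/
lemma bianchi (hD : IsSmoothRiemannianConnection D) :
    curvature D p x y z + curvature D p y z x + curvature D p z x y = 0 := by
  unfold curvature
  set X : VField E M := FiberBundle.extend E x
  set Y : VField E M := FiberBundle.extend E y
  set Z : VField E M := FiberBundle.extend E z
  have hX : SmoothNear X p := smoothNear_extend x
  have hY : SmoothNear Y p := smoothNear_extend y
  have hZ : SmoothNear Z p := smoothNear_extend z
  -- Vanishing torsion, used twice, turns each group of three terms of the cyclic sum into an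
  -- iterated bracket; Bianchi then becomes the Jacobi identity.
  have key : ∀ {A B C : VField E M}, SmoothNear A p → SmoothNear B p → SmoothNear C p →
      D (fun q ↦ D C q (B q)) p (A p) - D (fun q ↦ D B q (C q)) p (A p)
        - D A p (mlieBracket 𝓘(ℝ, E) B C p)
        = mlieBracket 𝓘(ℝ, E) A (mlieBracket 𝓘(ℝ, E) B C) p := by
    intro A B C hA hB hC
    rw [← hD.bracket hA (hB.bracket hC), ← cov_sub (hD.smooth hB hC) (hD.smooth hC hB)]
    congr 2
    refine cov_congr ((hD.smooth hB hC).sub (hD.smooth hC hB)) ?_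
    filter_upwards [hB.eventually, hC.eventually] with q h h'
    exact hD.bracket h h'
  have hsm : ∀ {A : VField E M}, SmoothNear A p → ContMDiffAt 𝓘(ℝ, E)
      (𝓘(ℝ, E).prod 𝓘(ℝ, E)) (minSmoothness ℝ 2)
      (fun q ↦ TotalSpace.mk' E (E := fun p : M ↦ TangentSpace 𝓘(ℝ, E) p) q (A q)) p :=
    fun h ↦ h.contMDiffAt.of_le (by simpa using WithTop.coe_le_coe.2 (le_top : (2 : ℕ∞) ≤ ⊤))
  have J := leibniz_identity_mlieBracket_apply (hsm hX) (hsm hY) (hsm hZ)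
  rw [← key hX hY hZ, mlieBracket_swap_apply (V := mlieBracket 𝓘(ℝ, E) X Y) (W := Z),
    ← key hZ hX hY, mlieBracket_swap (V := X) (W := Z)]
    at J
  have J' : mlieBracket 𝓘(ℝ, E) Y (-mlieBracket 𝓘(ℝ, E) Z X) p
      = -mlieBracket 𝓘(ℝ, E) Y (mlieBracket 𝓘(ℝ, E) Z X) p := by
    have h := mlieBracket_const_smul_right (I := 𝓘(ℝ, E)) (V := Y) (c := (-1 : ℝ))
      (hZ.bracket hX).mdiff
    simpa using h
  rw [J', ← key hY hZ hX] at J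
  simp only [curvatureField]
  linear_combination (norm := module) (1 : ℝ) • J

/-- The curvature in terms of first derivatives of products. -/
lemma inner_curvature (hD : IsSmoothRiemannianConnection D) (hX : SmoothNear X p)
    (hY : SmoothNear Y p) (hZ : SmoothNear Z p) (hW : SmoothNear W p) :
    (inner ℝ (curvature D p (X p) (Y p) (Z p)) (W p) : ℝ)
      = mvfderiv 𝓘(ℝ, E) (fun q ↦ (inner ℝ (D Z q (Y q)) (W q) : ℝ)) p (X p)
        - inner ℝ (D Z p (Y p)) (D W p (X p))
        - (mvfderiv 𝓘(ℝ, E) (fun q ↦ (inner ℝ (D Z q (X q)) (W q) : ℝ)) p (Y p)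
        - inner ℝ (D Z p (X p)) (D W p (Y p)))
        - inner ℝ (D Z p (mlieBracket 𝓘(ℝ, E) X Y p)) (W p) := by
  rw [← hD.curvatureField_eq hX hY hZ, hD.deriv_inner (hD.smooth hY hZ) hW,
    hD.deriv_inner (hD.smooth hX hZ) hW]
  simp only [curvatureField, inner_sub_left]
  ring

/-- By metricity the operator XY - YX - [X, Y] applied to the function g(Z, W) equals g(R(X, Y)Z, W)
+ g(Z, R(X, Y)W), and the operator annihilates functions. -/
lemma inner_curvature_skew (hD : IsSmoothRiemannianConnection D) :
    (inner ℝ (curvature D p x y z) w : ℝ) = -inner ℝ (curvature D p x y w) z := by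
  set X : VField E M := FiberBundle.extend E x with hXd
  set Y : VField E M := FiberBundle.extend E y with hYd
  set Z : VField E M := FiberBundle.extend E z with hZd
  set W : VField E M := FiberBundle.extend E w with hWd
  have hX : SmoothNear X p := smoothNear_extend x
  have hY : SmoothNear Y p := smoothNear_extend y
  have hZ : SmoothNear Z p := smoothNear_extend z
  have hW : SmoothNear W p := smoothNear_extend w
  have h1 := hD.inner_curvature hX hY hZ hW
  have h2 := hD.inner_curvature hX hY hW hZ
  have hB := mvfderiv_mlieBracket hX hY (hZ.inner hW)
  have key : ∀ {A : VField E M}, SmoothNear A p → ∀ v,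
      mvfderiv 𝓘(ℝ, E) (fun q ↦ mvfderiv 𝓘(ℝ, E)
        (fun q ↦ (inner ℝ (Z q) (W q) : ℝ)) q (A q)) p v
        = mvfderiv 𝓘(ℝ, E) (fun q ↦ (inner ℝ (D Z q (A q)) (W q) : ℝ)) p v
          + mvfderiv 𝓘(ℝ, E) (fun q ↦ (inner ℝ (D W q (A q)) (Z q) : ℝ)) p v := by
    intro A hA v
    have e : mvfderiv 𝓘(ℝ, E) (fun q ↦ mvfderiv 𝓘(ℝ, E)
        (fun q ↦ (inner ℝ (Z q) (W q) : ℝ)) q (A q)) p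
        = mvfderiv 𝓘(ℝ, E) (fun q ↦ (inner ℝ (D Z q (A q)) (W q) : ℝ)
          + (inner ℝ (D W q (A q)) (Z q) : ℝ)) p := by
      refine mvfderiv_congr ?_
      filter_upwards [hZ.eventually, hW.eventually] with q hq hq'
      rw [hD.deriv_inner hq hq', real_inner_comm (D W q (A q))]
    rw [e, mvfderiv_fun_add ((hD.smooth hA hZ).inner hW).mdiff
      ((hD.smooth hA hW).inner hZ).mdiff]
    rfl
  rw [key hX, key hY, hD.deriv_inner hZ hW] at hB
  have e1 : X p = x := FiberBundle.extend_apply_self E x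
  have e2 : Y p = y := FiberBundle.extend_apply_self E y
  have e3 : Z p = z := FiberBundle.extend_apply_self E z
  have e4 : W p = w := FiberBundle.extend_apply_self E w
  rw [real_inner_comm (D W p (mlieBracket 𝓘(ℝ, E) X Y p)) (Z p)] at hB
  rw [real_inner_comm (D Z p (X p)) (D W p (Y p)), real_inner_comm (D Z p (Y p)) (D W p (X p))]
    at h2
  rw [e1, e2, e3, e4] at h1 h2
  rw [e1, e2, e3, e4] at hB
  linarith

/-- The octahedron argument: the four Bianchi identities on x, y, z, w combine with the two skew
symmetries to give the exchange of pairs. -/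
lemma inner_curvature_pair (hD : IsSmoothRiemannianConnection D) :
    (inner ℝ (curvature D p x y z) w : ℝ) = inner ℝ (curvature D p z w x) y := by
  have b : ∀ a b c d : TangentSpace 𝓘(ℝ, E) p, (inner ℝ (curvature D p a b c) d : ℝ)
      + inner ℝ (curvature D p b c a) d + inner ℝ (curvature D p c a b) d = 0 := by
    intro a b c d
    rw [← inner_add_left, ← inner_add_left, hD.bianchi, inner_zero_left]
  have s : ∀ a b c d : TangentSpace 𝓘(ℝ, E) p, (inner ℝ (curvature D p a b c) d : ℝ)
      = -inner ℝ (curvature D p b a c) d := by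
    intro a b c d
    rw [curvature_swap, inner_neg_left]
  have k := fun a b c d : TangentSpace 𝓘(ℝ, E) p ↦ hD.inner_curvature_skew a b c d
  linarith [b x y z w, b y z w x, b z w x y, b w x y z, s x y z w, s y z x w, s z x y w,
    s y z w x, s z w y x, s w y z x, s z w x y, s w x z y, s x z w y, s w x y z, s x y w z,
    s y w x z, k x y z w, k y z x w, k z x y w, k y z w x, k z w y x, k w y z x, k z w x y,
    k w x z y, k x z w y, k w x y z, k x y w z, k y w x z]

end IsSmoothRiemannianConnection

end Curvature

/-! ### Algebra of complex linear extension. -/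

section ComplexExtension

variable {V V' : Type*}

lemma cext_add (f g : V → ℂ) (z : Cplx V) :
    cext (fun x ↦ f x + g x) z = cext f z + cext g z := by
  simp only [cext]; ring

lemma cext_sub (f g : V → ℂ) (z : Cplx V) :
    cext (fun x ↦ f x - g x) z = cext f z - cext g z := by
  simp only [cext]; ring

lemma cext_neg (f : V → ℂ) (z : Cplx V) : cext (fun x ↦ -f x) z = -cext f z := by
  simp only [cext]; ring

lemma cext_mul_left (c : ℂ) (f : V → ℂ) (z : Cplx V) :
    cext (fun x ↦ c * f x) z = c * cext f z := by
  simp only [cext]; ring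

lemma cext_mul_right (c : ℂ) (f : V → ℂ) (z : Cplx V) :
    cext (fun x ↦ f x * c) z = cext f z * c := by
  simp only [cext]; ring

lemma cext_zero (z : Cplx V) : cext (fun _ ↦ (0 : ℂ)) z = 0 := by
  simp [cext]

lemma cext_sum {ι : Type*} (s : Finset ι) (f : ι → V → ℂ) (z : Cplx V) :
    cext (fun x ↦ ∑ i ∈ s, f i x) z = ∑ i ∈ s, cext (f i) z := by
  simp only [cext, Finset.mul_sum, Finset.sum_add_distrib]

lemma cext_comm (f : V → V' → ℂ) (z : Cplx V) (w : Cplx V') :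
    cext (fun x ↦ cext (fun y ↦ f x y) w) z = cext (fun y ↦ cext (fun x ↦ f x y) z) w := by
  simp only [cext]; ring

lemma cext_congr {f g : V → ℂ} {z : Cplx V} (h1 : f z.re = g z.re) (h2 : f z.im = g z.im) :
    cext f z = cext g z := by
  simp only [cext, h1, h2]

end ComplexExtension

/-! ### Derivatives of complex-valued functions. -/

section ComplexDerivative

variable {E : Type*} [NormedAddCommGroup E] [NormedSpace ℝ E] [FiniteDimensional ℝ E]
  {M : Type*} [TopologicalSpace M] [ChartedSpace E M] [IsManifold 𝓘(ℝ, E) ∞ M]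
  {p : M}

lemma SmoothFnNear.ofReal {f : M → ℝ} (hf : SmoothFnNear E f p) :
    MDifferentiableAt 𝓘(ℝ, E) 𝓘(ℝ, ℂ) (fun q ↦ (f q : ℂ)) p :=
  Complex.ofRealCLM.differentiableAt.comp_mdifferentiableAt hf.mdiff

lemma mvfderiv_ofReal {f : M → ℝ} (hf : SmoothFnNear E f p) (v : TangentSpace 𝓘(ℝ, E) p) :
    mvfderiv 𝓘(ℝ, E) (fun q ↦ (f q : ℂ)) p v = ((mvfderiv 𝓘(ℝ, E) f p v : ℝ) : ℂ) := by
  have h := (Complex.ofRealCLM.hasFDerivAt (x := f p)).hasMFDerivAt.comp p hf.mdiff.hasMFDerivAt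
  have h1 : mfderiv 𝓘(ℝ, E) 𝓘(ℝ, ℂ) (fun q ↦ (f q : ℂ)) p = _ := h.mfderiv
  simp only [mvfderiv, ContinuousLinearMap.comp_apply]
  rw [h1]
  rfl

lemma mdifferentiableAt_I_mul {f : M → ℂ} (hf : MDifferentiableAt 𝓘(ℝ, E) 𝓘(ℝ, ℂ) f p) :
    MDifferentiableAt 𝓘(ℝ, E) 𝓘(ℝ, ℂ) (fun q ↦ Complex.I * f q) p :=
  ((ContinuousLinearMap.mul ℝ ℂ) Complex.I).differentiableAt.comp_mdifferentiableAt hf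

lemma mvfderiv_I_mul {f : M → ℂ} (hf : MDifferentiableAt 𝓘(ℝ, E) 𝓘(ℝ, ℂ) f p)
    (v : TangentSpace 𝓘(ℝ, E) p) :
    mvfderiv 𝓘(ℝ, E) (fun q ↦ Complex.I * f q) p v = Complex.I * mvfderiv 𝓘(ℝ, E) f p v := by
  have h := (((ContinuousLinearMap.mul ℝ ℂ) Complex.I).hasFDerivAt
    (x := f p)).hasMFDerivAt.comp p hf.hasMFDerivAt
  have h1 : mfderiv 𝓘(ℝ, E) 𝓘(ℝ, ℂ) (fun q ↦ Complex.I * f q) p = _ := h.mfderiv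
  simp only [mvfderiv, ContinuousLinearMap.comp_apply]
  rw [h1]
  rfl

lemma mdifferentiableAt_cext {V : Type*} {f : V → M → ℂ} {z : Cplx V}
    (h1 : MDifferentiableAt 𝓘(ℝ, E) 𝓘(ℝ, ℂ) (f z.re) p)
    (h2 : MDifferentiableAt 𝓘(ℝ, E) 𝓘(ℝ, ℂ) (f z.im) p) :
    MDifferentiableAt 𝓘(ℝ, E) 𝓘(ℝ, ℂ) (fun q ↦ cext (fun x ↦ f x q) z) p :=
  h1.add (mdifferentiableAt_I_mul h2)

lemma mvfderiv_cext {V : Type*} {f : V → M → ℂ} {z : Cplx V}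
    (h1 : MDifferentiableAt 𝓘(ℝ, E) 𝓘(ℝ, ℂ) (f z.re) p)
    (h2 : MDifferentiableAt 𝓘(ℝ, E) 𝓘(ℝ, ℂ) (f z.im) p) (v : TangentSpace 𝓘(ℝ, E) p) :
    mvfderiv 𝓘(ℝ, E) (fun q ↦ cext (fun x ↦ f x q) z) p v
      = cext (fun x ↦ mvfderiv 𝓘(ℝ, E) (f x) p v) z := by
  unfold cext
  rw [mvfderiv_fun_add h1 (mdifferentiableAt_I_mul h2), add_apply,
    mvfderiv_I_mul h2]

end ComplexDerivative

/-! ### The complex vectors of an A-frame as eigenvectors of Φ. -/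

section ComplexFrames

variable {E : Type*} [NormedAddCommGroup E] [NormedSpace ℝ E] [FiniteDimensional ℝ E]
  {M : Type*} [TopologicalSpace M] [ChartedSpace E M] [IsManifold 𝓘(ℝ, E) ∞ M]
  [RiemannianBundle (fun p : M ↦ TangentSpace 𝓘(ℝ, E) p)]
  [IsContMDiffRiemannianBundle 𝓘(ℝ, E) ∞ E (fun p : M ↦ TangentSpace 𝓘(ℝ, E) p)]
  {p : M}

/-- The complex bilinear extension of the metric. -/
def cinner (z w : Cplx (TangentSpace 𝓘(ℝ, E) p)) : ℂ :=
  cext (fun x ↦ cext (fun y ↦ ((inner ℝ x y : ℝ) : ℂ)) w) z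

/-- A complex vector field is smooth near `p`. -/
structure CSmoothNear (Z : Cplx (VField E M)) (p : M) : Prop where
  re : SmoothNear Z.re p
  im : SmoothNear Z.im p

namespace AlmostContactMetric

variable (S : AlmostContactMetric E M)

/-- The complex vector `z` satisfies `Φ z = s √-1 z`. -/
structure IsTypeAt (s : ℝ) (z : Cplx (TangentSpace 𝓘(ℝ, E) p)) : Prop where
  re : S.Φ p z.re = -(s • z.im)
  im : S.Φ p z.im = s • z.re

/-- The complex vector field `Z` satisfies `Φ Z = s √-1 Z` near `p`. -/
structure IsTypeNear (s : ℝ) (Z : Cplx (VField E M)) (p : M) : Prop extends CSmoothNear Z p where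
  eig : ∀ᶠ q in 𝓝 p, S.IsTypeAt s (Z.at q)

variable {S} {n : ℕ} {e : Fin n → VField E M} {s : ℝ}

lemma IsTypeNear.at {Z : Cplx (VField E M)} (h : S.IsTypeNear s Z p) : S.IsTypeAt s (Z.at p) :=
  h.eig.self_of_nhds

lemma IsTypeAt.re_inner_ξ {z : Cplx (TangentSpace 𝓘(ℝ, E) p)} (h : S.IsTypeAt s z)
    (hs : s ≠ 0) : (inner ℝ z.re (S.ξ p) : ℝ) = 0 := by
  have h1 := S.η_Φ p z.im
  rw [h.im, inner_smul_left] at h1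
  simpa [hs] using h1

lemma IsTypeAt.im_inner_ξ {z : Cplx (TangentSpace 𝓘(ℝ, E) p)} (h : S.IsTypeAt s z)
    (hs : s ≠ 0) : (inner ℝ z.im (S.ξ p) : ℝ) = 0 := by
  have h1 := S.η_Φ p z.re
  rw [h.re, inner_neg_left, inner_smul_left] at h1
  simpa [hs] using h1

lemma IsTypeAt.cext_Φ {z : Cplx (TangentSpace 𝓘(ℝ, E) p)} (h : S.IsTypeAt s z)
    (f : TangentSpace 𝓘(ℝ, E) p →ₗ[ℝ] ℂ) :
    cext (fun x ↦ f (S.Φ p x)) z = Complex.I * s * cext f z := by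
  simp only [cext, h.re, h.im, map_neg, map_smul, Complex.real_smul]
  linear_combination (-(s : ℂ) * f z.im) * Complex.I_sq

lemma IsAFrameNear.eps_isType (h : S.IsAFrameNear p e) (a : Fin n) :
    S.IsTypeNear 1 (S.eps e a) p where
  re := (h.smooth a).const_smul _
  im := ((S.smoothNear_Φ (h.smooth a)).const_smul _).neg
  eig := by
    filter_upwards [h.frame] with q hq
    constructor
    · simp [eps, Cplx.at]
    · simp [eps, Cplx.at, S.Φ_Φ, hq.inner_ξ]

lemma IsAFrameNear.epsBar_isType (h : S.IsAFrameNear p e) (a : Fin n) :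
    S.IsTypeNear (-1) (S.epsBar e a) p where
  re := (h.smooth a).const_smul _
  im := (S.smoothNear_Φ (h.smooth a)).const_smul _
  eig := by
    filter_upwards [h.frame] with q hq
    constructor
    · simp [epsBar, Cplx.at]
    · simp [epsBar, Cplx.at, S.Φ_Φ, hq.inner_ξ]

lemma ofReal_inv_sqrt_two_mul_self : (((√2)⁻¹ : ℝ) : ℂ) * (((√2)⁻¹ : ℝ) : ℂ) = 1 / 2 := by
  rw [← Complex.ofReal_mul, ← mul_inv, Real.mul_self_sqrt (by norm_num)]
  norm_num

lemma cext_eps (f : TangentSpace 𝓘(ℝ, E) p →ₗ[ℝ] ℂ) (a : Fin n) :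
    cext f ((S.eps e a).at p)
      = (((√2)⁻¹ : ℝ) : ℂ) * (f (e a p) - Complex.I * f (S.Φ p (e a p))) := by
  simp only [cext, Cplx.at, eps, map_neg, map_smul, Complex.real_smul, one_div]
  ring

lemma cext_epsBar (f : TangentSpace 𝓘(ℝ, E) p →ₗ[ℝ] ℂ) (a : Fin n) :
    cext f ((S.epsBar e a).at p)
      = (((√2)⁻¹ : ℝ) : ℂ) * (f (e a p) + Complex.I * f (S.Φ p (e a p))) := by
  simp only [cext, Cplx.at, epsBar, map_smul, Complex.real_smul, one_div]
  ring

/-- The linear form `⟨·, y⟩` with values in `ℂ`. -/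
def innerForm (y : TangentSpace 𝓘(ℝ, E) p) : TangentSpace 𝓘(ℝ, E) p →ₗ[ℝ] ℂ where
  toFun x := ((inner ℝ x y : ℝ) : ℂ)
  map_add' x x' := by simp [inner_add_left]
  map_smul' c x := by simp [inner_smul_left]

lemma innerForm_apply (x y : TangentSpace 𝓘(ℝ, E) p) :
    innerForm y x = ((inner ℝ x y : ℝ) : ℂ) := rfl

lemma cext_inner_right (x : TangentSpace 𝓘(ℝ, E) p) (z : Cplx (TangentSpace 𝓘(ℝ, E) p)) :
    cext (fun y ↦ ((inner ℝ x y : ℝ) : ℂ)) z = cext (innerForm x) z := by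
  simp only [cext, innerForm_apply, real_inner_comm]

/-- Since ε_a and ε_â are dual to each other under the complex metric, x = η(x)ξ + Σ (g(x, ε_â)ε_a +
g(x, ε_a)ε_â); f is applied to this expansion. -/
lemma IsAFrameAt.cext_expand (h : S.IsAFrameAt p (fun a ↦ e a p))
    (hE : Module.finrank ℝ E = 2 * n + 1) (f : TangentSpace 𝓘(ℝ, E) p →ₗ[ℝ] ℂ)
    (x : TangentSpace 𝓘(ℝ, E) p) :
    f x = ((inner ℝ x (S.ξ p) : ℝ) : ℂ) * f (S.ξ p)
      + ∑ a, (cext (fun y ↦ ((inner ℝ x y : ℝ) : ℂ)) ((S.epsBar e a).at p)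
          * cext f ((S.eps e a).at p)
        + cext (fun y ↦ ((inner ℝ x y : ℝ) : ℂ)) ((S.eps e a).at p)
          * cext f ((S.epsBar e a).at p)) := by
  conv_lhs => rw [h.expand hE x]
  simp only [map_add, map_sum, map_smul, Complex.real_smul, cext_inner_right, cext_eps,
    cext_epsBar, innerForm_apply]
  rw [add_assoc, ← Finset.sum_add_distrib, real_inner_comm x (S.ξ p)]
  congr 1
  refine Finset.sum_congr rfl fun a _ ↦ ?_
  have h2 := ofReal_inv_sqrt_two_mul_self
  have hI := Complex.I_sq
  set c : ℂ := (((√2)⁻¹ : ℝ) : ℂ)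
  set A : ℂ := ((inner ℝ (e a p) x : ℝ) : ℂ)
  set B : ℂ := ((inner ℝ (S.Φ p (e a p)) x : ℝ) : ℂ)
  set F := f (e a p)
  set G := f (S.Φ p (e a p))
  linear_combination (-2 * (A * F + B * G)) * h2 + (2 * c * c * B * G) * hI

lemma IsAFrameAt.cinner_eps_eps (h : S.IsAFrameAt p (fun a ↦ e a p)) (a b : Fin n) :
    cinner ((S.eps e a).at p) ((S.eps e b).at p) = 0 := by
  unfold cinner
  simp only [cext, Cplx.at, eps, inner_neg_left, inner_neg_right, inner_smul_left,
    inner_smul_right, h.inner_e, h.inner_Φ, h.Φ_inner, h.inner_ΦΦ]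
  split_ifs <;> simp
  linear_combination (Complex.ofReal (√2))⁻¹ * (Complex.ofReal (√2))⁻¹ * Complex.I_sq

lemma IsAFrameAt.cinner_epsBar_epsBar (h : S.IsAFrameAt p (fun a ↦ e a p)) (a b : Fin n) :
    cinner ((S.epsBar e a).at p) ((S.epsBar e b).at p) = 0 := by
  unfold cinner
  simp only [cext, Cplx.at, epsBar, inner_smul_left,
    inner_smul_right, h.inner_e, h.inner_Φ, h.Φ_inner, h.inner_ΦΦ]
  split_ifs <;> simp
  linear_combination (Complex.ofReal (√2))⁻¹ * (Complex.ofReal (√2))⁻¹ * Complex.I_sq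

lemma IsAFrameAt.cinner_eps_epsBar (h : S.IsAFrameAt p (fun a ↦ e a p)) (a b : Fin n) :
    cinner ((S.eps e a).at p) ((S.epsBar e b).at p) = delta a b := by
  have h2 := ofReal_inv_sqrt_two_mul_self
  unfold cinner delta
  simp only [cext, Cplx.at, eps, epsBar, inner_neg_left, inner_smul_left,
    inner_smul_right, h.inner_e, h.inner_Φ, h.Φ_inner, h.inner_ΦΦ]
  split_ifs <;> simp
  rw [Complex.ofReal_inv] at h2
  linear_combination 2 * h2
    - (Complex.ofReal (√2))⁻¹ * (Complex.ofReal (√2))⁻¹ * Complex.I_sq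

lemma cinner_comm (z w : Cplx (TangentSpace 𝓘(ℝ, E) p)) : cinner z w = cinner w z := by
  unfold cinner
  rw [cext_comm]
  simp only [cext, real_inner_comm]

lemma delta_comm {n : ℕ} (a b : Fin n) : delta a b = delta b a := by
  unfold delta
  simp only [eq_comm]

lemma IsAFrameAt.cinner_epsBar_eps (h : S.IsAFrameAt p (fun a ↦ e a p)) (a b : Fin n) :
    cinner ((S.epsBar e a).at p) ((S.eps e b).at p) = delta a b := by
  rw [cinner_comm, h.cinner_eps_epsBar, delta_comm]

end AlmostContactMetric

end ComplexFrames

/-! ### Consequences of the Kenmotsu condition for ξ and for R(·, ·)ξ. -/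

section KenmotsuReal

variable {E : Type*} [NormedAddCommGroup E] [NormedSpace ℝ E] [FiniteDimensional ℝ E]
  {M : Type*} [TopologicalSpace M] [ChartedSpace E M] [IsManifold 𝓘(ℝ, E) ∞ M]
  [RiemannianBundle (fun p : M ↦ TangentSpace 𝓘(ℝ, E) p)]
  [IsContMDiffRiemannianBundle 𝓘(ℝ, E) ∞ E (fun p : M ↦ TangentSpace 𝓘(ℝ, E) p)]
  {D : CovariantDerivative 𝓘(ℝ, E) E (fun p : M ↦ TangentSpace 𝓘(ℝ, E) p)}
  {S : AlmostContactMetric E M} {X Y Z W : VField E M} {p : M}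

namespace AlmostContactMetric

lemma tensorial_covDerivEndo (v : TangentSpace 𝓘(ℝ, E) p) :
    IsTensorialNear (fun Y ↦ D (fun q ↦ S.Φ q (Y q)) p v - S.Φ p (D Y p v)) p where
  add {Y Y'} hY hY' := by
    have h1 : (fun q ↦ S.Φ q ((Y + Y') q))
        = (fun q ↦ S.Φ q (Y q)) + fun q ↦ S.Φ q (Y' q) := by
      funext q; exact map_add _ _ _
    rw [h1, cov_add (S.smoothNear_Φ hY) (S.smoothNear_Φ hY'), cov_add hY hY', map_add]
    abel
  smul {f Y} hf hY := by
    have h1 : (fun q ↦ S.Φ q ((f • Y) q)) = f • fun q ↦ S.Φ q (Y q) := by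
      funext q; exact map_smul _ _ _
    rw [h1, cov_smul hf (S.smoothNear_Φ hY), cov_smul hf hY, map_add, map_smul, map_smul]
    module

lemma covDerivEndo_eq (hY : SmoothNear Y p) (v : TangentSpace 𝓘(ℝ, E) p) :
    covDerivEndo D S.Φ p v (Y p) = D (fun q ↦ S.Φ q (Y q)) p v - S.Φ p (D Y p v) :=
  (tensorial_covDerivEndo v).pointwise (smoothNear_extend (Y p)) hY
    (FiberBundle.extend_apply_self E _)

lemma covDerivEndo_add_right (v x y : TangentSpace 𝓘(ℝ, E) p) :
    covDerivEndo D S.Φ p v (x + y) = covDerivEndo D S.Φ p v x + covDerivEndo D S.Φ p v y := by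
  have h := covDerivEndo_eq (D := D) (S := S) ((smoothNear_extend x).add (smoothNear_extend y)) v
  rw [(tensorial_covDerivEndo v).add (smoothNear_extend x) (smoothNear_extend y)] at h
  simp at h
  exact h

lemma covDerivEndo_smul_right (c : ℝ) (v x : TangentSpace 𝓘(ℝ, E) p) :
    covDerivEndo D S.Φ p v (c • x) = c • covDerivEndo D S.Φ p v x := by
  have h := covDerivEndo_eq (D := D) (S := S)
    (SmoothNear.smul (SmoothFnNear.const c) (smoothNear_extend x)) v
  rw [(tensorial_covDerivEndo v).smul (SmoothFnNear.const c) (smoothNear_extend x)] at h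
  simp at h
  exact h

lemma covDerivEndo_add_left (v w x : TangentSpace 𝓘(ℝ, E) p) :
    covDerivEndo D S.Φ p (v + w) x = covDerivEndo D S.Φ p v x + covDerivEndo D S.Φ p w x := by
  simp only [covDerivEndo, map_add]
  abel

lemma covDerivEndo_smul_left (c : ℝ) (v x : TangentSpace 𝓘(ℝ, E) p) :
    covDerivEndo D S.Φ p (c • v) x = c • covDerivEndo D S.Φ p v x := by
  simp only [covDerivEndo, map_smul, smul_sub]

lemma inner_cov_ξ_self (hD : IsRiemannianConnection D) (v : TangentSpace 𝓘(ℝ, E) p) :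
    (inner ℝ (D S.ξ p v) (S.ξ p) : ℝ) = 0 := by
  have h := hD.deriv_inner (S.smoothNear_ξ (p := p)) S.smoothNear_ξ v
  simp only [S.η_ξ] at h
  rw [mvfderiv_const, real_inner_comm (D S.ξ p v) (S.ξ p)] at h
  have h' : (0 : ℝ) = inner ℝ (D S.ξ p v) (S.ξ p) + inner ℝ (D S.ξ p v) (S.ξ p) := h
  linarith

/-- On a manifold of Kenmotsu type, `∇_v ξ = v - η(v) ξ`. -/
lemma cov_ξ (hD : IsRiemannianConnection D) (hS : S.IsKenmotsuType D)
    (v : TangentSpace 𝓘(ℝ, E) p) :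
    D S.ξ p v = v - (inner ℝ v (S.ξ p) : ℝ) • S.ξ p := by
  -- At Y = ξ the second term of the identity vanishes and the first is -Φ∇_v ξ, so Φ∇_v ξ = Φv.
  -- Applying Φ again determines ∇_v ξ up to its ξ-component, which is zero because ξ has unit
  -- length.
  have h := hS p v (S.ξ p)
  have h0 : covDerivEndo D S.Φ p (S.Φ p v) 0 = 0 := by
    have := covDerivEndo_smul_right (D := D) (S := S) 0 (S.Φ p v) 0
    simpa using this
  rw [S.Φ_ξ, h0, covDerivEndo_eq S.smoothNear_ξ] at h
  have h1 : (fun q ↦ S.Φ q (S.ξ q)) = 0 := by funext q; exact S.Φ_ξ q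
  rw [h1, CovariantDerivative.zero] at h
  have h2 : S.Φ p (D S.ξ p v) = S.Φ p v := by
    simpa [-inner_self_eq_norm_sq_to_K, η, S.η_ξ] using h
  have h3 := congrArg (S.Φ p) h2
  rw [S.Φ_Φ, S.Φ_Φ, inner_cov_ξ_self hD] at h3
  linear_combination (norm := module) (-1 : ℝ) • h3

/-- Differentiate g(Z, ξ) = 0 in the direction v and insert ∇_v ξ = v - η(v)ξ. -/
lemma inner_cov_ξ (hD : IsRiemannianConnection D) (hS : S.IsKenmotsuType D)
    (hZ : SmoothNear Z p) (h0 : ∀ᶠ q in 𝓝 p, (inner ℝ (Z q) (S.ξ q) : ℝ) = 0)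
    (v : TangentSpace 𝓘(ℝ, E) p) :
    (inner ℝ (D Z p v) (S.ξ p) : ℝ) = -inner ℝ (Z p) v := by
  have h := hD.deriv_inner hZ S.smoothNear_ξ v
  rw [mvfderiv_congr h0, mvfderiv_const, cov_ξ hD hS, inner_sub_right, inner_smul_right,
    h0.self_of_nhds, mul_zero, sub_zero] at h
  have h' : (0 : ℝ) = inner ℝ (D Z p v) (S.ξ p) + inner ℝ (Z p) v := h
  linarith

/-- On a manifold of Kenmotsu type, `R(x, y)ξ = η(x) y - η(y) x`. -/
lemma curvature_ξ (hD : IsSmoothRiemannianConnection D) (hS : S.IsKenmotsuType D)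
    (x y : TangentSpace 𝓘(ℝ, E) p) :
    curvature D p x y (S.ξ p)
      = (inner ℝ x (S.ξ p) : ℝ) • y - (inner ℝ y (S.ξ p) : ℝ) • x := by
  set X : VField E M := FiberBundle.extend E x
  set Y : VField E M := FiberBundle.extend E y
  have hX : SmoothNear X p := smoothNear_extend x
  have hY : SmoothNear Y p := smoothNear_extend y
  have hξ : SmoothNear S.ξ p := S.smoothNear_ξ
  have hXp : X p = x := FiberBundle.extend_apply_self E x
  have hYp : Y p = y := FiberBundle.extend_apply_self E y
  have h := hD.curvatureField_eq hX hY hξ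
  rw [hXp, hYp] at h
  rw [← h]
  have key : ∀ {A B : VField E M}, SmoothNear A p → SmoothNear B p →
      D (fun q ↦ D S.ξ q (B q)) p (A p)
        = D B p (A p) - ((inner ℝ (B p) (S.ξ p) : ℝ) • D S.ξ p (A p)
          + (inner ℝ (D B p (A p)) (S.ξ p) + inner ℝ (B p) (D S.ξ p (A p)) : ℝ) • S.ξ p) := by
    intro A B hA hB
    have h1 : (fun q ↦ D S.ξ q (B q)) = B - (fun q ↦ (inner ℝ (B q) (S.ξ q) : ℝ)) • S.ξ := by
      funext q; exact cov_ξ hD.toIsRiemannianConnection hS (B q)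
    rw [h1, cov_sub hB (SmoothNear.smul (hB.inner hξ) hξ), cov_smul (hB.inner hξ) hξ,
      hD.deriv_inner hB hξ]
  unfold curvatureField
  rw [key hX hY, key hY hX, ← hD.bracket hX hY]
  simp only [cov_ξ hD.toIsRiemannianConnection hS, inner_sub_left, inner_sub_right,
    inner_smul_right, hXp, hYp, real_inner_comm y x]
  module

end AlmostContactMetric

end KenmotsuReal

/-! ### Complexified connection coefficients and curvature. -/

section ComplexConnection

variable {E : Type*} [NormedAddCommGroup E] [NormedSpace ℝ E] [FiniteDimensional ℝ E]
  {M : Type*} [TopologicalSpace M] [ChartedSpace E M] [IsManifold 𝓘(ℝ, E) ∞ M]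
  [RiemannianBundle (fun p : M ↦ TangentSpace 𝓘(ℝ, E) p)]
  [IsContMDiffRiemannianBundle 𝓘(ℝ, E) ∞ E (fun p : M ↦ TangentSpace 𝓘(ℝ, E) p)]
  {D : CovariantDerivative 𝓘(ℝ, E) E (fun p : M ↦ TangentSpace 𝓘(ℝ, E) p)}
  {S : AlmostContactMetric E M} {n : ℕ} {e : Fin n → VField E M} {p : M}

lemma mdifferentiableAt_cext₂ {V V' : Type*} {f : V → V' → M → ℝ} {z : Cplx V} {w : Cplx V'}
    (h : ∀ x y, (x = z.re ∨ x = z.im) → (y = w.re ∨ y = w.im) → SmoothFnNear E (f x y) p) :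
    MDifferentiableAt 𝓘(ℝ, E) 𝓘(ℝ, ℂ)
      (fun q ↦ cext (fun x ↦ cext (fun y ↦ (f x y q : ℂ)) w) z) p :=
  mdifferentiableAt_cext
    (mdifferentiableAt_cext (f := fun y q ↦ (f z.re y q : ℂ))
      (h _ _ (.inl rfl) (.inl rfl)).ofReal (h _ _ (.inl rfl) (.inr rfl)).ofReal)
    (mdifferentiableAt_cext (f := fun y q ↦ (f z.im y q : ℂ))
      (h _ _ (.inr rfl) (.inl rfl)).ofReal (h _ _ (.inr rfl) (.inr rfl)).ofReal)

lemma mvfderiv_cext₂ {V V' : Type*} {f : V → V' → M → ℝ} {z : Cplx V} {w : Cplx V'}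
    (h : ∀ x y, (x = z.re ∨ x = z.im) → (y = w.re ∨ y = w.im) → SmoothFnNear E (f x y) p)
    (v : TangentSpace 𝓘(ℝ, E) p) :
    mvfderiv 𝓘(ℝ, E) (fun q ↦ cext (fun x ↦ cext (fun y ↦ (f x y q : ℂ)) w) z) p v
      = cext (fun x ↦ cext (fun y ↦ ((mvfderiv 𝓘(ℝ, E) (f x y) p v : ℝ) : ℂ)) w) z := by
  have a1 := h _ _ (.inl rfl) (.inl rfl)
  have a2 := h _ _ (.inl rfl) (.inr rfl)
  have a3 := h _ _ (.inr rfl) (.inl rfl)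
  have a4 := h _ _ (.inr rfl) (.inr rfl)
  rw [mvfderiv_cext (f := fun x q ↦ cext (fun y ↦ (f x y q : ℂ)) w)
    (mdifferentiableAt_cext (f := fun y q ↦ (f z.re y q : ℂ)) a1.ofReal a2.ofReal)
    (mdifferentiableAt_cext (f := fun y q ↦ (f z.im y q : ℂ)) a3.ofReal a4.ofReal)]
  refine cext_congr ?_ ?_
  · rw [mvfderiv_cext (f := fun y q ↦ (f z.re y q : ℂ)) a1.ofReal a2.ofReal]
    exact cext_congr (mvfderiv_ofReal a1 v) (mvfderiv_ofReal a2 v)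
  · rw [mvfderiv_cext (f := fun y q ↦ (f z.im y q : ℂ)) a3.ofReal a4.ofReal]
    exact cext_congr (mvfderiv_ofReal a3 v) (mvfderiv_ofReal a4 v)

variable (D) in
/-- The complex bilinear extension of `g(∇_v Z, W)`. -/
def conn (p : M) (v : TangentSpace 𝓘(ℝ, E) p) (Z W : Cplx (VField E M)) : ℂ :=
  cext (fun X ↦ cext (fun Y ↦ ((inner ℝ (D X p v) (Y p) : ℝ) : ℂ)) W) Z

variable (D) in
/-- `conn` as a linear form in the direction of differentiation. -/
def connForm' (p : M) (Z W : Cplx (VField E M)) : TangentSpace 𝓘(ℝ, E) p →ₗ[ℝ] ℂ where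
  toFun v := conn D p v Z W
  map_add' v w := by
    simp only [conn, cext, map_add, inner_add_left, Complex.ofReal_add]; ring
  map_smul' c v := by
    simp only [conn, cext, map_smul, inner_smul_left, Complex.ofReal_mul, Complex.real_smul,
      RingHom.id_apply, conj_trivial]
    ring

lemma connForm'_apply (v : TangentSpace 𝓘(ℝ, E) p) (Z W : Cplx (VField E M)) :
    connForm' D p Z W v = conn D p v Z W := rfl

variable (D) in
/-- The complex trilinear extension of `g(∇_X Z, W)`. -/
def conn₃ (p : M) (X Z W : Cplx (VField E M)) : ℂ :=
  cext (fun Y ↦ conn D p (Y p) Z W) X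

/-- The derivative of the constant function g(Z, W). The frame relations must hold on a
neighbourhood of p, not only at p. -/
lemma conn_add_swap (hD : IsRiemannianConnection D) {Z W : Cplx (VField E M)}
    (hZ : CSmoothNear Z p) (hW : CSmoothNear W p) {c : ℂ}
    (h : ∀ᶠ q in 𝓝 p, cinner (Z.at q) (W.at q) = c) (v : TangentSpace 𝓘(ℝ, E) p) :
    conn D p v Z W + conn D p v W Z = 0 := by
  have h0 : mvfderiv 𝓘(ℝ, E) (fun q ↦ cext (fun x : VField E M ↦
      cext (fun y : VField E M ↦ ((inner ℝ (x q) (y q) : ℝ) : ℂ)) W) Z) p v = 0 := by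
    have h1 : mvfderiv 𝓘(ℝ, E) (fun q ↦ cext (fun x : VField E M ↦
      cext (fun y : VField E M ↦ ((inner ℝ (x q) (y q) : ℝ) : ℂ)) W) Z) p
        = mvfderiv 𝓘(ℝ, E) (fun _ ↦ c) p := mvfderiv_congr h
    rw [h1, mvfderiv_const]; rfl
  rw [mvfderiv_cext₂ (f := fun (x y : VField E M) q ↦ (inner ℝ (x q) (y q) : ℝ))] at h0
  · have h2 : conn D p v W Z = cext (fun X : VField E M ↦ cext (fun Y : VField E M ↦
        ((inner ℝ (X p) (D Y p v) : ℝ) : ℂ)) W) Z := by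
      unfold conn
      rw [cext_comm]
      simp only [cext, real_inner_comm]
    rw [h2]
    rw [← h0]
    simp only [conn, cext, hD.deriv_inner hZ.re hW.re, hD.deriv_inner hZ.re hW.im,
      hD.deriv_inner hZ.im hW.re, hD.deriv_inner hZ.im hW.im, Complex.ofReal_add]
    ring
  · rintro x y (rfl | rfl) (rfl | rfl)
    · exact hZ.re.inner hW.re
    · exact hZ.re.inner hW.im
    · exact hZ.im.inner hW.re
    · exact hZ.im.inner hW.im

lemma conn_smooth (hD : IsSmoothRiemannianConnection D) {Y : VField E M}
    {Z W : Cplx (VField E M)} (hY : SmoothNear Y p) (hZ : CSmoothNear Z p)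
    (hW : CSmoothNear W p) (x y : VField E M) (hx : x = Z.re ∨ x = Z.im)
    (hy : y = W.re ∨ y = W.im) :
    SmoothFnNear E (fun q ↦ (inner ℝ (D x q (Y q)) (y q) : ℝ)) p := by
  rcases hx with rfl | rfl <;> rcases hy with rfl | rfl
  · exact (hD.smooth hY hZ.re).inner hW.re
  · exact (hD.smooth hY hZ.re).inner hW.im
  · exact (hD.smooth hY hZ.im).inner hW.re
  · exact (hD.smooth hY hZ.im).inner hW.im

lemma mdifferentiableAt_conn (hD : IsSmoothRiemannianConnection D) {Y : VField E M}
    {Z W : Cplx (VField E M)} (hY : SmoothNear Y p) (hZ : CSmoothNear Z p)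
    (hW : CSmoothNear W p) :
    MDifferentiableAt 𝓘(ℝ, E) 𝓘(ℝ, ℂ) (fun q ↦ conn D q (Y q) Z W) p :=
  mdifferentiableAt_cext₂ (f := fun (x y : VField E M) q ↦ (inner ℝ (D x q (Y q)) (y q) : ℝ))
    (conn_smooth hD hY hZ hW)

lemma mvfderiv_conn (hD : IsSmoothRiemannianConnection D) {Y : VField E M}
    {Z W : Cplx (VField E M)} (hY : SmoothNear Y p) (hZ : CSmoothNear Z p)
    (hW : CSmoothNear W p) (v : TangentSpace 𝓘(ℝ, E) p) :
    mvfderiv 𝓘(ℝ, E) (fun q ↦ conn D q (Y q) Z W) p v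
      = cext (fun x ↦ cext (fun y ↦ ((mvfderiv 𝓘(ℝ, E)
        (fun q ↦ (inner ℝ (D x q (Y q)) (y q) : ℝ)) p v : ℝ) : ℂ)) W) Z :=
  mvfderiv_cext₂ (f := fun (x y : VField E M) q ↦ (inner ℝ (D x q (Y q)) (y q) : ℝ))
    (conn_smooth hD hY hZ hW) v

variable (D) in
/-- The complex bilinear extension of `g(R(x, y)z, w)` in `z` and `w`. -/
def ccurv₂ (p : M) (x y : TangentSpace 𝓘(ℝ, E) p) (z w : Cplx (TangentSpace 𝓘(ℝ, E) p)) : ℂ :=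
  cext (fun z ↦ cext (fun w ↦ ((inner ℝ (curvature D p x y z) w : ℝ) : ℂ)) w) z

variable (D) in
/-- The complex bilinear extension of `g(∇_v Z, ∇_w W)`. -/
def covProd (p : M) (v w : TangentSpace 𝓘(ℝ, E) p) (Z W : Cplx (VField E M)) : ℂ :=
  cext (fun X ↦ cext (fun Y ↦ ((inner ℝ (D X p v) (D Y p w) : ℝ) : ℂ)) W) Z

lemma ccurv₂_eq (hD : IsSmoothRiemannianConnection D) {X Y : VField E M}
    {Z W : Cplx (VField E M)} (hX : SmoothNear X p) (hY : SmoothNear Y p)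
    (hZ : CSmoothNear Z p) (hW : CSmoothNear W p) :
    ccurv₂ D p (X p) (Y p) (Z.at p) (W.at p)
      = mvfderiv 𝓘(ℝ, E) (fun q ↦ conn D q (Y q) Z W) p (X p) - covProd D p (Y p) (X p) Z W
        - (mvfderiv 𝓘(ℝ, E) (fun q ↦ conn D q (X q) Z W) p (Y p)
          - covProd D p (X p) (Y p) Z W)
        - conn D p (VectorField.mlieBracket 𝓘(ℝ, E) X Y p) Z W := by
  rw [mvfderiv_conn hD hY hZ hW, mvfderiv_conn hD hX hZ hW]
  simp only [ccurv₂, covProd, conn, cext, Cplx.at, hD.inner_curvature hX hY hZ.re hW.re,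
    hD.inner_curvature hX hY hZ.re hW.im, hD.inner_curvature hX hY hZ.im hW.re,
    hD.inner_curvature hX hY hZ.im hW.im, Complex.ofReal_sub]
  ring

namespace AlmostContactMetric

lemma cext_inner_cov_ξ (hD : IsRiemannianConnection D) (hS : S.IsKenmotsuType D)
    {s : ℝ} (hs : s ≠ 0) {Z : Cplx (VField E M)} (hZ : S.IsTypeNear s Z p)
    (v : TangentSpace 𝓘(ℝ, E) p) :
    cext (fun X ↦ ((inner ℝ (D X p v) (S.ξ p) : ℝ) : ℂ)) Z
      = -cext (fun x ↦ ((inner ℝ x v : ℝ) : ℂ)) (Z.at p) := by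
  have h1 := inner_cov_ξ hD hS hZ.re (hZ.eig.mono fun q hq ↦ hq.re_inner_ξ hs) v
  have h2 := inner_cov_ξ hD hS hZ.im (hZ.eig.mono fun q hq ↦ hq.im_inner_ξ hs) v
  simp only [cext, Cplx.at, h1, h2, Complex.ofReal_neg]
  ring

/-- Expansion of `g(∇_v Z, ∇_w W)` in an A-frame. -/
lemma covProd_expand (hD : IsRiemannianConnection D) (hS : S.IsKenmotsuType D)
    (hE : Module.finrank ℝ E = 2 * n + 1) (he : S.IsAFrameAt p (fun a ↦ e a p))
    {s t : ℝ} (hs : s ≠ 0) (ht : t ≠ 0) {Z W : Cplx (VField E M)}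
    (hZ : S.IsTypeNear s Z p) (hW : S.IsTypeNear t W p) (v w : TangentSpace 𝓘(ℝ, E) p) :
    covProd D p v w Z W
      = cext (fun x ↦ ((inner ℝ x v : ℝ) : ℂ)) (Z.at p)
          * cext (fun x ↦ ((inner ℝ x w : ℝ) : ℂ)) (W.at p)
        + ∑ a, (conn D p v Z (S.epsBar e a) * conn D p w W (S.eps e a)
          + conn D p v Z (S.eps e a) * conn D p w W (S.epsBar e a)) := by
  have key : ∀ x y : TangentSpace 𝓘(ℝ, E) p, ((inner ℝ x y : ℝ) : ℂ)
      = ((inner ℝ x (S.ξ p) : ℝ) : ℂ) * ((inner ℝ y (S.ξ p) : ℝ) : ℂ)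
        + ∑ a, (cext (fun u ↦ ((inner ℝ x u : ℝ) : ℂ)) ((S.epsBar e a).at p)
          * cext (fun u ↦ ((inner ℝ y u : ℝ) : ℂ)) ((S.eps e a).at p)
        + cext (fun u ↦ ((inner ℝ x u : ℝ) : ℂ)) ((S.eps e a).at p)
          * cext (fun u ↦ ((inner ℝ y u : ℝ) : ℂ)) ((S.epsBar e a).at p)) := by
    intro x y
    simp only [cext_inner_right (x := y)]
    rw [← innerForm_apply, he.cext_expand hE, innerForm_apply (S.ξ p), real_inner_comm y (S.ξ p)]
  unfold covProd
  simp only [fun X Y : VField E M ↦ key (D X p v) (D Y p w), cext_add, cext_sum, cext_mul_left,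
    cext_mul_right, cext_inner_cov_ξ hD hS hs hZ, cext_inner_cov_ξ hD hS ht hW]
  rw [neg_mul_neg]
  rfl

/-- Expansion of `g(∇_x Z, W)` in the direction `x`. -/
lemma conn_expand (hE : Module.finrank ℝ E = 2 * n + 1) (he : S.IsAFrameAt p (fun a ↦ e a p))
    (x : TangentSpace 𝓘(ℝ, E) p) (Z W : Cplx (VField E M)) :
    conn D p x Z W = ((inner ℝ x (S.ξ p) : ℝ) : ℂ) * conn D p (S.ξ p) Z W
      + ∑ a, (cext (fun y ↦ ((inner ℝ x y : ℝ) : ℂ)) ((S.epsBar e a).at p)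
          * conn₃ D p (S.eps e a) Z W
        + cext (fun y ↦ ((inner ℝ x y : ℝ) : ℂ)) ((S.eps e a).at p)
          * conn₃ D p (S.epsBar e a) Z W) :=
  he.cext_expand hE (connForm' D p Z W) x

end AlmostContactMetric

end ComplexConnection

/-! ### Curvature through connection coefficients; vanishing of the pure coefficients. -/

section StructureEquations

variable {E : Type*} [NormedAddCommGroup E] [NormedSpace ℝ E] [FiniteDimensional ℝ E]
  {M : Type*} [TopologicalSpace M] [ChartedSpace E M] [IsManifold 𝓘(ℝ, E) ∞ M]
  [RiemannianBundle (fun p : M ↦ TangentSpace 𝓘(ℝ, E) p)]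
  [IsContMDiffRiemannianBundle 𝓘(ℝ, E) ∞ E (fun p : M ↦ TangentSpace 𝓘(ℝ, E) p)]
  {D : CovariantDerivative 𝓘(ℝ, E) E (fun p : M ↦ TangentSpace 𝓘(ℝ, E) p)}
  {S : AlmostContactMetric E M} {n : ℕ} {e : Fin n → VField E M} {p : M}

variable (D) in
/-- The complex quadrilinear extension of `g(R(x, y)z, w)`. -/
def ccurv (p : M) (x y z w : Cplx (TangentSpace 𝓘(ℝ, E) p)) : ℂ :=
  cext (fun x ↦ cext (fun y ↦ ccurv₂ D p x y z w) y) x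

namespace AlmostContactMetric

lemma cext_covProd (hD : IsRiemannianConnection D) (hS : S.IsKenmotsuType D)
    (hE : Module.finrank ℝ E = 2 * n + 1) (he : S.IsAFrameAt p (fun a ↦ e a p))
    {s t : ℝ} (hs : s ≠ 0) (ht : t ≠ 0) {X Y Z W : Cplx (VField E M)}
    (hZ : S.IsTypeNear s Z p) (hW : S.IsTypeNear t W p) :
    cext (fun x ↦ cext (fun y ↦ covProd D p (y p) (x p) Z W) Y) X
      = cinner (Z.at p) (Y.at p) * cinner (W.at p) (X.at p)
        + ∑ a, (conn₃ D p Y Z (S.epsBar e a) * conn₃ D p X W (S.eps e a)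
          + conn₃ D p Y Z (S.eps e a) * conn₃ D p X W (S.epsBar e a)) := by
  simp only [covProd_expand hD hS hE he hs ht hZ hW, cext_add, cext_sum, cext_mul_left,
    cext_mul_right]
  rw [cinner_comm (Z.at p), cinner_comm (W.at p)]
  unfold cinner
  simp only [fun x : TangentSpace 𝓘(ℝ, E) p ↦ cext_inner_right x (Z.at p),
    fun x : TangentSpace 𝓘(ℝ, E) p ↦ cext_inner_right x (W.at p)]
  rfl

lemma cext_conn_cov (hD : IsRiemannianConnection D) (hS : S.IsKenmotsuType D)
    (hE : Module.finrank ℝ E = 2 * n + 1) (he : S.IsAFrameAt p (fun a ↦ e a p))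
    {s : ℝ} (hs : s ≠ 0) {X Y : Cplx (VField E M)} (Z W : Cplx (VField E M))
    (hY : S.IsTypeNear s Y p) :
    cext (fun x ↦ cext (fun y ↦ conn D p (D y p (x p)) Z W) Y) X
      = -cinner (Y.at p) (X.at p) * conn D p (S.ξ p) Z W
        + ∑ a, (conn₃ D p X Y (S.epsBar e a) * conn₃ D p (S.eps e a) Z W
          + conn₃ D p X Y (S.eps e a) * conn₃ D p (S.epsBar e a) Z W) := by
  simp only [fun x y : VField E M ↦ conn_expand (D := D) (S := S) hE he (D y p (x p)) Z W,
    cext_add, cext_sum, cext_mul_right, cext_inner_cov_ξ hD hS hs hY, cext_neg]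
  rw [cinner_comm (Y.at p)]
  unfold cinner
  simp only [fun x : TangentSpace 𝓘(ℝ, E) p ↦ cext_inner_right x (Y.at p)]
  rfl

/-- The curvature in terms of the connection coefficients in an A-frame. -/
lemma ccurv_eq (hD : IsSmoothRiemannianConnection D) (hS : S.IsKenmotsuType D)
    (hE : Module.finrank ℝ E = 2 * n + 1) (he : S.IsAFrameAt p (fun a ↦ e a p))
    {r r' s t : ℝ} (hr : r ≠ 0) (hr' : r' ≠ 0) (hs : s ≠ 0) (ht : t ≠ 0)
    {X Y Z W : Cplx (VField E M)} (hX : S.IsTypeNear r X p) (hY : S.IsTypeNear r' Y p)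
    (hZ : S.IsTypeNear s Z p) (hW : S.IsTypeNear t W p) :
    ccurv D p (X.at p) (Y.at p) (Z.at p) (W.at p)
      = cext (fun v ↦ mvfderiv 𝓘(ℝ, E) (fun q ↦ conn₃ D q Y Z W) p v) (X.at p)
        - (cinner (Z.at p) (Y.at p) * cinner (W.at p) (X.at p)
          + ∑ a, (conn₃ D p Y Z (S.epsBar e a) * conn₃ D p X W (S.eps e a)
            + conn₃ D p Y Z (S.eps e a) * conn₃ D p X W (S.epsBar e a)))
        - (cext (fun v ↦ mvfderiv 𝓘(ℝ, E) (fun q ↦ conn₃ D q X Z W) p v) (Y.at p)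
          - (cinner (Z.at p) (X.at p) * cinner (W.at p) (Y.at p)
            + ∑ a, (conn₃ D p X Z (S.epsBar e a) * conn₃ D p Y W (S.eps e a)
              + conn₃ D p X Z (S.eps e a) * conn₃ D p Y W (S.epsBar e a))))
        - (∑ a, (conn₃ D p X Y (S.epsBar e a) * conn₃ D p (S.eps e a) Z W
            + conn₃ D p X Y (S.eps e a) * conn₃ D p (S.epsBar e a) Z W)
          - ∑ a, (conn₃ D p Y X (S.epsBar e a) * conn₃ D p (S.eps e a) Z W
            + conn₃ D p Y X (S.eps e a) * conn₃ D p (S.epsBar e a) Z W)) := by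
  have hD' := hD.toIsRiemannianConnection
  have key : ∀ {x y : VField E M}, SmoothNear x p → SmoothNear y p →
      ccurv₂ D p (x p) (y p) (Z.at p) (W.at p)
        = mvfderiv 𝓘(ℝ, E) (fun q ↦ conn D q (y q) Z W) p (x p)
          - covProd D p (y p) (x p) Z W
          - (mvfderiv 𝓘(ℝ, E) (fun q ↦ conn D q (x q) Z W) p (y p)
            - covProd D p (x p) (y p) Z W)
          - (conn D p (D y p (x p)) Z W - conn D p (D x p (y p)) Z W) := by
    intro x y hx hy
    rw [ccurv₂_eq hD hx hy hZ.toCSmoothNear hW.toCSmoothNear, ← hD.bracket hx hy]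
    simp only [← connForm'_apply, map_sub]
  have h1 : ccurv D p (X.at p) (Y.at p) (Z.at p) (W.at p)
      = cext (fun x : VField E M ↦ cext (fun y : VField E M ↦
        mvfderiv 𝓘(ℝ, E) (fun q ↦ conn D q (y q) Z W) p (x p)
          - covProd D p (y p) (x p) Z W
          - (mvfderiv 𝓘(ℝ, E) (fun q ↦ conn D q (x q) Z W) p (y p)
            - covProd D p (x p) (y p) Z W)
          - (conn D p (D y p (x p)) Z W - conn D p (D x p (y p)) Z W)) Y) X := by
    have h0 : ccurv D p (X.at p) (Y.at p) (Z.at p) (W.at p)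
        = cext (fun x : VField E M ↦ cext (fun y : VField E M ↦
          ccurv₂ D p (x p) (y p) (Z.at p) (W.at p)) Y) X := rfl
    rw [h0]
    exact cext_congr (cext_congr (key hX.re hY.re) (key hX.re hY.im))
      (cext_congr (key hX.im hY.re) (key hX.im hY.im))
  have h2 : ∀ {X Y : Cplx (VField E M)}, CSmoothNear Y p →
      cext (fun x : VField E M ↦ cext (fun y : VField E M ↦
        mvfderiv 𝓘(ℝ, E) (fun q ↦ conn D q (y q) Z W) p (x p)) Y) X
      = cext (fun v ↦ mvfderiv 𝓘(ℝ, E) (fun q ↦ conn₃ D q Y Z W) p v) (X.at p) := by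
    intro X Y hY
    have h3 : ∀ v, mvfderiv 𝓘(ℝ, E) (fun q ↦ conn₃ D q Y Z W) p v = cext (fun y : VField E M ↦
        mvfderiv 𝓘(ℝ, E) (fun q ↦ conn D q (y q) Z W) p v) Y := fun v ↦
      mvfderiv_cext (f := fun (y : VField E M) q ↦ conn D q (y q) Z W)
        (mdifferentiableAt_conn hD hY.re hZ.toCSmoothNear hW.toCSmoothNear)
        (mdifferentiableAt_conn hD hY.im hZ.toCSmoothNear hW.toCSmoothNear) v
    simp only [h3]
    rfl
  rw [h1]
  simp only [cext_sub]
  -- The ξ-components of ∇_X Y and ∇_Y X are both -g(X, Y), so they cancel and no derivative in the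
  -- direction ξ remains.
  rw [h2 hY.toCSmoothNear, cext_covProd hD' hS hE he hs ht hZ hW,
    cext_comm (fun x y : VField E M ↦ mvfderiv 𝓘(ℝ, E) (fun q ↦ conn D q (x q) Z W) p (y p)),
    h2 hX.toCSmoothNear, cext_comm (fun x y : VField E M ↦ covProd D p (x p) (y p) Z W),
    cext_covProd hD' hS hE he hs ht hZ hW, cext_conn_cov hD' hS hE he hr' Z W hY,
    cext_comm (fun x y : VField E M ↦ conn D p (D x p (y p)) Z W),
    cext_conn_cov hD' hS hE he hr Z W hX, cinner_comm (Y.at p) (X.at p)]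
  ring

variable (S D) in
/-- The complex trilinear extension of `g((∇_x Φ)y, z)`. -/
def cEndo (p : M) (x y z : Cplx (TangentSpace 𝓘(ℝ, E) p)) : ℂ :=
  cext (fun x ↦ cext (fun y ↦ cext (fun z ↦
    ((inner ℝ (covDerivEndo D S.Φ p x y) z : ℝ) : ℂ)) z) y) x

variable (S D) in
/-- `g((∇_x Φ)y, z)`, complexified in `z`, as a linear form in `y`. -/
def endoForm (x : TangentSpace 𝓘(ℝ, E) p) (z : Cplx (TangentSpace 𝓘(ℝ, E) p)) :
    TangentSpace 𝓘(ℝ, E) p →ₗ[ℝ] ℂ where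
  toFun y := cext (fun z ↦ ((inner ℝ (covDerivEndo D S.Φ p x y) z : ℝ) : ℂ)) z
  map_add' y y' := by
    simp only [covDerivEndo_add_right, inner_add_left, Complex.ofReal_add, cext_add]
  map_smul' c y := by
    simp only [covDerivEndo_smul_right, inner_smul_left, Complex.ofReal_mul, cext_mul_left,
      Complex.real_smul, RingHom.id_apply, conj_trivial]

variable (S D) in
/-- `g((∇_x Φ)y, z)`, complexified in `y` and `z`, as a linear form in `x`. -/
def endoForm₂ (y z : Cplx (TangentSpace 𝓘(ℝ, E) p)) :
    TangentSpace 𝓘(ℝ, E) p →ₗ[ℝ] ℂ where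
  toFun x := cext (endoForm D S x z) y
  map_add' x x' := by
    simp only [cext, endoForm, LinearMap.coe_mk, AddHom.coe_mk, covDerivEndo_add_left,
      inner_add_left, Complex.ofReal_add]
    ring
  map_smul' c x := by
    simp only [cext, endoForm, LinearMap.coe_mk, AddHom.coe_mk, covDerivEndo_smul_left,
      inner_smul_left, Complex.ofReal_mul, Complex.real_smul, RingHom.id_apply, conj_trivial]
    ring

/-- On eigenvectors Φx = r√-1 x and Φy = s√-1 y the term (∇_{Φx}Φ)Φy is -rs(∇_x Φ)y, and η(y) = 0,
so the Kenmotsu identity reads (1 + rs)(∇_x Φ)y = 0. For types ±1 this kills equal types and says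
nothing about opposite ones. -/
lemma cEndo_eq_zero (hS : S.IsKenmotsuType D) {r s : ℝ} (hs : s ≠ 0) (hrs : 1 + r * s ≠ 0)
    {x y : Cplx (TangentSpace 𝓘(ℝ, E) p)} (z : Cplx (TangentSpace 𝓘(ℝ, E) p))
    (hx : S.IsTypeAt r x) (hy : S.IsTypeAt s y) : cEndo D S p x y z = 0 := by
  have h1 : cext (fun x ↦ cext (fun y ↦ endoForm D S x z y - endoForm D S (S.Φ p x) z (S.Φ p y))
      y) x = 0 := by
    have h2 : ∀ u v : TangentSpace 𝓘(ℝ, E) p, (inner ℝ v (S.ξ p) : ℝ) = 0 →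
        endoForm D S u z v - endoForm D S (S.Φ p u) z (S.Φ p v) = 0 := by
      intro u v hv
      have h3 := hS p u v
      rw [η, hv, zero_smul, neg_zero, sub_eq_zero] at h3
      simp only [endoForm, LinearMap.coe_mk, AddHom.coe_mk, h3, sub_self]
    simp only [cext, h2 _ _ (hy.re_inner_ξ hs), h2 _ _ (hy.im_inner_ξ hs)]
    simp
  simp only [cext_sub, hy.cext_Φ, cext_mul_left] at h1
  have h4 : cext (fun x ↦ cext (endoForm D S (S.Φ p x) z) y) x
      = Complex.I * r * cext (fun x ↦ cext (endoForm D S x z) y) x :=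
    hx.cext_Φ (endoForm₂ D S y z)
  rw [h4] at h1
  have h5 : ((1 + r * s : ℝ) : ℂ) * cEndo D S p x y z = 0 := by
    have h6 : cEndo D S p x y z = cext (fun x ↦ cext (endoForm D S x z) y) x := rfl
    rw [h6]
    push_cast
    linear_combination h1
      + ((r : ℂ) * s * cext (fun x ↦ cext (endoForm D S x z) y) x) * Complex.I_sq
  rcases mul_eq_zero.1 h5 with h | h
  · exact absurd (Complex.ofReal_eq_zero.1 h) hrs
  · exact h

/-- From ΦZ = s√-1 Z one has (∇_X Φ)Z = s√-1 ∇_X Z - Φ∇_X Z. Skewness of Φ moves it onto W, where it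
acts as t√-1 with the sign reversed. -/
lemma cEndo_eq_conn₃ {s t : ℝ} {X Z W : Cplx (VField E M)} (hZ : S.IsTypeNear s Z p)
    (hW : S.IsTypeNear t W p) :
    cEndo D S p (X.at p) (Z.at p) (W.at p) = Complex.I * (s + t) * conn₃ D p X Z W := by
  have h1 : ∀ v, D (fun q ↦ S.Φ q (Z.re q)) p v = -(s • D Z.im p v) := by
    intro v
    have h0 : ∀ᶠ q in 𝓝 p, S.Φ q (Z.re q) = (-((fun _ : M ↦ s) • Z.im) : VField E M) q :=
      hZ.eig.mono fun q hq ↦ hq.re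
    rw [cov_congr (S.smoothNear_Φ hZ.re) h0,
      cov_neg (SmoothNear.smul (SmoothFnNear.const s) hZ.im),
      cov_smul (SmoothFnNear.const s) hZ.im, mvfderiv_const]
    simp
  have h2 : ∀ v, D (fun q ↦ S.Φ q (Z.im q)) p v = s • D Z.re p v := by
    intro v
    have h0 : ∀ᶠ q in 𝓝 p, S.Φ q (Z.im q) = ((fun _ : M ↦ s) • Z.re : VField E M) q :=
      hZ.eig.mono fun q hq ↦ hq.im
    rw [cov_congr (S.smoothNear_Φ hZ.im) h0,
      cov_smul (SmoothFnNear.const s) hZ.re, mvfderiv_const]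
    simp
  have h3 : S.Φ p (W.re p) = -(t • W.im p) := hW.at.re
  have h4 : S.Φ p (W.im p) = t • W.re p := hW.at.im
  have key : ∀ v, cext (fun y ↦ cext (fun z ↦
      ((inner ℝ (covDerivEndo D S.Φ p v y) z : ℝ) : ℂ)) (W.at p)) (Z.at p)
      = Complex.I * (s + t) * conn D p v Z W := by
    intro v
    simp only [cext, conn, Cplx.at, covDerivEndo_eq hZ.re, covDerivEndo_eq hZ.im, h1, h2,
      inner_sub_left, S.inner_Φ_left, h3, h4, inner_neg_left, inner_neg_right, inner_smul_left,
      inner_smul_right, Complex.ofReal_sub, Complex.ofReal_neg, Complex.ofReal_mul, conj_trivial]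
    set a : ℂ := ((inner ℝ (D Z.re p v) (W.re p) : ℝ) : ℂ)
    set b : ℂ := ((inner ℝ (D Z.re p v) (W.im p) : ℝ) : ℂ)
    set c : ℂ := ((inner ℝ (D Z.im p v) (W.re p) : ℝ) : ℂ)
    set d : ℂ := ((inner ℝ (D Z.im p v) (W.im p) : ℝ) : ℂ)
    linear_combination (-(t : ℂ) * b - s * c - (s + t) * Complex.I * d) * Complex.I_sq
  unfold cEndo conn₃
  simp only [key, cext_mul_left]
  rfl

/-- For three vectors of one type the factor s + s in `cEndo_eq_conn₃` is nonzero while ∇Φ vanishes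
by `cEndo_eq_zero`. -/
lemma conn₃_eq_zero (hS : S.IsKenmotsuType D) {s : ℝ} (hs : s ≠ 0)
    {X Z W : Cplx (VField E M)} (hX : S.IsTypeAt s (X.at p)) (hZ : S.IsTypeNear s Z p)
    (hW : S.IsTypeNear s W p) : conn₃ D p X Z W = 0 := by
  have h1 := cEndo_eq_zero hS hs (by nlinarith [mul_self_nonneg s]) (W.at p) hX hZ.at
  rw [cEndo_eq_conn₃ hZ hW] at h1
  have h2 : (Complex.I * (s + s) : ℂ) ≠ 0 :=
    mul_ne_zero Complex.I_ne_zero (by rw [← two_mul]; simpa using hs)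
  exact (mul_eq_zero.1 h1).resolve_left h2

lemma IsAFrameNear.Bup_eq (he : S.IsAFrameNear p e) (a b c : Fin n) :
    S.Bup D e a b c p = -conn₃ D p (S.eps e c) (S.epsBar e b) (S.epsBar e a) := by
  have h : S.Bup D e a b c p = -(Complex.I / 2) * cEndo D S p ((S.eps e c).at p)
      ((S.epsBar e b).at p) ((S.epsBar e a).at p) := rfl
  rw [h, cEndo_eq_conn₃ (he.epsBar_isType b) (he.epsBar_isType a)]
  push_cast
  linear_combination conn₃ D p (S.eps e c) (S.epsBar e b) (S.epsBar e a) * Complex.I_sq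

lemma IsAFrameNear.Bdown_eq (he : S.IsAFrameNear p e) (a b c : Fin n) :
    S.Bdown D e a b c p = -conn₃ D p (S.epsBar e c) (S.eps e b) (S.eps e a) := by
  have h : S.Bdown D e a b c p = (Complex.I / 2) * cEndo D S p ((S.epsBar e c).at p)
      ((S.eps e b).at p) ((S.eps e a).at p) := rfl
  rw [h, cEndo_eq_conn₃ (he.eps_isType b) (he.eps_isType a)]
  push_cast
  linear_combination conn₃ D p (S.epsBar e c) (S.eps e b) (S.eps e a) * Complex.I_sq

lemma conn₃_swap (hD : IsRiemannianConnection D) (X : Cplx (VField E M))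
    {Z W : Cplx (VField E M)}
    (hZ : CSmoothNear Z p) (hW : CSmoothNear W p) {c : ℂ}
    (h : ∀ᶠ q in 𝓝 p, cinner (Z.at q) (W.at q) = c) :
    conn₃ D p X Z W = -conn₃ D p X W Z := by
  have h1 : ∀ v, conn D p v Z W = -conn D p v W Z := fun v ↦
    eq_neg_of_add_eq_zero_left (conn_add_swap hD hZ hW h v)
  unfold conn₃
  simp only [h1, cext_neg]

lemma IsAFrameNear.conn₃_eps_eps (hD : IsRiemannianConnection D) (he : S.IsAFrameNear p e)
    (X : Cplx (VField E M)) (a b : Fin n) :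
    conn₃ D p X (S.eps e a) (S.eps e b) = -conn₃ D p X (S.eps e b) (S.eps e a) :=
  conn₃_swap hD X (he.eps_isType a).toCSmoothNear (he.eps_isType b).toCSmoothNear
    (he.frame.mono fun _ hq ↦ hq.cinner_eps_eps a b)

lemma IsAFrameNear.conn₃_epsBar_epsBar (hD : IsRiemannianConnection D) (he : S.IsAFrameNear p e)
    (X : Cplx (VField E M)) (a b : Fin n) :
    conn₃ D p X (S.epsBar e a) (S.epsBar e b) = -conn₃ D p X (S.epsBar e b) (S.epsBar e a) :=
  conn₃_swap hD X (he.epsBar_isType a).toCSmoothNear (he.epsBar_isType b).toCSmoothNear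
    (he.frame.mono fun _ hq ↦ hq.cinner_epsBar_epsBar a b)

lemma IsAFrameNear.conn₃_epsBar_eps (hD : IsRiemannianConnection D) (he : S.IsAFrameNear p e)
    (X : Cplx (VField E M)) (a b : Fin n) :
    conn₃ D p X (S.epsBar e a) (S.eps e b) = -conn₃ D p X (S.eps e b) (S.epsBar e a) :=
  conn₃_swap hD X (he.epsBar_isType a).toCSmoothNear (he.eps_isType b).toCSmoothNear
    (he.frame.mono fun _ hq ↦ hq.cinner_epsBar_eps a b)

end AlmostContactMetric

end StructureEquations

/-! ### The structure functions A and B in terms of the curvature. -/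

section StructureFunctions

variable {E : Type*} [NormedAddCommGroup E] [NormedSpace ℝ E] [FiniteDimensional ℝ E]
  {M : Type*} [TopologicalSpace M] [ChartedSpace E M] [IsManifold 𝓘(ℝ, E) ∞ M]
  [RiemannianBundle (fun p : M ↦ TangentSpace 𝓘(ℝ, E) p)]
  [IsContMDiffRiemannianBundle 𝓘(ℝ, E) ∞ E (fun p : M ↦ TangentSpace 𝓘(ℝ, E) p)]
  {D : CovariantDerivative 𝓘(ℝ, E) E (fun p : M ↦ TangentSpace 𝓘(ℝ, E) p)}
  {S : AlmostContactMetric E M} {n : ℕ} {e : Fin n → VField E M} {p : M}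

namespace AlmostContactMetric

/-- The second structure equations: `dω^a_b + ω^a_h ∧ ω^h_b` in terms of the curvature. -/
lemma IsAFrameNear.curvFormC_eq (hD : IsSmoothRiemannianConnection D) (hS : S.IsKenmotsuType D)
    (hE : Module.finrank ℝ E = 2 * n + 1) (he : S.IsAFrameNear p e) (a b : Fin n)
    {X Y : Cplx (VField E M)} (hX : CSmoothNear X p) (hY : CSmoothNear Y p) :
    S.curvFormC D e a b p X Y
      = ccurv D p (X.at p) (Y.at p) ((S.eps e b).at p) ((S.epsBar e a).at p)
        + (cinner ((S.eps e b).at p) (Y.at p) * cinner ((S.epsBar e a).at p) (X.at p)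
          - cinner ((S.eps e b).at p) (X.at p) * cinner ((S.epsBar e a).at p) (Y.at p))
        + ∑ h, (conn₃ D p Y (S.eps e b) (S.eps e h) * conn₃ D p X (S.epsBar e a) (S.epsBar e h)
          - conn₃ D p X (S.eps e b) (S.eps e h)
            * conn₃ D p Y (S.epsBar e a) (S.epsBar e h)) := by
  have hD' := hD.toIsRiemannianConnection
  have hb := he.eps_isType b
  have ha := he.epsBar_isType a
  set Z := S.eps e b with hZ
  set W := S.epsBar e a with hW
  have key : ∀ {x y : VField E M}, SmoothNear x p → SmoothNear y p →
      S.curvForm D e a b p x y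
        = ccurv₂ D p (x p) (y p) (Z.at p) (W.at p) + covProd D p (y p) (x p) Z W
          - covProd D p (x p) (y p) Z W
          + ∑ h, (conn D p (x p) (S.eps e h) W * conn D p (y p) Z (S.epsBar e h)
            - conn D p (y p) (S.eps e h) W * conn D p (x p) Z (S.epsBar e h)) := by
    intro x y hx hy
    rw [ccurv₂_eq hD hx hy hb.toCSmoothNear ha.toCSmoothNear]
    change mvfderiv 𝓘(ℝ, E) (fun q ↦ conn D q (y q) Z W) p (x p)
      - mvfderiv 𝓘(ℝ, E) (fun q ↦ conn D q (x q) Z W) p (y p)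
      - conn D p (VectorField.mlieBracket 𝓘(ℝ, E) x y p) Z W
      + ∑ h, (conn D p (x p) (S.eps e h) W * conn D p (y p) Z (S.epsBar e h)
            - conn D p (y p) (S.eps e h) W * conn D p (x p) Z (S.epsBar e h)) = _
    ring
  have h1 : S.curvFormC D e a b p X Y = cext (fun x : VField E M ↦ cext (fun y : VField E M ↦
      ccurv₂ D p (x p) (y p) (Z.at p) (W.at p) + covProd D p (y p) (x p) Z W
          - covProd D p (x p) (y p) Z W
          + ∑ h, (conn D p (x p) (S.eps e h) W * conn D p (y p) Z (S.epsBar e h)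
            - conn D p (y p) (S.eps e h) W * conn D p (x p) Z (S.epsBar e h))) Y) X :=
    cext_congr (cext_congr (key hX.re hY.re) (key hX.re hY.im))
      (cext_congr (key hX.im hY.re) (key hX.im hY.im))
  rw [h1]
  simp only [cext_add, cext_sub, cext_sum, cext_mul_left, cext_mul_right]
  -- Of the expansion of g(∇Z, ∇W), the products of coefficients ω^a_h and ω^h_b cancel against the
  -- wedge terms. The ξ-part survives as products of g, the rest as products of coefficients of
  -- Kirichenko type.
  rw [cext_covProd hD' hS hE he.at one_ne_zero (neg_ne_zero.2 one_ne_zero) hb ha,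
    cext_comm (fun x y : VField E M ↦ covProd D p (x p) (y p) Z W),
    cext_covProd hD' hS hE he.at one_ne_zero (neg_ne_zero.2 one_ne_zero) hb ha]
  have h2 : cext (fun x : VField E M ↦ cext (fun y : VField E M ↦
      ccurv₂ D p (x p) (y p) (Z.at p) (W.at p)) Y) X
      = ccurv D p (X.at p) (Y.at p) (Z.at p) (W.at p) := rfl
  have h3 : ∀ (X : Cplx (VField E M)) (h : Fin n),
      cext (fun x : VField E M ↦ conn D p (x p) (S.eps e h) W) X
        = -conn₃ D p X W (S.eps e h) := fun X h ↦ by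
    rw [hW, he.conn₃_epsBar_eps hD', neg_neg]; rfl
  have h4 : ∀ (X : Cplx (VField E M)) (h : Fin n),
      cext (fun x : VField E M ↦ conn D p (x p) Z (S.epsBar e h)) X
        = conn₃ D p X Z (S.epsBar e h) := fun X h ↦ rfl
  simp only [h2, h3, h4, Finset.sum_add_distrib, Finset.sum_sub_distrib, neg_mul,
    Finset.sum_neg_distrib, mul_comm (conn₃ D p _ W (S.eps e _))]
  ring

/-- The ξ-part of the frame expansion contributes the deltas, and its off-diagonal part contributes
the sum of products of B. The other half of that sum contains a coefficient with three vectors ε and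
vanishes. -/
lemma IsAFrameNear.A₂₂_eq (hD : IsSmoothRiemannianConnection D) (hS : S.IsKenmotsuType D)
    (hE : Module.finrank ℝ E = 2 * n + 1) (he : S.IsAFrameNear p e) (a b c d : Fin n) :
    S.A₂₂ D e a d b c p
      = ccurv D p ((S.eps e c).at p) ((S.epsBar e d).at p) ((S.eps e b).at p)
          ((S.epsBar e a).at p)
        + delta a c * delta d b + ∑ h, S.Bup D e a h c p * S.Bdown D e b h d p := by
  have hD' := hD.toIsRiemannianConnection
  unfold A₂₂
  rw [he.curvFormC_eq hD hS hE a b (he.eps_isType c).toCSmoothNear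
    (he.epsBar_isType d).toCSmoothNear]
  simp only [he.at.cinner_eps_epsBar, he.at.cinner_epsBar_eps, he.at.cinner_eps_eps,
    he.Bup_eq, he.Bdown_eq,
    fun h ↦ conn₃_eq_zero hS one_ne_zero (he.eps_isType c).at (he.eps_isType b)
      (he.eps_isType h), fun h ↦ he.conn₃_epsBar_epsBar hD' (S.eps e c) h a,
    fun h ↦ he.conn₃_eps_eps hD' (S.epsBar e d) h b, neg_neg, zero_mul, sub_zero,
    delta_comm b d]
  simp only [mul_comm]

lemma IsAFrameNear.A₁₃_eq (hD : IsSmoothRiemannianConnection D) (hS : S.IsKenmotsuType D)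
    (hE : Module.finrank ℝ E = 2 * n + 1) (he : S.IsAFrameNear p e) (a b c d : Fin n) :
    S.A₁₃ D e a b c d p
      = 1 / 2 * ccurv D p ((S.eps e c).at p) ((S.eps e d).at p) ((S.eps e b).at p)
          ((S.epsBar e a).at p) := by
  unfold A₁₃
  rw [he.curvFormC_eq hD hS hE a b (he.eps_isType c).toCSmoothNear
    (he.eps_isType d).toCSmoothNear]
  simp only [he.at.cinner_eps_eps,
    fun c h ↦ conn₃_eq_zero hS one_ne_zero (he.eps_isType c).at (he.eps_isType b)
      (he.eps_isType h), zero_mul, sub_zero, Finset.sum_const_zero, add_zero]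

/-- The curvature has no component on four vectors of the same type. -/
lemma IsAFrameNear.ccurv_eps (hD : IsSmoothRiemannianConnection D) (hS : S.IsKenmotsuType D)
    (hE : Module.finrank ℝ E = 2 * n + 1) (he : S.IsAFrameNear p e) (a b c d : Fin n) :
    ccurv D p ((S.eps e a).at p) ((S.eps e b).at p) ((S.eps e c).at p) ((S.eps e d).at p)
      = 0 := by
  -- The pure coefficients vanish near p, hence so do their derivatives at p. Every quadratic term
  -- of `ccurv_eq` also has a pure coefficient as a factor.
  have h0 : ∀ x y, ∀ᶠ q in 𝓝 p, conn₃ D q (S.eps e x) (S.eps e c) (S.eps e y) = 0 := by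
    intro x y
    filter_upwards [he.eventually] with q hq
    exact conn₃_eq_zero hS one_ne_zero (hq.eps_isType x).at (hq.eps_isType c) (hq.eps_isType y)
  rw [ccurv_eq hD hS hE he.at one_ne_zero one_ne_zero one_ne_zero one_ne_zero
    (he.eps_isType a) (he.eps_isType b) (he.eps_isType c) (he.eps_isType d),
    mvfderiv_congr (h0 b d), mvfderiv_congr (h0 a d), mvfderiv_const]
  simp only [he.at.cinner_eps_eps,
    fun x y z ↦ conn₃_eq_zero hS one_ne_zero (he.eps_isType x).at (he.eps_isType y)
      (he.eps_isType z)]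
  simp [cext]

/-- As B^{ab}_c = -g(∇_{ε_c} ε_b̂, ε_â), antisymmetrising its covariant differential in c, d
reproduces the derivative terms of R(ε_c, ε_d) and its surviving quadratic terms. Only the ξ-part of
the expansion is not accounted for, and it gives the deltas. -/
lemma IsAFrameNear.B₂₂_sub (hD : IsSmoothRiemannianConnection D) (hS : S.IsKenmotsuType D)
    (hE : Module.finrank ℝ E = 2 * n + 1) (he : S.IsAFrameNear p e) (a b c d : Fin n) :
    S.B₂₂ D e a b c d p - S.B₂₂ D e a b d c p
      = ccurv D p ((S.eps e c).at p) ((S.eps e d).at p) ((S.epsBar e b).at p)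
          ((S.epsBar e a).at p)
        + (delta a c * delta b d - delta a d * delta b c) := by
  have hD' := hD.toIsRiemannianConnection
  have hm : (-1 : ℝ) ≠ 0 := neg_ne_zero.2 one_ne_zero
  have h0 : ∀ x, ∀ᶠ q in 𝓝 p,
      S.Bup D e a b x q = -conn₃ D q (S.eps e x) (S.epsBar e b) (S.epsBar e a) := by
    intro x
    filter_upwards [he.eventually] with q hq
    exact hq.Bup_eq a b x
  have h1 : ∀ x v, mvfderiv 𝓘(ℝ, E) (fun q ↦ S.Bup D e a b x q) p v
      = -mvfderiv 𝓘(ℝ, E) (fun q ↦ conn₃ D q (S.eps e x) (S.epsBar e b) (S.epsBar e a)) p v := by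
    intro x v
    rw [mvfderiv_congr (h0 x), mvfderiv_fun_neg]
    rfl
  have h2 : ∀ x y, S.B₂₂ D e a b x y p
      = -cext (fun v ↦ mvfderiv 𝓘(ℝ, E)
          (fun q ↦ conn₃ D q (S.eps e x) (S.epsBar e b) (S.epsBar e a)) p v) ((S.eps e y).at p)
        + ∑ h, (S.Bup D e h b x p * conn₃ D p (S.eps e y) (S.eps e h) (S.epsBar e a)
          + S.Bup D e a h x p * conn₃ D p (S.eps e y) (S.eps e h) (S.epsBar e b)
          - S.Bup D e a b h p * conn₃ D p (S.eps e y) (S.eps e x) (S.epsBar e h)) := by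
    intro x y
    unfold B₂₂
    simp only [h1, cext_add, cext_neg, cext_sum, cext_sub, cext_mul_left]
    rfl
  rw [ccurv_eq hD hS hE he.at one_ne_zero one_ne_zero hm hm
    (he.eps_isType c) (he.eps_isType d) (he.epsBar_isType b) (he.epsBar_isType a), h2, h2]
  simp only [he.at.cinner_epsBar_eps, he.Bup_eq,
    fun x y z ↦ conn₃_eq_zero hS one_ne_zero (he.eps_isType x).at (he.eps_isType y)
      (he.eps_isType z), fun x y z ↦ he.conn₃_epsBar_eps hD' (S.eps e x) y z,
    fun x h ↦ he.conn₃_epsBar_epsBar hD' (S.eps e x) h a, zero_mul, add_zero,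
    Finset.sum_add_distrib, Finset.sum_sub_distrib, neg_mul, mul_neg, neg_neg,
    Finset.sum_neg_distrib]
  simp only [mul_comm]
  ring

end AlmostContactMetric

end StructureFunctions

/-! ### Real forms with curvature symmetries and their complex extensions. -/

section CurvatureLike

variable {V : Type*}

/-- The complex quadrilinear extension of a real quadrilinear form. -/
def cext₄ (T : V → V → V → V → ℝ) (x y z w : Cplx V) : ℂ :=
  cext (fun x ↦ cext (fun y ↦ cext (fun z ↦ cext (fun w ↦ (T x y z w : ℂ)) w) z) y) x

/-- The conjugate of a complex vector. -/
def Cplx.conj [Neg V] (z : Cplx V) : Cplx V := ⟨z.re, -z.im⟩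

lemma Cplx.conj_conj [InvolutiveNeg V] (z : Cplx V) : z.conj.conj = z := by
  simp [Cplx.conj]

lemma isLinearMap_cext {W : Type*} [AddCommGroup W] [Module ℝ W] {f : V → W → ℂ}
    (h : ∀ x, IsLinearMap ℝ (f x)) (z : Cplx V) :
    IsLinearMap ℝ (fun y ↦ cext (fun x ↦ f x y) z) where
  map_add x y := by simp only [cext, (h _).map_add]; ring
  map_smul c x := by simp only [cext, (h _).map_smul, Complex.real_smul]; ring

variable [AddCommGroup V] [Module ℝ V]

/-- A quadrilinear form with the skew symmetry and the pair symmetry of a curvature tensor. -/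
structure IsCurvatureLike (T : V → V → V → V → ℝ) : Prop where
  add : ∀ x x' y z w, T (x + x') y z w = T x y z w + T x' y z w
  smul : ∀ (c : ℝ) x y z w, T (c • x) y z w = c * T x y z w
  skew : ∀ x y z w, T x y z w = -T y x z w
  pair : ∀ x y z w, T x y z w = T z w x y

namespace IsCurvatureLike

variable {T T' : V → V → V → V → ℝ}

lemma sub (h : IsCurvatureLike T) (h' : IsCurvatureLike T') :
    IsCurvatureLike (fun x y z w ↦ T x y z w - T' x y z w) where
  add x x' y z w := by simp only [h.add, h'.add]; ring
  smul c x y z w := by simp only [h.smul, h'.smul]; ring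
  skew x y z w := by rw [h.skew, h'.skew]; ring
  pair x y z w := by rw [h.pair, h'.pair]

variable (h : IsCurvatureLike T)
include h

lemma isLinearMap₁ (y z w : V) : IsLinearMap ℝ (fun x ↦ (T x y z w : ℂ)) where
  map_add x x' := by simp [h.add]
  map_smul c x := by simp [h.smul]

lemma isLinearMap₂ (x z w : V) : IsLinearMap ℝ (fun y ↦ (T x y z w : ℂ)) where
  map_add y y' := by
    simp only [h.skew x, h.add, Complex.ofReal_neg, Complex.ofReal_add]; ring
  map_smul c y := by
    simp only [h.skew x, h.smul, Complex.ofReal_neg, Complex.ofReal_mul, Complex.real_smul]; ring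

lemma isLinearMap₃ (x y w : V) : IsLinearMap ℝ (fun z ↦ (T x y z w : ℂ)) := by
  simp only [h.pair x y]
  exact h.isLinearMap₁ w x y

lemma isLinearMap₄ (x y z : V) : IsLinearMap ℝ (fun w ↦ (T x y z w : ℂ)) := by
  simp only [h.pair x y]
  exact h.isLinearMap₂ z x y

lemma neg₁ (x y z w : V) : T (-x) y z w = -T x y z w := by
  rw [← neg_one_smul ℝ x, h.smul]; ring

lemma neg₂ (x y z w : V) : T x (-y) z w = -T x y z w := by
  rw [h.skew, h.neg₁, h.skew x y]

lemma neg₃ (x y z w : V) : T x y (-z) w = -T x y z w := by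
  rw [h.pair, h.neg₁, h.pair z]

lemma neg₄ (x y z w : V) : T x y z (-w) = -T x y z w := by
  rw [h.pair, h.neg₂, h.pair z]

lemma cext₄_skew (x y z w : Cplx V) : cext₄ T x y z w = -cext₄ T y x z w := by
  have h1 : T = fun x y z w ↦ -T y x z w := by
    funext x y z w; exact h.skew x y z w
  conv_lhs => rw [h1]
  simp only [cext₄, cext, Complex.ofReal_neg]
  ring

lemma cext₄_pair (x y z w : Cplx V) : cext₄ T x y z w = cext₄ T z w x y := by
  have h1 : T = fun x y z w ↦ T z w x y := by
    funext x y z w; exact h.pair x y z w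
  conv_lhs => rw [h1]
  simp only [cext₄, cext]
  ring

lemma cext₄_skew' (x y z w : Cplx V) : cext₄ T x y z w = -cext₄ T x y w z := by
  rw [h.cext₄_pair, h.cext₄_skew, h.cext₄_pair w z]

/-- T takes real values, so conjugating all arguments conjugates the component; this halves the
types to be checked. -/
lemma cext₄_conj (x y z w : Cplx V) :
    cext₄ T x.conj y.conj z.conj w.conj = (starRingEnd ℂ) (cext₄ T x y z w) := by
  simp only [cext₄, cext, Cplx.conj, h.neg₁, h.neg₂, h.neg₃, h.neg₄, map_add, map_mul,
    Complex.conj_I, Complex.conj_ofReal, Complex.ofReal_neg]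
  ring

end IsCurvatureLike

end CurvatureLike

/-! ### Determination of a curvature-like form by its components in an A-frame. -/

section Characterization

variable {E : Type*} [NormedAddCommGroup E] [NormedSpace ℝ E] [FiniteDimensional ℝ E]
  {M : Type*} [TopologicalSpace M] [ChartedSpace E M] [IsManifold 𝓘(ℝ, E) ∞ M]
  [RiemannianBundle (fun p : M ↦ TangentSpace 𝓘(ℝ, E) p)]
  [IsContMDiffRiemannianBundle 𝓘(ℝ, E) ∞ E (fun p : M ↦ TangentSpace 𝓘(ℝ, E) p)]
  {D : CovariantDerivative 𝓘(ℝ, E) E (fun p : M ↦ TangentSpace 𝓘(ℝ, E) p)}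
  {S : AlmostContactMetric E M} {n : ℕ} {e : Fin n → VField E M} {p : M}

namespace AlmostContactMetric

lemma epsBar_at (a : Fin n) : (S.epsBar e a).at p = ((S.eps e a).at p).conj := by
  simp [epsBar, eps, Cplx.at, Cplx.conj]

lemma eps_at (a : Fin n) : (S.eps e a).at p = ((S.epsBar e a).at p).conj := by
  rw [epsBar_at, Cplx.conj_conj]

lemma IsAFrameAt.eq_zero_of_cext (he : S.IsAFrameAt p (fun a ↦ e a p))
    (hE : Module.finrank ℝ E = 2 * n + 1) {f : TangentSpace 𝓘(ℝ, E) p → ℂ}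
    (hf : IsLinearMap ℝ f) (h0 : f (S.ξ p) = 0)
    (h : ∀ a, cext f ((S.eps e a).at p) = 0 ∧ cext f ((S.epsBar e a).at p) = 0)
    (x : TangentSpace 𝓘(ℝ, E) p) : f x = 0 := by
  have h1 := he.cext_expand hE (hf.mk' f) x
  have h2 : ∀ z, cext (hf.mk' f) z = cext f z := fun _ ↦ rfl
  simp only [h2, IsLinearMap.mk'_apply, h0, h] at h1
  simpa using h1

variable (S) in
/-- The complex members of an A-frame. -/
def frameVec (e : Fin n → VField E M) (p : M) (i : Bool × Fin n) :
    Cplx (TangentSpace 𝓘(ℝ, E) p) :=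
  if i.1 then (S.eps e i.2).at p else (S.epsBar e i.2).at p

lemma IsAFrameAt.eq_zero_of_frameVec (he : S.IsAFrameAt p (fun a ↦ e a p))
    (hE : Module.finrank ℝ E = 2 * n + 1) {f : TangentSpace 𝓘(ℝ, E) p → ℂ}
    (hf : IsLinearMap ℝ f) (h0 : f (S.ξ p) = 0)
    (h : ∀ i, cext f (S.frameVec e p i) = 0)
    (x : TangentSpace 𝓘(ℝ, E) p) : f x = 0 :=
  he.eq_zero_of_cext hE hf h0 (fun a ↦ ⟨h (true, a), h (false, a)⟩) x

variable {T : TangentSpace 𝓘(ℝ, E) p → TangentSpace 𝓘(ℝ, E) p → TangentSpace 𝓘(ℝ, E) p →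
  TangentSpace 𝓘(ℝ, E) p → ℝ}

/-- The complex arguments are replaced by arbitrary real vectors one slot at a time. Vanishing on ξ,
assumed in one slot, passes to the others by the symmetries. -/
lemma IsAFrameAt.eq_zero_of_cext₄ (he : S.IsAFrameAt p (fun a ↦ e a p))
    (hE : Module.finrank ℝ E = 2 * n + 1) (hT : IsCurvatureLike T)
    (h0 : ∀ y z w, T (S.ξ p) y z w = 0)
    (h : ∀ i j k l, cext₄ T (S.frameVec e p i) (S.frameVec e p j) (S.frameVec e p k)
      (S.frameVec e p l) = 0) (x y z w : TangentSpace 𝓘(ℝ, E) p) : T x y z w = 0 := by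
  have h0₂ : ∀ x z w, T x (S.ξ p) z w = 0 := fun x z w ↦ by rw [hT.skew, h0, neg_zero]
  have h0₃ : ∀ x y w, T x y (S.ξ p) w = 0 := fun x y w ↦ by rw [hT.pair, h0]
  have h0₄ : ∀ x y z, T x y z (S.ξ p) = 0 := fun x y z ↦ by rw [hT.pair, h0₂]
  have step₁ : ∀ j k l x, cext (fun y ↦ cext (fun z ↦ cext (fun w ↦ (T x y z w : ℂ))
      (S.frameVec e p l)) (S.frameVec e p k)) (S.frameVec e p j) = 0 := fun j k l ↦
    he.eq_zero_of_frameVec hE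
      (isLinearMap_cext (fun y ↦ isLinearMap_cext (fun z ↦ isLinearMap_cext
        (fun w ↦ hT.isLinearMap₁ y z w) _) _) _)
      (by simp only [h0, Complex.ofReal_zero, cext_zero]) (fun i ↦ h i j k l)
  have step₂ : ∀ x k l y, cext (fun z ↦ cext (fun w ↦ (T x y z w : ℂ))
      (S.frameVec e p l)) (S.frameVec e p k) = 0 := fun x k l ↦
    he.eq_zero_of_frameVec hE
      (isLinearMap_cext (fun z ↦ isLinearMap_cext (fun w ↦ hT.isLinearMap₂ x z w) _) _)
      (by simp only [h0₂, Complex.ofReal_zero, cext_zero]) (fun j ↦ step₁ j k l x)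
  have step₃ : ∀ x y l z, cext (fun w ↦ (T x y z w : ℂ)) (S.frameVec e p l) = 0 := fun x y l ↦
    he.eq_zero_of_frameVec hE (isLinearMap_cext (fun w ↦ hT.isLinearMap₃ x y w) _)
      (by simp only [h0₃, Complex.ofReal_zero, cext_zero]) (fun k ↦ step₂ x k l y)
  exact Complex.ofReal_eq_zero.1 (he.eq_zero_of_frameVec hE (hT.isLinearMap₄ x y z)
    (by simp only [h0₄, Complex.ofReal_zero]) (fun l ↦ step₃ x y l z) w)

/-- By the symmetries, four types of components determine a curvature-like form that vanishes
on `ξ`. -/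
lemma IsAFrameAt.eq_zero_of_components (he : S.IsAFrameAt p (fun a ↦ e a p))
    (hE : Module.finrank ℝ E = 2 * n + 1) (hT : IsCurvatureLike T)
    (h0 : ∀ y z w, T (S.ξ p) y z w = 0)
    (h₁ : ∀ a b c d, cext₄ T ((S.eps e a).at p) ((S.eps e b).at p) ((S.eps e c).at p)
      ((S.eps e d).at p) = 0)
    (h₂ : ∀ a b c d, cext₄ T ((S.eps e a).at p) ((S.eps e b).at p) ((S.eps e c).at p)
      ((S.epsBar e d).at p) = 0)
    (h₃ : ∀ a b c d, cext₄ T ((S.eps e a).at p) ((S.eps e b).at p) ((S.epsBar e c).at p)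
      ((S.epsBar e d).at p) = 0)
    (h₄ : ∀ a b c d, cext₄ T ((S.eps e a).at p) ((S.epsBar e b).at p) ((S.eps e c).at p)
      ((S.epsBar e d).at p) = 0) (x y z w : TangentSpace 𝓘(ℝ, E) p) : T x y z w = 0 := by
  have k₁ : ∀ a b c d, cext₄ T ((S.epsBar e a).at p) ((S.epsBar e b).at p)
      ((S.epsBar e c).at p) ((S.epsBar e d).at p) = 0 := fun a b c d ↦ by
    simp only [epsBar_at, hT.cext₄_conj, h₁, map_zero]
  have k₂ : ∀ a b c d, cext₄ T ((S.epsBar e a).at p) ((S.epsBar e b).at p)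
      ((S.epsBar e c).at p) ((S.eps e d).at p) = 0 := fun a b c d ↦ by
    rw [eps_at d]
    simp only [epsBar_at (S := S) (e := e) (p := p) a, epsBar_at (S := S) (e := e) (p := p) b,
      epsBar_at (S := S) (e := e) (p := p) c, hT.cext₄_conj, h₂, map_zero]
  refine he.eq_zero_of_cext₄ hE hT h0 ?_ x y z w
  -- All sixteen patterns of barred and unbarred vectors; each reduces to one of the four types, or
  -- to the conjugate of one, by skew and pair symmetry.
  rintro ⟨_ | _, a⟩ ⟨_ | _, b⟩ ⟨_ | _, c⟩ ⟨_ | _, d⟩ <;>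
    simp only [frameVec, if_true, if_false, Bool.false_eq_true]
  · exact k₁ _ _ _ _
  · exact k₂ _ _ _ _
  · rw [hT.cext₄_skew', k₂, neg_zero]
  · rw [hT.cext₄_pair, h₃]
  · rw [hT.cext₄_pair, k₂]
  · rw [hT.cext₄_skew, hT.cext₄_skew', h₄, neg_zero, neg_zero]
  · rw [hT.cext₄_skew, h₄, neg_zero]
  · rw [hT.cext₄_pair, hT.cext₄_skew', h₂, neg_zero]
  · rw [hT.cext₄_pair, hT.cext₄_skew', k₂, neg_zero]
  · rw [hT.cext₄_skew', h₄, neg_zero]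
  · exact h₄ _ _ _ _
  · rw [hT.cext₄_pair, h₂]
  · exact h₃ _ _ _ _
  · rw [hT.cext₄_skew', h₂, neg_zero]
  · exact h₂ _ _ _ _
  · exact h₁ _ _ _ _

variable (S) in
/-- The curvature tensor of the Kenmotsu type manifolds with vanishing generalized curvature
tensor. -/
def modelCurv (κ : ℝ) (p : M) (x y z w : TangentSpace 𝓘(ℝ, E) p) : ℝ :=
  -- This is the curvature tensor of constant curvature -1, plus κ times that of constant curvature
  -- 1 evaluated on the projections of the arguments to ξ^⊥; the terms of degree four in η cancel.
  (κ - 1) * (inner ℝ y z * inner ℝ x w - inner ℝ x z * inner ℝ y w)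
    - κ * (inner ℝ x (S.ξ p) * inner ℝ w (S.ξ p) * inner ℝ y z
      + inner ℝ x w * inner ℝ y (S.ξ p) * inner ℝ z (S.ξ p)
      - inner ℝ x (S.ξ p) * inner ℝ z (S.ξ p) * inner ℝ y w
      - inner ℝ x z * inner ℝ y (S.ξ p) * inner ℝ w (S.ξ p))

variable (S D) in
/-- The deviation of the curvature tensor from `modelCurv`. -/
def curvDev (κ : ℝ) (p : M) (x y z w : TangentSpace 𝓘(ℝ, E) p) : ℝ :=
  inner ℝ (curvature D p x y z) w - S.modelCurv κ p x y z w

lemma isCurvatureLike_curvDev (hD : IsSmoothRiemannianConnection D) (κ : ℝ) :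
    IsCurvatureLike (S.curvDev D κ p) := by
  refine IsCurvatureLike.sub (T := fun x y z w ↦ inner ℝ (curvature D p x y z) w)
    (T' := S.modelCurv κ p) ⟨?_, ?_, ?_, ?_⟩ ⟨?_, ?_, ?_, ?_⟩
  · intro x x' y z w
    rw [hD.curvature_add_left, inner_add_left]
  · intro c x y z w
    rw [hD.curvature_smul_left, inner_smul_left, conj_trivial]
  · intro x y z w
    rw [IsSmoothRiemannianConnection.curvature_swap, inner_neg_left]
  · intro x y z w
    exact IsSmoothRiemannianConnection.inner_curvature_pair x y z w hD
  · intro x x' y z w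
    simp only [modelCurv, inner_add_left]
    ring
  · intro c x y z w
    simp only [modelCurv, inner_smul_left, conj_trivial]
    ring
  · intro x y z w
    simp only [modelCurv]
    ring
  · intro x y z w
    simp only [modelCurv]
    rw [real_inner_comm x z, real_inner_comm y z, real_inner_comm x w, real_inner_comm y w]
    ring

/-- Whatever κ is, the model satisfies the same formula R(z, w)ξ = η(z)w - η(w)z as the curvature;
the pair symmetry brings ξ from the first slot into the third. -/
lemma curvDev_ξ (hD : IsSmoothRiemannianConnection D) (hS : S.IsKenmotsuType D) (κ : ℝ)
    (y z w : TangentSpace 𝓘(ℝ, E) p) : S.curvDev D κ p (S.ξ p) y z w = 0 := by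
  rw [(isCurvatureLike_curvDev hD κ).pair]
  simp only [curvDev, modelCurv, curvature_ξ hD hS, inner_sub_left, inner_smul_left,
    conj_trivial, S.η_ξ]
  rw [real_inner_comm y w, real_inner_comm y z]
  ring

/-- Eigenvectors of Φ with nonzero eigenvalue are orthogonal to ξ, so only the (κ - 1)-part of the
model contributes. -/
lemma cext₄_curvDev (κ : ℝ) {x y z w : Cplx (TangentSpace 𝓘(ℝ, E) p)} {q r s t : ℝ}
    (hq : q ≠ 0) (hr : r ≠ 0) (hs : s ≠ 0) (ht : t ≠ 0) (hx : S.IsTypeAt q x)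
    (hy : S.IsTypeAt r y) (hz : S.IsTypeAt s z) (hw : S.IsTypeAt t w) :
    cext₄ (S.curvDev D κ p) x y z w
      = ccurv D p x y z w
        - (κ - 1) * (cinner y z * cinner x w - cinner x z * cinner y w) := by
  simp only [cext₄, ccurv, ccurv₂, cinner, cext, curvDev, modelCurv, hx.re_inner_ξ hq,
    hx.im_inner_ξ hq, hy.re_inner_ξ hr, hy.im_inner_ξ hr, hz.re_inner_ξ hs, hz.im_inner_ξ hs,
    hw.re_inner_ξ ht, hw.im_inner_ξ ht]
  push_cast
  ring

end AlmostContactMetric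

end Characterization

/-! ### Ricci tensor and generalized curvature tensor on a manifold of Kenmotsu type. -/

section GeneralizedCurvature

variable {E : Type*} [NormedAddCommGroup E] [NormedSpace ℝ E] [FiniteDimensional ℝ E]
  {M : Type*} [TopologicalSpace M] [ChartedSpace E M] [IsManifold 𝓘(ℝ, E) ∞ M]
  [RiemannianBundle (fun p : M ↦ TangentSpace 𝓘(ℝ, E) p)]
  [IsContMDiffRiemannianBundle 𝓘(ℝ, E) ∞ E (fun p : M ↦ TangentSpace 𝓘(ℝ, E) p)]
  {D : CovariantDerivative 𝓘(ℝ, E) E (fun p : M ↦ TangentSpace 𝓘(ℝ, E) p)}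
  {S : AlmostContactMetric E M} {n : ℕ} {p : M}

namespace AlmostContactMetric

lemma sum_inner_self_stdOrthonormalBasis (hE : Module.finrank ℝ E = 2 * n + 1) :
    ∑ i, (inner ℝ (stdOrthonormalBasis ℝ (TangentSpace 𝓘(ℝ, E) p) i)
      (stdOrthonormalBasis ℝ (TangentSpace 𝓘(ℝ, E) p) i) : ℝ) = 2 * n + 1 := by
  have h : Module.finrank ℝ (TangentSpace 𝓘(ℝ, E) p) = 2 * n + 1 := hE
  simp only [OrthonormalBasis.inner_eq_ite, if_true, Finset.sum_const, Finset.card_univ,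
    Fintype.card_fin, h]
  simp

/-- On a manifold of Kenmotsu type, `r(x, ξ) = -2n η(x)`. -/
lemma ricci_ξ_right (hD : IsSmoothRiemannianConnection D) (hS : S.IsKenmotsuType D)
    (hE : Module.finrank ℝ E = 2 * n + 1) (x : TangentSpace 𝓘(ℝ, E) p) :
    ricci D p x (S.ξ p) = -(2 * n) * inner ℝ x (S.ξ p) := by
  unfold ricci
  set b := stdOrthonormalBasis ℝ (TangentSpace 𝓘(ℝ, E) p)
  have h1 : ∑ i, (inner ℝ x (b i) * inner ℝ (b i) (S.ξ p) : ℝ) = inner ℝ x (S.ξ p) :=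
    b.sum_inner_mul_inner x (S.ξ p)
  have h2 : ∑ i, (inner ℝ (b i) (b i) : ℝ) = 2 * n + 1 := sum_inner_self_stdOrthonormalBasis hE
  simp only [curvature_ξ hD hS, inner_sub_left, inner_smul_left, conj_trivial,
    Finset.sum_sub_distrib, ← Finset.mul_sum, h2]
  simp only [mul_comm (inner ℝ (b _) (S.ξ p) : ℝ), h1]
  ring

/-- On a manifold of Kenmotsu type, `r(ξ, x) = -2n η(x)`. -/
lemma ricci_ξ_left (hD : IsSmoothRiemannianConnection D) (hS : S.IsKenmotsuType D)
    (hE : Module.finrank ℝ E = 2 * n + 1) (x : TangentSpace 𝓘(ℝ, E) p) :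
    ricci D p (S.ξ p) x = -(2 * n) * inner ℝ x (S.ξ p) := by
  unfold ricci
  set b := stdOrthonormalBasis ℝ (TangentSpace 𝓘(ℝ, E) p)
  have h1 : ∑ i, (inner ℝ x (b i) * inner ℝ (b i) (S.ξ p) : ℝ) = inner ℝ x (S.ξ p) :=
    b.sum_inner_mul_inner x (S.ξ p)
  have h2 : ∑ i, (inner ℝ (b i) (b i) : ℝ) = 2 * n + 1 := sum_inner_self_stdOrthonormalBasis hE
  -- Pair symmetry moves ξ into the second pair, where R(·, ·)ξ is known.
  have h3 : ∀ i, (inner ℝ (curvature D p (b i) (S.ξ p) x) (b i) : ℝ)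
      = inner ℝ x (b i) * inner ℝ (b i) (S.ξ p) - inner ℝ x (S.ξ p) * inner ℝ (b i) (b i) := by
    intro i
    rw [IsSmoothRiemannianConnection.inner_curvature_pair _ _ _ _ hD,
      IsSmoothRiemannianConnection.inner_curvature_skew _ _ _ _ hD, curvature_ξ hD hS,
      inner_sub_left, inner_smul_left, inner_smul_left, conj_trivial, conj_trivial]
    ring
  simp only [h3, Finset.sum_sub_distrib, ← Finset.mul_sum, h1, h2]
  ring

/-- With R(y, ξ)ξ = η(y)ξ - y and the known values of r on ξ, the only unknown in B(x, ξ, y, ξ) is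
r(x, y), with coefficient a₁; the equation is solved for it. -/
lemma ricci_eq_of_generalizedCurvature_eq_zero (hD : IsSmoothRiemannianConnection D)
    (hS : S.IsKenmotsuType D) (hE : Module.finrank ℝ E = 2 * n + 1) {a₀ a₁ a₂ : ℝ}
    (ha₁ : a₁ ≠ 0) {x y : TangentSpace 𝓘(ℝ, E) p}
    (h : generalizedCurvature D a₀ a₁ a₂ p x (S.ξ p) y (S.ξ p) = 0) :
    ricci D p x y
      = (a₀ + 2 * n * a₁ - 2 * a₂ * scalarCurvature D p) / a₁ * inner ℝ x y
        + -(2 * n + (a₀ + 2 * n * a₁ - 2 * a₂ * scalarCurvature D p) / a₁)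
          * (S.η p x * S.η p y) := by
  have h1 := S.η_ξ p
  simp only [generalizedCurvature, curvature₄, curvature_ξ hD hS, inner_sub_left,
    inner_smul_left, conj_trivial, h1, ricci_ξ_left hD hS hE, ricci_ξ_right hD hS hE] at h
  rw [real_inner_comm x (S.ξ p), real_inner_comm x y, real_inner_comm y (S.ξ p)] at h
  unfold η
  field_simp
  linear_combination h

/-- After substitution of r the tensor g(x, z)g(y, w) - g(x, w)g(y, z) has coefficient 2a₁λ + 2a₂s =
a₁λ + a₀ + 2na₁ = a₀ - a₁μ = a₀(1 - κ), and the η-terms have coefficient a₁μ = a₀κ. The arguments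
are reordered because R(x, y, z, w) = g(R(z, w)y, x). -/
lemma generalizedCurvature_eq {a₀ a₁ a₂ lam mu : ℝ} (ha₀ : a₀ ≠ 0) (ha₁ : a₁ ≠ 0)
    (hr : ∀ x y : TangentSpace 𝓘(ℝ, E) p,
      ricci D p x y = lam * inner ℝ x y + mu * (S.η p x * S.η p y))
    (hlam : lam = (a₀ + 2 * n * a₁ - 2 * a₂ * scalarCurvature D p) / a₁)
    (hmu : mu = -(2 * n + lam)) (x y z w : TangentSpace 𝓘(ℝ, E) p) :
    generalizedCurvature D a₀ a₁ a₂ p x y z w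
      = a₀ * S.curvDev D (a₁ / a₀ * mu) p z w y x := by
  rw [eq_div_iff ha₁] at hlam
  have hκ : a₀ * (a₁ / a₀ * mu) = a₁ * mu := by field_simp
  simp only [generalizedCurvature, curvature₄, hr, curvDev, modelCurv, η]
  rw [real_inner_comm y w, real_inner_comm y z, real_inner_comm x w, real_inner_comm x z]
  generalize a₁ / a₀ * mu = κ at hκ ⊢
  set G : ℝ := inner ℝ x z * inner ℝ y w - inner ℝ x w * inner ℝ y z with hG
  linear_combination (G - (inner ℝ y (S.ξ p) * inner ℝ w (S.ξ p) * inner ℝ x z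
      - inner ℝ y (S.ξ p) * inner ℝ z (S.ξ p) * inner ℝ x w
      + inner ℝ x (S.ξ p) * inner ℝ z (S.ξ p) * inner ℝ y w
      - inner ℝ x (S.ξ p) * inner ℝ w (S.ξ p) * inner ℝ y z)) * hκ + a₁ * G * hmu + G * hlam

end AlmostContactMetric

end GeneralizedCurvature

/-! ### Structure functions against the deviation, and the equivalence. -/

section Main

variable {E : Type*} [NormedAddCommGroup E] [NormedSpace ℝ E] [FiniteDimensional ℝ E]
  {M : Type*} [TopologicalSpace M] [ChartedSpace E M] [IsManifold 𝓘(ℝ, E) ∞ M]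
  [RiemannianBundle (fun p : M ↦ TangentSpace 𝓘(ℝ, E) p)]
  [IsContMDiffRiemannianBundle 𝓘(ℝ, E) ∞ E (fun p : M ↦ TangentSpace 𝓘(ℝ, E) p)]
  {D : CovariantDerivative 𝓘(ℝ, E) E (fun p : M ↦ TangentSpace 𝓘(ℝ, E) p)}
  {S : AlmostContactMetric E M} {n : ℕ} {e : Fin n → VField E M} {p : M}

namespace AlmostContactMetric

/-- The model has no component of this type for any κ. -/
lemma IsAFrameNear.A₁₃_eq_curvDev (hD : IsSmoothRiemannianConnection D)
    (hS : S.IsKenmotsuType D) (hE : Module.finrank ℝ E = 2 * n + 1) (he : S.IsAFrameNear p e)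
    (κ : ℝ) (a b c d : Fin n) :
    S.A₁₃ D e a b c d p
      = 1 / 2 * cext₄ (S.curvDev D κ p) ((S.eps e c).at p) ((S.eps e d).at p) ((S.eps e b).at p)
          ((S.epsBar e a).at p) := by
  have hm : (-1 : ℝ) ≠ 0 := neg_ne_zero.2 one_ne_zero
  rw [he.A₁₃_eq hD hS hE, cext₄_curvDev κ one_ne_zero one_ne_zero one_ne_zero hm
    (he.eps_isType c).at (he.eps_isType d).at (he.eps_isType b).at (he.epsBar_isType a).at,
    he.at.cinner_eps_eps, he.at.cinner_eps_eps]
  ring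

/-- The coefficient κ is the sum of κ - 1 from the model and 1 from the ξ-part of the structure
equations; the same happens for `B₂₂_sub_eq_curvDev`. -/
lemma IsAFrameNear.A₂₂_eq_curvDev (hD : IsSmoothRiemannianConnection D)
    (hS : S.IsKenmotsuType D) (hE : Module.finrank ℝ E = 2 * n + 1) (he : S.IsAFrameNear p e)
    (κ : ℝ) (a b c d : Fin n) :
    S.A₂₂ D e a d b c p
      = ∑ h, S.Bup D e a h c p * S.Bdown D e b h d p + (κ : ℂ) * (delta a c * delta d b)
        + cext₄ (S.curvDev D κ p) ((S.eps e c).at p) ((S.epsBar e d).at p) ((S.eps e b).at p)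
          ((S.epsBar e a).at p) := by
  have hm : (-1 : ℝ) ≠ 0 := neg_ne_zero.2 one_ne_zero
  rw [he.A₂₂_eq hD hS hE, cext₄_curvDev κ one_ne_zero hm one_ne_zero hm
    (he.eps_isType c).at (he.epsBar_isType d).at (he.eps_isType b).at (he.epsBar_isType a).at,
    he.at.cinner_eps_eps, he.at.cinner_epsBar_eps, he.at.cinner_eps_epsBar, delta_comm c a]
  ring

lemma IsAFrameNear.B₂₂_sub_eq_curvDev (hD : IsSmoothRiemannianConnection D)
    (hS : S.IsKenmotsuType D) (hE : Module.finrank ℝ E = 2 * n + 1) (he : S.IsAFrameNear p e)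
    (κ : ℝ) (a b c d : Fin n) :
    (S.B₂₂ D e a b c d p - S.B₂₂ D e a b d c p) / 2
      = (κ : ℂ) * ((delta a c * delta b d - delta a d * delta b c) / 2)
        + 1 / 2 * cext₄ (S.curvDev D κ p) ((S.eps e c).at p) ((S.eps e d).at p)
          ((S.epsBar e b).at p) ((S.epsBar e a).at p) := by
  have hm : (-1 : ℝ) ≠ 0 := neg_ne_zero.2 one_ne_zero
  rw [he.B₂₂_sub hD hS hE, cext₄_curvDev κ one_ne_zero one_ne_zero hm hm
    (he.eps_isType c).at (he.eps_isType d).at (he.epsBar_isType b).at (he.epsBar_isType a).at]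
  simp only [he.at.cinner_eps_epsBar, delta_comm c, delta_comm d]
  ring

lemma IsAFrameNear.cext₄_curvDev_eps (hD : IsSmoothRiemannianConnection D)
    (hS : S.IsKenmotsuType D) (hE : Module.finrank ℝ E = 2 * n + 1) (he : S.IsAFrameNear p e)
    (κ : ℝ) (a b c d : Fin n) :
    cext₄ (S.curvDev D κ p) ((S.eps e a).at p) ((S.eps e b).at p) ((S.eps e c).at p)
      ((S.eps e d).at p) = 0 := by
  rw [cext₄_curvDev κ one_ne_zero one_ne_zero one_ne_zero one_ne_zero
    (he.eps_isType a).at (he.eps_isType b).at (he.eps_isType c).at (he.eps_isType d).at,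
    he.ccurv_eps hD hS hE]
  simp only [he.at.cinner_eps_eps]
  ring

/-- The generalized curvature tensor of a manifold of Kenmotsu type vanishes if and only if the
manifold is `η`-Einstein and its structure functions are the indicated ones. -/
theorem generalizedCurvature_eq_zero_iff (hD : IsRiemannianConnection D)
    (hS : S.IsKenmotsuType D) (hE : Module.finrank ℝ E = 2 * n + 1) {a₀ a₁ a₂ : M → ℝ}
    (ha₀ : ∀ p, a₀ p ≠ 0) (ha₁ : ∀ p, a₁ p ≠ 0) :
    (∀ (p : M) (x y z w : TangentSpace 𝓘(ℝ, E) p),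
        generalizedCurvature D (a₀ p) (a₁ p) (a₂ p) p x y z w = 0) ↔
      ∃ lam mu : M → ℝ,
        S.IsEtaEinsteinWith D lam mu ∧
        (∀ p, lam p =
          (a₀ p + 2 * n * a₁ p - 2 * a₂ p * scalarCurvature D p) / a₁ p) ∧
        (∀ p, mu p = -(2 * n + lam p)) ∧
        ∀ (U : Set M) (e : Fin n → VField E M),
          S.IsAFrame U e → ∀ p ∈ U, ∀ a b c d : Fin n,
            S.A₁₃ D e a b c d p = 0 ∧
            S.A₂₂ D e a d b c p =
              ∑ h, S.Bup D e a h c p * S.Bdown D e b h d p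
                + ((a₁ p / a₀ p * mu p : ℝ) : ℂ) * (delta a c * delta d b) ∧
            (S.B₂₂ D e a b c d p - S.B₂₂ D e a b d c p) / 2 =
              ((a₁ p / a₀ p * mu p : ℝ) : ℂ)
                * ((delta a c * delta b d - delta a d * delta b c) / 2) := by
  have hD' := hD.isSmooth S hE
  constructor
  · intro h
    set lam : M → ℝ := fun p ↦
      (a₀ p + 2 * n * a₁ p - 2 * a₂ p * scalarCurvature D p) / a₁ p with hlam
    set mu : M → ℝ := fun p ↦ -(2 * n + lam p) with hmu
    have hr : S.IsEtaEinsteinWith D lam mu := fun p x y ↦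
      ricci_eq_of_generalizedCurvature_eq_zero hD' hS hE (ha₁ p) (h p x (S.ξ p) y (S.ξ p))
    refine ⟨lam, mu, hr, fun _ ↦ rfl, fun _ ↦ rfl, fun U e he p hp a b c d ↦ ?_⟩
    have he' := he.near hp
    have hQ : S.curvDev D (a₁ p / a₀ p * mu p) p = fun _ _ _ _ ↦ 0 := by
      funext x y z w
      -- This order of arguments turns into x, y, z, w in `generalizedCurvature_eq`.
      have h1 := h p w z x y
      rw [generalizedCurvature_eq (ha₀ p) (ha₁ p) (hr p) rfl rfl] at h1
      exact (mul_eq_zero.1 h1).resolve_left (ha₀ p)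
    have hc : ∀ x y z w, cext₄ (S.curvDev D (a₁ p / a₀ p * mu p) p) x y z w = 0 := by
      intro x y z w
      rw [hQ]
      simp [cext₄, cext]
    refine ⟨?_, ?_, ?_⟩
    · rw [he'.A₁₃_eq_curvDev hD' hS hE, hc, mul_zero]
    · rw [he'.A₂₂_eq_curvDev hD' hS hE (a₁ p / a₀ p * mu p), hc, add_zero]
    · rw [he'.B₂₂_sub_eq_curvDev hD' hS hE (a₁ p / a₀ p * mu p), hc, mul_zero, add_zero]
  · rintro ⟨lam, mu, hr, hlam, hmu, h⟩ p x y z w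
    -- The conditions are assumed in every A-frame, but one around p suffices for the pointwise
    -- conclusion; its existence keeps the assumption from being vacuous.
    obtain ⟨e, he⟩ := exists_isAFrameNear S p hE
    obtain ⟨U, hpU, heU⟩ := he.exists_isAFrame
    have h' := h U e heU p hpU
    rw [generalizedCurvature_eq (ha₀ p) (ha₁ p) (hr p) (hlam p) (hmu p)]
    -- The pure components vanish by the Kenmotsu condition. The remaining three types are supplied,
    -- in the order of the goals, by the conditions on A^a_{bcd}, B^{ab}_{[cd]} and A^{ad}_{bc}.
    refine mul_eq_zero_of_right _ (he.at.eq_zero_of_components hE (isCurvatureLike_curvDev hD' _)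
      (curvDev_ξ hD' hS _) (he.cext₄_curvDev_eps hD' hS hE _) ?_ ?_ ?_ z w y x)
    · intro c d b a
      have h1 := (h' a b c d).1
      rw [he.A₁₃_eq_curvDev hD' hS hE (a₁ p / a₀ p * mu p)] at h1
      simpa using h1
    · intro c d b a
      have h1 := (h' a b c d).2.2
      rw [he.B₂₂_sub_eq_curvDev hD' hS hE (a₁ p / a₀ p * mu p)] at h1
      simpa using h1
    · intro c d b a
      have h1 := (h' a b c d).2.1
      rw [he.A₂₂_eq_curvDev hD' hS hE (a₁ p / a₀ p * mu p)] at h1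
      simpa using h1

end AlmostContactMetric

end Main

end Kenmotsu

end

theorem theorem3p2 (n : ℕ)
    {M : Type*} [TopologicalSpace M] [T2Space M] [SecondCountableTopology M]
    [ChartedSpace (EuclideanSpace ℝ (Fin (2 * n + 1))) M]
    [IsManifold (𝓡 (2 * n + 1)) ∞ M]
    [RiemannianBundle (fun p : M ↦ TangentSpace (𝓡 (2 * n + 1)) p)]
    [IsContMDiffRiemannianBundle (𝓡 (2 * n + 1)) ∞ (EuclideanSpace ℝ (Fin (2 * n + 1)))
      (fun p : M ↦ TangentSpace (𝓡 (2 * n + 1)) p)]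
    (D : CovariantDerivative (𝓡 (2 * n + 1)) (EuclideanSpace ℝ (Fin (2 * n + 1)))
      (fun p : M ↦ TangentSpace (𝓡 (2 * n + 1)) p))
    (hD : Kenmotsu.IsRiemannianConnection D)
    (S : Kenmotsu.AlmostContactMetric (EuclideanSpace ℝ (Fin (2 * n + 1))) M)
    (hS : S.IsKenmotsuType D)
    (a₀ a₁ a₂ : M → ℝ) (ha₀ : ∀ p, a₀ p ≠ 0) (ha₁ : ∀ p, a₁ p ≠ 0) :
    (∀ (p : M) (x y z w : TangentSpace (𝓡 (2 * n + 1)) p),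
        Kenmotsu.generalizedCurvature D (a₀ p) (a₁ p) (a₂ p) p x y z w = 0) ↔
      ∃ lam mu : M → ℝ,
        S.IsEtaEinsteinWith D lam mu ∧
        (∀ p, lam p =
          (a₀ p + 2 * n * a₁ p - 2 * a₂ p * Kenmotsu.scalarCurvature D p) / a₁ p) ∧
        (∀ p, mu p = -(2 * n + lam p)) ∧
        ∀ (U : Set M) (e : Fin n → Π p : M, TangentSpace (𝓡 (2 * n + 1)) p),
          S.IsAFrame U e → ∀ p ∈ U, ∀ a b c d : Fin n,
            S.A₁₃ D e a b c d p = 0 ∧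
            S.A₂₂ D e a d b c p =
              ∑ h, S.Bup D e a h c p * S.Bdown D e b h d p
                + ((a₁ p / a₀ p * mu p : ℝ) : ℂ)
                  * (Kenmotsu.delta a c * Kenmotsu.delta d b) ∧
            (S.B₂₂ D e a b c d p - S.B₂₂ D e a b d c p) / 2 =
              ((a₁ p / a₀ p * mu p : ℝ) : ℂ)
                * ((Kenmotsu.delta a c * Kenmotsu.delta b d
                  - Kenmotsu.delta a d * Kenmotsu.delta b c) / 2) :=
  Kenmotsu.AlmostContactMetric.generalizedCurvature_eq_zero_iff hD hS (by simp) ha₀ ha₁
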